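/- **Bianchi's Bäcklund transformation via common conjugate systems (hyperbolic paraboloid).** *Setting.* Let $\epsilon\in\{1,-1\}$, $a_1>z>0>a_2$ with $a_1^{-1}-a_2^{-1}=1$, and let $x_z(\alpha,\beta)=[\sqrt{a_1-z}\,\alpha,\ \sqrt{-a_2+z}\,\sqrt{\epsilon}\,\beta,\ \tfrac12(\alpha^2-\epsilon\beta^2+z)]^T$ be the confocal paraboloids (the Ivory affinity sends $x_0(\alpha,\beta)$ to $x_z(\alpha,\beta)$). Put $V=[\alpha,\beta]^T$, $H=\epsilon\alpha^2/a_1-\beta^2/a_2+\epsilon$, $\mathcal E=\mathrm{diag}[1,-\epsilon]$, $\mathcal E_1=\mathrm{diag}[1,-\epsilon_1]$, $A'=\mathrm{diag}[a_1^{-1},a_2^{-1}]$, $R'_z=I_2-zA'$, $\delta=\mathrm{diag}[du,dv]$, and $R_j=\begin{bmatrix}\mathbf C_j&\epsilon\mathbf S_j\\ \mathbf S_j&\mathbf C_j\end{bmatrix}$ with $(\mathbf C_j,\mathbf S_j)=(\cosh\theta_j,\sinh\theta_j)$ if $\epsilon=1$ and $(\cos\theta_j,\sin\theta_j)$ if $\epsilon=-1$;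 further $\Omega_j=R_j^{-1}(R_j)_u\,dv+R_j^{-1}(R_j)_v\,du$. Let $U\subset\mathbb R^2$ be a simply connected open set with coordinates $(u,v)$; everything is $C^\infty$ on $U$. A *deformation* is a pair $x:U\to\mathbb R^3$, $V:U\to\mathbb R^2$ with $H(V)>0$, $\det(V_u,V_v)\ne0$ and $|dx|^2=|d(x_0\circ V)|^2$; its normal is $N=(x_\alpha\times x_\beta)/\sqrt{-a_1a_2H}$. Its *angle data* with respect to $(u,v)$ are a function $\theta$ and $\Lambda=[\lambda,\mu]^T$ with $dV=R\delta\Lambda$, $\Lambda^T\mathcal E\Lambda=-V^T\mathcal EA'V-1$ (i.e. $\mu^2-\epsilon\lambda^2=H$), and $\lambda\mu\,N^Tx_{uu}>0$ (orientation). We say that $(u,v)$ is a *common isothermic-conjugate system* if it is conjugate on $x_0\circ V$ and on $x$, and $N^Tx_{uu}=-N^Tx_{vv}$. *Hypotheses.* $(x^0,V_0)$ is a deformation (the seed), $(u,v)$ is a common isothermic-conjugate system for it, with angle data $(\theta_0,\Lambda_0)$. $(x^1,V_1)$ is a *leaf* $B_z(x^0)$: it is a deformation, $x_z(V_1)\in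 T_{x_0(V_0)}x_0$, and $x^1=x^0+[x^0_{\alpha_0}\ x^0_{\beta_0}](\sqrt{R'_z}V_1-V_0)$ on $U$. *Conclusions.* 1. $(x^0,V_0)$ is a leaf $B_z(x^1)$ of $(x^1,V_1)$. The system $(u,v)$ is also a common isothermic-conjugate system for $(x^1,V_1)$, and $(x^1,V_1)$ has angle data $(\theta_1,\Lambda_1)$. 2. There is a sign $\epsilon_1=\pm1$ (constant on $U$; it tells the two families of leaves apart, $x^1=B_{z,\epsilon_1}(x^0)$) such that $$(N^0)^T[dx^0_{\alpha_0}\ dx^0_{\beta_0}](\sqrt{R'_z}V_1-V_0)=\frac{\epsilon_1}{\sqrt{H_0}}\,dV_1^T\begin{bmatrix}0&1\\-1&0\end{bmatrix}(\sqrt{R'_z}V_0-V_1),$$ and the same holds, with the same sign, after exchanging $0\leftrightarrow1$; moreover, with this $\epsilon_1$, the following hold for every choice of angle data $(\theta_1,\Lambda_1)$ of $(x^1,V_1)$. * The second fundamental form of $x^j$ is $\lambda_j\mu_j(du^2-dv^2)/\sqrt{H_j}$, and $d\begin{bmatrix}V_j\\\Lambda_j\end{bmatrix}=\begin{bmatrix}0&R_j\delta\\-\delta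 R_j^{-1}A'&\Omega_j\end{bmatrix}\begin{bmatrix}V_j\\\Lambda_j\end{bmatrix}$, for $j=0,1$. * There is a sign $\epsilon_1'=\pm1$ such that, with $D=\dfrac{\sqrt{R'_z}}{\epsilon_1'\sqrt z}$, $$\begin{bmatrix}V_1\\\Lambda_1\end{bmatrix}=\epsilon_1'\sqrt z\begin{bmatrix}I_2&0\\0&\mathcal E_1R_0^{-1}\end{bmatrix}\begin{bmatrix}D&-I_2\\A'&D\end{bmatrix}\begin{bmatrix}I_2&0\\0&R_1\mathcal E_1\end{bmatrix}\begin{bmatrix}V_0\\\Lambda_0\end{bmatrix},$$ $$dR_1\,\mathcal E_1=-R_1\mathcal E_1\Omega_0-R_1\mathcal E_1\delta R_0^{-1}DR_1\mathcal E_1+DR_0\delta,$$ and both identities also hold with $0\leftrightarrow1$ exchanged, where $\epsilon_0=\epsilon_1$, $\epsilon_0'=-\epsilon_1'$. * $\theta_0$ and $\epsilon_1\theta_1$ solve the hyperbolic sinh-Gordon equation $\theta_{vv}-\theta_{uu}=\cosh\theta\sinh\theta$ (if $\epsilon=1$), respectively the hyperbolic sine-Gordon equation $\theta_{vv}-\theta_{uu}=\cos\theta\sin\theta$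 (if $\epsilon=-1$). There is $\sigma_1\in\mathbb R\setminus\{0\}$ with $\mathrm{diag}\big[\tfrac{\sigma_1-\sigma_1^{-1}}2,\ \tfrac{\sigma_1+\sigma_1^{-1}}2\big]=-D\mathcal E_1$, and $\epsilon_1\theta_1=B_{\sigma_1}(\theta_0)$, $\theta_0=B_{-\sigma_1}(\epsilon_1\theta_1)$, where $\varphi_1=B_\sigma(\varphi_0)$ means $$\varphi_{1v}-\varphi_{0u}=\tfrac12\big(\sigma\,\mathbf S(\varphi_1+\varphi_0)+\sigma^{-1}\mathbf S(\varphi_1-\varphi_0)\big),\qquad \varphi_{1u}-\varphi_{0v}=\tfrac12\big(\sigma\,\mathbf S(\varphi_1+\varphi_0)-\sigma^{-1}\mathbf S(\varphi_1-\varphi_0)\big),$$ with $\mathbf S=\sinh$ (if $\epsilon=1$) or $\mathbf S=\sin$ (if $\epsilon=-1$). For this $\sigma_1$, the matrix equation above for $dR_1\mathcal E_1$, read for arbitrary functions $\varphi_0,\varphi_1$ in place of $\theta_0,\theta_1$, holds at a point where both are differentiable if and only if $\epsilon_1\varphi_1=B_{\sigma_1}(\varphi_0)$ holds there. -/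

import Mathlib

open scoped ContDiff Matrix

noncomputable section

namespace Paraboloid

/-! Surfaces are maps of the parameters `(u, v)`, points of `ℝ × ℝ`. -/

/-- `∂f/∂u`. -/
def partialU {E : Type*} [NormedAddCommGroup E] [NormedSpace ℝ E] (f : ℝ × ℝ → E)
    (p : ℝ × ℝ) : E :=
  fderiv ℝ f p (1, 0)

/-- `∂f/∂v`. -/
def partialV {E : Type*} [NormedAddCommGroup E] [NormedSpace ℝ E] (f : ℝ × ℝ → E)
    (p : ℝ × ℝ) : E :=
  fderiv ℝ f p (0, 1)

/-- The Jacobian matrix, with columns `f_u` and `f_v`. -/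
def jac {m : ℕ} (f : ℝ × ℝ → Fin m → ℝ) (p : ℝ × ℝ) : Matrix (Fin m) (Fin 2) ℝ :=
  Matrix.of fun i j => ![partialU f p i, partialV f p i] j

/-- The differential of a matrix-valued function, evaluated at the vector `ξ = (du, dv)`. -/
def matD {m n : ℕ} (M : ℝ × ℝ → Matrix (Fin m) (Fin n) ℝ) (p ξ : ℝ × ℝ) :
    Matrix (Fin m) (Fin n) ℝ :=
  Matrix.of fun i j => fderiv ℝ (fun q => M q i j) p ξ

/-! ### The confocal paraboloids -/

/-- `√ε` as a complex number: `1` for `ε = 1` and `i` for `ε = -1`. -/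
def sqrtSign (ε : ℝ) : ℂ := ⟨√ε, √(-ε)⟩

/-- The confocal paraboloids `x_z(α, β)`, `V = (α, β)`, in the parametrization that is invariant
under the Ivory affinity: that affinity sends `x_0(V)` to `x_z(V)`.
For `ε = -1` the second coordinate is imaginary. -/
def quadric (ε a₁ a₂ z : ℝ) (V : Fin 2 → ℝ) : Fin 3 → ℂ :=
  ![((√(a₁ - z) * V 0 : ℝ) : ℂ),
    ((√(-a₂ + z) : ℝ) : ℂ) * sqrtSign ε * ((V 1 : ℝ) : ℂ),
    (((V 0 ^ 2 - ε * V 1 ^ 2 + z) / 2 : ℝ) : ℂ)]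

/-- `H = ε α² / a₁ - β² / a₂ + ε`. The linear element of `x_0` is positive definite where
`H > 0`. -/
def quadricH (ε a₁ a₂ : ℝ) (V : Fin 2 → ℝ) : ℝ :=
  ε * V 0 ^ 2 / a₁ - V 1 ^ 2 / a₂ + ε

/-- `diag[1, -s]`. This is `𝓔` for `s = ε`, and `𝓔₁` for `s = ε₁`. -/
def signMat (s : ℝ) : Matrix (Fin 2) (Fin 2) ℝ := Matrix.diagonal ![1, -s]

/-- `A' = diag[1/a₁, 1/a₂]`. -/
def invA (a₁ a₂ : ℝ) : Matrix (Fin 2) (Fin 2) ℝ := Matrix.diagonal ![a₁⁻¹, a₂⁻¹]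

/-- `√R'_z`, where `R'_z = I₂ - z A'`. -/
def sqrtR (a₁ a₂ z : ℝ) : Matrix (Fin 2) (Fin 2) ℝ :=
  Matrix.diagonal ![√(1 - z * a₁⁻¹), √(1 - z * a₂⁻¹)]

/-- `𝐂`: `cosh` for `ε = 1`, `cos` for `ε = -1`. -/
def cosE (ε t : ℝ) : ℝ := if ε = 1 then Real.cosh t else Real.cos t

/-- `𝐒`: `sinh` for `ε = 1`, `sin` for `ε = -1`. -/
def sinE (ε t : ℝ) : ℝ := if ε = 1 then Real.sinh t else Real.sin t

/-- `R = [𝐂, ε𝐒; 𝐒, 𝐂]`. -/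
def rot (ε t : ℝ) : Matrix (Fin 2) (Fin 2) ℝ :=
  !![cosE ε t, ε * sinE ε t; sinE ε t, cosE ε t]

/-- `δ = diag[du, dv]`, evaluated at `ξ = (du, dv)`. -/
def delta (ξ : ℝ × ℝ) : Matrix (Fin 2) (Fin 2) ℝ := Matrix.diagonal ![ξ.1, ξ.2]

/-- `Ω = R⁻¹ R_u dv + R⁻¹ R_v du`, evaluated at `ξ = (du, dv)`. -/
def connOmega (ε : ℝ) (θ : ℝ × ℝ → ℝ) (p ξ : ℝ × ℝ) : Matrix (Fin 2) (Fin 2) ℝ :=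
  (rot ε (θ p))⁻¹ * matD (fun q => rot ε (θ q)) p (ξ.2, ξ.1)

/-! ### Deformations, common conjugate systems, leaves -/

/-- `x ⊂ ℝ³` is a (regular, smooth) deformation of the piece `x_0 ∘ V` of the region `H > 0` of
`x_0`: the two surfaces have the same linear element. -/
structure IsDeformation (ε a₁ a₂ : ℝ) (U : Set (ℝ × ℝ)) (x : ℝ × ℝ → Fin 3 → ℝ)
    (V : ℝ × ℝ → Fin 2 → ℝ) : Prop where
  smooth_x : ContDiffOn ℝ ∞ x U
  smooth_V : ContDiffOn ℝ ∞ V U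
  region : ∀ p ∈ U, 0 < quadricH ε a₁ a₂ (V p)
  regular : ∀ p ∈ U, (jac V p).det ≠ 0
  isometric : ∀ p ∈ U, ∀ ξ : ℝ × ℝ,
    ((fderiv ℝ x p ξ ⬝ᵥ fderiv ℝ x p ξ : ℝ) : ℂ) =
      fderiv ℝ (fun q => quadric ε a₁ a₂ 0 (V q)) p ξ ⬝ᵥ
        fderiv ℝ (fun q => quadric ε a₁ a₂ 0 (V q)) p ξ

/-- The matrix `[x_α  x_β]` of the derivatives of `x` with respect to `V = (α, β)`, by the chain
rule. -/
def frame (x : ℝ × ℝ → Fin 3 → ℝ) (V : ℝ × ℝ → Fin 2 → ℝ) (p : ℝ × ℝ) :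
    Matrix (Fin 3) (Fin 2) ℝ :=
  jac x p * (jac V p)⁻¹

/-- `N = (x_α × x_β) / √(-a₁ a₂ H)`. -/
def normal (ε a₁ a₂ : ℝ) (x : ℝ × ℝ → Fin 3 → ℝ) (V : ℝ × ℝ → Fin 2 → ℝ) (p : ℝ × ℝ) :
    Fin 3 → ℝ :=
  (√(-(a₁ * a₂ * quadricH ε a₁ a₂ (V p))))⁻¹ •
    ((frame x V p)ᵀ 0 ⨯₃ (frame x V p)ᵀ 1)

/-- The second fundamental form `Nᵀ d²x` of `x`, evaluated at `ξ` and `η`. -/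
def secondForm (ε a₁ a₂ : ℝ) (x : ℝ × ℝ → Fin 3 → ℝ) (V : ℝ × ℝ → Fin 2 → ℝ)
    (p ξ η : ℝ × ℝ) : ℝ :=
  normal ε a₁ a₂ x V p ⬝ᵥ fderiv ℝ (fun q => fderiv ℝ x q η) p ξ

/-- `(u, v)` is conjugate on `y` at `p`: the mixed term of the second fundamental form
vanishes, that is, `y_uv` is orthogonal to `y_u × y_v`. -/
def IsConjugateAt {𝕜 : Type*} [RCLike 𝕜] (y : ℝ × ℝ → Fin 3 → 𝕜) (p : ℝ × ℝ) : Prop :=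
  (partialU y p ⨯₃ partialV y p) ⬝ᵥ partialV (partialU y) p = 0

/-- `(u, v)` is a conjugate system common to `x_0 ∘ V` and `x`, and it is isothermic-conjugate on
`x`: the second fundamental form of `x` is a multiple of `du² - dv²`. -/
structure IsIsothermicConjugate (ε a₁ a₂ : ℝ) (U : Set (ℝ × ℝ)) (x : ℝ × ℝ → Fin 3 → ℝ)
    (V : ℝ × ℝ → Fin 2 → ℝ) : Prop where
  conj_quadric : ∀ p ∈ U, IsConjugateAt (fun q => quadric ε a₁ a₂ 0 (V q)) p
  conj : ∀ p ∈ U, IsConjugateAt x p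
  isothermic : ∀ p ∈ U,
    secondForm ε a₁ a₂ x V p (1, 0) (1, 0) = -secondForm ε a₁ a₂ x V p (0, 1) (0, 1)

/-- `θ` is the (hyperbolic) angle between the conjugate systems `(α, β)` and `(u, v)`, and
`Λ = (λ, μ)`: `dV = R δ Λ`. The system `(u, v)` is normalized by
`Λᵀ 𝓔 Λ = -Vᵀ 𝓔 A' V - 1` (that is, `μ² - ε λ² = H`) and oriented so that the `du²` coefficient
of the second fundamental form of `x` has the sign of `λ μ`. -/
structure IsAngleData (ε a₁ a₂ : ℝ) (U : Set (ℝ × ℝ)) (x : ℝ × ℝ → Fin 3 → ℝ)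
    (V : ℝ × ℝ → Fin 2 → ℝ) (θ : ℝ × ℝ → ℝ) (Λ : ℝ × ℝ → Fin 2 → ℝ) : Prop where
  smooth_θ : ContDiffOn ℝ ∞ θ U
  smooth_Λ : ContDiffOn ℝ ∞ Λ U
  angle : ∀ p ∈ U, jac V p = rot ε (θ p) * Matrix.diagonal (Λ p)
  normalized : ∀ p ∈ U,
    Λ p ⬝ᵥ (signMat ε *ᵥ Λ p) = -(V p ⬝ᵥ ((signMat ε * invA a₁ a₂) *ᵥ V p)) - 1
  oriented : ∀ p ∈ U, 0 < Λ p 0 * Λ p 1 * secondForm ε a₁ a₂ x V p (1, 0) (1, 0)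

/-- `x1` is a leaf `B_z(x0)` of the seed `x0`: the points `x_0(V0)` and `x_z(V1)` are in the
tangency configuration `x_z(V1) ∈ T x_0` at `x_0(V0)`; the position of `x1` relative to the
tangent plane of `x0` is that of `x_z(V1)` relative to the tangent plane of `x_0`; and
(applicability correspondence provided by the Ivory affinity) `|dx1|² = |d(x_0 ∘ V1)|²`. -/
structure IsLeaf (ε a₁ a₂ z : ℝ) (U : Set (ℝ × ℝ)) (x0 : ℝ × ℝ → Fin 3 → ℝ)
    (V0 : ℝ × ℝ → Fin 2 → ℝ) (x1 : ℝ × ℝ → Fin 3 → ℝ) (V1 : ℝ × ℝ → Fin 2 → ℝ) : Prop where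
  tangency : ∀ p ∈ U, ∃ ξ : Fin 2 → ℝ,
    quadric ε a₁ a₂ z (V1 p) =
      quadric ε a₁ a₂ 0 (V0 p) + fderiv ℝ (quadric ε a₁ a₂ 0) (V0 p) ξ
  position : ∀ p ∈ U,
    x1 p = x0 p + frame x0 V0 p *ᵥ (sqrtR a₁ a₂ z *ᵥ V1 p - V0 p)
  deformation : IsDeformation ε a₁ a₂ U x1 V1

/-- The sign `s` that tells the two families of leaves apart:
`Nᵀ [dx_α  dx_β] (√R'_z V1 - V0) = (s / √H0) dV1ᵀ [0, 1; -1, 0] (√R'_z V0 - V1)`,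
with `N`, `x_α`, `x_β` taken on `x0`. -/
def HasLeafSign (ε a₁ a₂ z s : ℝ) (U : Set (ℝ × ℝ)) (x0 : ℝ × ℝ → Fin 3 → ℝ)
    (V0 V1 : ℝ × ℝ → Fin 2 → ℝ) : Prop :=
  ∀ p ∈ U, ∀ ξ : ℝ × ℝ,
    normal ε a₁ a₂ x0 V0 p ⬝ᵥ
        (matD (frame x0 V0) p ξ *ᵥ (sqrtR a₁ a₂ z *ᵥ V1 p - V0 p)) =
      s / √(quadricH ε a₁ a₂ (V0 p)) *
        (fderiv ℝ V1 p ξ ⬝ᵥ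
          ((!![0, 1; -1, 0] : Matrix (Fin 2) (Fin 2) ℝ) *ᵥ (sqrtR a₁ a₂ z *ᵥ V0 p - V1 p)))

/-- The second fundamental form of `x` is `λ μ (du² - dv²) / √H`. -/
def HasSecondForm (ε a₁ a₂ : ℝ) (U : Set (ℝ × ℝ)) (x : ℝ × ℝ → Fin 3 → ℝ)
    (V Λ : ℝ × ℝ → Fin 2 → ℝ) : Prop :=
  ∀ p ∈ U, ∀ ξ η : ℝ × ℝ,
    secondForm ε a₁ a₂ x V p ξ η =
      Λ p 0 * Λ p 1 / √(quadricH ε a₁ a₂ (V p)) * (ξ.1 * η.1 - ξ.2 * η.2)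

/-! ### The analytic side -/

/-- The linear system `d[V; Λ] = [0, R δ; -δ R⁻¹ A', Ω] [V; Λ]`. -/
def SolvesLinearSystem (ε a₁ a₂ : ℝ) (U : Set (ℝ × ℝ)) (V : ℝ × ℝ → Fin 2 → ℝ)
    (θ : ℝ × ℝ → ℝ) (Λ : ℝ × ℝ → Fin 2 → ℝ) : Prop :=
  ∀ p ∈ U, ∀ ξ : ℝ × ℝ,
    Sum.elim (fderiv ℝ V p ξ) (fderiv ℝ Λ p ξ) =
      Matrix.fromBlocks 0 (rot ε (θ p) * delta ξ)
          (-(delta ξ * (rot ε (θ p))⁻¹ * invA a₁ a₂)) (connOmega ε θ p ξ) *ᵥ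
        Sum.elim (V p) (Λ p)

/-- The hyperbolic sinh-Gordon equation `θ_vv - θ_uu = cosh θ sinh θ` (`ε = 1`), respectively the
hyperbolic sine-Gordon equation `ω_vv - ω_uu = cos ω sin ω` (`ε = -1`). -/
def SolvesGordon (ε : ℝ) (U : Set (ℝ × ℝ)) (θ : ℝ × ℝ → ℝ) : Prop :=
  ∀ p ∈ U, partialV (partialV θ) p - partialU (partialU θ) p = cosE ε (θ p) * sinE ε (θ p)

/-- The classical Bäcklund transformation `φ1 = B_σ(φ0)` of the sinh-Gordon (`ε = 1`),
respectively sine-Gordon (`ε = -1`) equation, at the point `p`. -/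
def IsBacklundAt (ε σ : ℝ) (φ0 φ1 : ℝ × ℝ → ℝ) (p : ℝ × ℝ) : Prop :=
  partialV φ1 p - partialU φ0 p =
      (σ * sinE ε (φ1 p + φ0 p) + σ⁻¹ * sinE ε (φ1 p - φ0 p)) / 2 ∧
    partialU φ1 p - partialV φ0 p =
      (σ * sinE ε (φ1 p + φ0 p) - σ⁻¹ * sinE ε (φ1 p - φ0 p)) / 2

/-- `D = √R'_z / (s' √z)`. -/
def matDz (a₁ a₂ z s' : ℝ) : Matrix (Fin 2) (Fin 2) ℝ :=
  (s' * √z)⁻¹ • sqrtR a₁ a₂ z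

/-- The Bäcklund transformation in matrix form at the point `p`, with `𝓔₁ = diag[1, -s]`:
`dR1 𝓔₁ = -R1 𝓔₁ Ω0 - R1 𝓔₁ δ R0⁻¹ D R1 𝓔₁ + D R0 δ`. -/
def IsMatrixBacklundAt (ε s : ℝ) (D : Matrix (Fin 2) (Fin 2) ℝ) (θ0 θ1 : ℝ × ℝ → ℝ)
    (p : ℝ × ℝ) : Prop :=
  ∀ ξ : ℝ × ℝ,
    matD (fun q => rot ε (θ1 q)) p ξ * signMat s =
      -(rot ε (θ1 p) * signMat s * connOmega ε θ0 p ξ)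
        - rot ε (θ1 p) * signMat s * delta ξ * (rot ε (θ0 p))⁻¹ * D * rot ε (θ1 p) * signMat s
        + D * rot ε (θ0 p) * delta ξ

/-- The algebraic transformation, with `𝓔₁ = diag[1, -s]` and `D = √R'_z / (s' √z)`:
`[V1; Λ1] = s' √z [I, 0; 0, 𝓔₁ R0⁻¹] [D, -I; A', D] [I, 0; 0, R1 𝓔₁] [V0; Λ0]`. -/
def IsAlgebraicTransform (ε a₁ a₂ z s s' : ℝ) (U : Set (ℝ × ℝ))
    (V0 : ℝ × ℝ → Fin 2 → ℝ) (θ0 : ℝ × ℝ → ℝ) (Λ0 : ℝ × ℝ → Fin 2 → ℝ)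
    (V1 : ℝ × ℝ → Fin 2 → ℝ) (θ1 : ℝ × ℝ → ℝ) (Λ1 : ℝ × ℝ → Fin 2 → ℝ) : Prop :=
  ∀ p ∈ U,
    Sum.elim (V1 p) (Λ1 p) =
      (s' * √z) •
        ((Matrix.fromBlocks 1 0 0 (signMat s * (rot ε (θ0 p))⁻¹) *
            Matrix.fromBlocks (matDz a₁ a₂ z s') (-1) (invA a₁ a₂) (matDz a₁ a₂ z s') *
            Matrix.fromBlocks 1 0 0 (rot ε (θ1 p) * signMat s)) *ᵥ
          Sum.elim (V0 p) (Λ0 p))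

end Paraboloid

end

/-!
Throughout, `Γ = ε A' V / H`, `ω = [0, 1; -1, 0]`, and the two chords are `ξ = √R'_z V1 - V0`
(`x1 - x0` in the frame of the seed) and `ξ' = √R'_z V0 - V1`.

*Structure equations.* A deformation has the linear element of `x_0`, whose Christoffel symbols are
`𝓔_{ij} Γ^k`; this is the Gauss formula `fderiv_frameCol`. For a common isothermic-conjugate system
the Gauss equation fixes the second fundamental form up to sign (`hasSecondForm_of_isothermic`).
From `dV = R δ Λ` and the normalization of `Λ` one obtains the linear system
(`IsAngleData.fderiv_Λ`), and its integrability condition `λ_uv = λ_vu` is the Gordon equation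
(`IsAngleData.solvesGordon`).

*The leaf.* The tangency condition is an equation symmetric in `V0` and `V1` (`tangency_iff`), and
it fixes the `𝓔`-lengths of the chords: `ξ'ᵀ 𝓔 ξ' = -ε z H0`. With its derivative, the differential
of the leaf becomes `dx1 = [x_α x_β] (√R'_z - Γ ξ'ᵀ 𝓔) dV1 + τ N0` (`IsLeaf.fderiv_eq`). Since the
leaf has the linear element of `x_0`, `τ² = (dV1ᵀ ω ξ')² / H0`, so `τ` is the root up to a sign `s`,
which is constant because `U` is connected (`IsLeaf.exists_sign`). This sign is `ε₁`. The frame of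
the leaf is now known in the frame of the seed, from which the symmetry between seed and leaf
follows (`IsLeaf.symm`, `IsLeaf.hasNormalComponent_symm`).

*The conjugate system.* The differentiated tangency condition and the formula for `τ` determine
`dV1`: with `ζ = R0⁻¹ ξ` (`chordAngle`) there is a vector `b` (`leafDir`) with `V1_u = ζ₀ b` and
`V1_v = -s ζ₁ (ε b₁, b₀)` (`IsLeaf.partials`). So `(u, v)` is conjugate on `x_0 ∘ V1`, and a
computation in the frame of the seed gives `N1 · x1_uv = 0` (`IsLeaf.secondForm_mixed`). The
diagonal of the second fundamental form comes from the normal component of the differential of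
the seed in the frame of the leaf (`IsLeaf.secondForm_diagonal`).

*The transformation.* The vector `√z b` lies on the conic `c² - ε σ² = 1`, hence it is `±(𝐂, 𝐒)(θ1)`
for a smooth function `θ1`: an `arsinh` for `ε = 1`, a lift through `ℝ → S¹` for `ε = -1`, which
is where `U` has to be simply connected (`exists_arg_cosE_sinE`). For any angle data of the leaf
the chords are `ξ' = s' √z R1 𝓔₁ Λ0` and `ξ = -s' √z R0 𝓔₁ Λ1` (`IsLeaf.exists_chord_eq`). Solved
for `V1` and `Λ1` these are the algebraic transformation, differentiated they are the Bäcklund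
transformation in matrix form. The two equations go over into each other under the exchange of
seed and leaf with `s'` replaced by `-s'`, which gives the inverse transformation. Since
`a₁⁻¹ - a₂⁻¹ = 1`, the entries of `D = diag[d₁, d₂]` satisfy `d₂² - d₁² = 1`; then
`σ₁ = s d₂ - d₁` has the inverse `s d₂ + d₁`, and with this parameter the matrix form is the
classical form (`isMatrixBacklundAt_iff_isBacklundAt`).
-/

namespace Paraboloid

/-! ### The functions `𝐂`, `𝐒` and the matrices `R`, `Ω` -/

section Trig
variable {ε : ℝ}

lemma eps_mul_self (hε : ε = 1 ∨ ε = -1) : ε * ε = 1 := by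
  rcases hε with rfl | rfl <;> norm_num

lemma cosE_sq_sub (hε : ε = 1 ∨ ε = -1) (t : ℝ) : cosE ε t ^ 2 - ε * sinE ε t ^ 2 = 1 := by
  rcases hε with rfl | rfl
  · simp [cosE, sinE, Real.cosh_sq]
  · have h : (-1 : ℝ) ≠ 1 := by norm_num
    simp [cosE, sinE, h]

lemma hasDerivAt_cosE (hε : ε = 1 ∨ ε = -1) (t : ℝ) :
    HasDerivAt (cosE ε) (ε * sinE ε t) t := by
  rcases hε with rfl | rfl
  · have : cosE 1 = Real.cosh := by funext t; simp [cosE]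
    simpa [this, sinE] using Real.hasDerivAt_cosh t
  · have h : (-1 : ℝ) ≠ 1 := by norm_num
    have : cosE (-1) = Real.cos := by funext t; simp [cosE, h]
    simpa [this, sinE, h] using Real.hasDerivAt_cos t

lemma hasDerivAt_sinE (hε : ε = 1 ∨ ε = -1) (t : ℝ) :
    HasDerivAt (sinE ε) (cosE ε t) t := by
  rcases hε with rfl | rfl
  · have : sinE 1 = Real.sinh := by funext t; simp [sinE]
    simpa [this, cosE] using Real.hasDerivAt_sinh t
  · have h : (-1 : ℝ) ≠ 1 := by norm_num
    have : sinE (-1) = Real.sin := by funext t; simp [sinE, h]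
    simpa [this, cosE, h] using Real.hasDerivAt_sin t

lemma contDiff_cosE (ε : ℝ) : ContDiff ℝ ∞ (cosE ε) := by
  unfold cosE
  split_ifs
  exacts [Real.contDiff_cosh, Real.contDiff_cos]

lemma contDiff_sinE (ε : ℝ) : ContDiff ℝ ∞ (sinE ε) := by
  unfold sinE
  split_ifs
  exacts [Real.contDiff_sinh, Real.contDiff_sin]

lemma sinE_add (hε : ε = 1 ∨ ε = -1) (s t : ℝ) :
    sinE ε (s + t) = sinE ε s * cosE ε t + cosE ε s * sinE ε t := by
  rcases hε with rfl | rfl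
  · simp [cosE, sinE, Real.sinh_add]
  · have h : (-1 : ℝ) ≠ 1 := by norm_num
    simp [cosE, sinE, h, Real.sin_add]

lemma sinE_neg (t : ℝ) : sinE ε (-t) = -sinE ε t := by
  unfold sinE; split_ifs <;> simp

lemma cosE_neg (t : ℝ) : cosE ε (-t) = cosE ε t := by
  unfold cosE; split_ifs <;> simp

lemma sinE_sub (hε : ε = 1 ∨ ε = -1) (s t : ℝ) :
    sinE ε (s - t) = sinE ε s * cosE ε t - cosE ε s * sinE ε t := by
  rw [sub_eq_add_neg, sinE_add hε, sinE_neg, cosE_neg]; ring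

lemma sinE_sign_mul {s : ℝ} (hs : s = 1 ∨ s = -1) (t : ℝ) : sinE ε (s * t) = s * sinE ε t := by
  rcases hs with rfl | rfl <;> simp [sinE_neg]

lemma cosE_sign_mul {s : ℝ} (hs : s = 1 ∨ s = -1) (t : ℝ) : cosE ε (s * t) = cosE ε t := by
  rcases hs with rfl | rfl <;> simp [cosE_neg]

lemma det_rot (hε : ε = 1 ∨ ε = -1) (t : ℝ) : (rot ε t).det = 1 := by
  rw [rot, Matrix.det_fin_two_of]
  linear_combination cosE_sq_sub hε t

lemma rot_inv (hε : ε = 1 ∨ ε = -1) (t : ℝ) :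
    (rot ε t)⁻¹ = !![cosE ε t, -(ε * sinE ε t); -sinE ε t, cosE ε t] := by
  rw [Matrix.inv_def, det_rot hε, rot, Matrix.adjugate_fin_two_of]
  simp

lemma matD_rot (hε : ε = 1 ∨ ε = -1) {φ : ℝ × ℝ → ℝ} {p : ℝ × ℝ} (hφ : DifferentiableAt ℝ φ p)
    (ξ : ℝ × ℝ) :
    matD (fun q => rot ε (φ q)) p ξ =
      fderiv ℝ φ p ξ • !![ε * sinE ε (φ p), ε * cosE ε (φ p); cosE ε (φ p), ε * sinE ε (φ p)] := by
  have hc : HasFDerivAt (fun q => cosE ε (φ q)) _ p :=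
    (hasDerivAt_cosE hε (φ p)).comp_hasFDerivAt p hφ.hasFDerivAt
  have hs : HasFDerivAt (fun q => sinE ε (φ q)) _ p :=
    (hasDerivAt_sinE hε (φ p)).comp_hasFDerivAt p hφ.hasFDerivAt
  have hs' := hs.const_mul ε
  ext i j
  fin_cases i <;> fin_cases j
  · simpa [matD, rot, mul_comm] using congrArg (fun L => L ξ) hc.fderiv
  · have := congrArg (fun L => L ξ) hs'.fderiv
    simp [matD, rot] at this ⊢
    rw [this]; ring
  · simpa [matD, rot, mul_comm] using congrArg (fun L => L ξ) hs.fderiv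
  · simpa [matD, rot, mul_comm] using congrArg (fun L => L ξ) hc.fderiv

/-- `R⁻¹ dR` is the angle differential times the constant matrix `[0, ε; 1, 0]`, and `Ω` is the
same with `du` and `dv` exchanged. -/
lemma connOmega_eq (hε : ε = 1 ∨ ε = -1) {φ : ℝ × ℝ → ℝ} {p : ℝ × ℝ}
    (hφ : DifferentiableAt ℝ φ p) (ξ : ℝ × ℝ) :
    connOmega ε φ p ξ = !![0, ε * fderiv ℝ φ p (ξ.2, ξ.1); fderiv ℝ φ p (ξ.2, ξ.1), 0] := by
  have h := cosE_sq_sub hε (φ p)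
  rw [connOmega, rot_inv hε, matD_rot hε hφ]
  generalize fderiv ℝ φ p (ξ.2, ξ.1) = t
  ext i j
  fin_cases i <;> fin_cases j
  · simp [Matrix.mul_apply, Fin.sum_univ_two]; ring
  · simp [Matrix.mul_apply, Fin.sum_univ_two]; linear_combination ε * t * h
  · simp [Matrix.mul_apply, Fin.sum_univ_two]; linear_combination t * h
  · simp [Matrix.mul_apply, Fin.sum_univ_two]; ring

end Trig

/-! ### Calculus on open subsets of the parameter plane -/

section Calculus
variable {E : Type*} [NormedAddCommGroup E] [NormedSpace ℝ E] {U : Set (ℝ × ℝ)} {p : ℝ × ℝ}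

lemma fderiv_eq_partials (f : ℝ × ℝ → E) (p ξ : ℝ × ℝ) :
    fderiv ℝ f p ξ = ξ.1 • partialU f p + ξ.2 • partialV f p := by
  rw [partialU, partialV, ← map_smul, ← map_smul, ← map_add]
  simp

lemma differentiableAt_of_smoothOn {f : ℝ × ℝ → E} (hU : IsOpen U) (hf : ContDiffOn ℝ ∞ f U)
    (hp : p ∈ U) : DifferentiableAt ℝ f p :=
  (hf.contDiffAt (hU.mem_nhds hp)).differentiableAt (by simp)

lemma smoothOn_fderiv_apply {f : ℝ × ℝ → E} (hU : IsOpen U) (hf : ContDiffOn ℝ ∞ f U)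
    (ξ : ℝ × ℝ) : ContDiffOn ℝ ∞ (fun q => fderiv ℝ f q ξ) U :=
  (hf.fderiv_of_isOpen hU (by simp)).clm_apply contDiffOn_const

/-- Symmetry of the second derivatives, `∂_ξ ∂_η f = ∂_η ∂_ξ f`. -/
lemma fderiv_fderiv_comm {f : ℝ × ℝ → E} (hU : IsOpen U) (hf : ContDiffOn ℝ ∞ f U)
    (hp : p ∈ U) (ξ η : ℝ × ℝ) :
    fderiv ℝ (fun q => fderiv ℝ f q η) p ξ = fderiv ℝ (fun q => fderiv ℝ f q ξ) p η := by
  have hd : DifferentiableAt ℝ (fderiv ℝ f) p :=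
    differentiableAt_of_smoothOn hU (hf.fderiv_of_isOpen hU (by simp)) hp
  have h (η : ℝ × ℝ) (ξ : ℝ × ℝ) :
      fderiv ℝ (fun q => fderiv ℝ f q η) p ξ = fderiv ℝ (fderiv ℝ f) p ξ η := by
    rw [fderiv_clm_apply hd (differentiableAt_const η)]
    simp
  rw [h, h]
  exact ((hf.contDiffAt (hU.mem_nhds hp)).isSymmSndFDerivAt
    (by simpa using ENat.LEInfty.out)).eq ξ η

lemma fderiv_congr_on {f g : ℝ × ℝ → E} (hU : IsOpen U) (hp : p ∈ U)
    (h : ∀ q ∈ U, f q = g q) : fderiv ℝ f p = fderiv ℝ g p :=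
  Filter.EventuallyEq.fderiv_eq (Filter.eventuallyEq_of_mem (hU.mem_nhds hp) h)

lemma fderiv_apply_coord {n : ℕ} {f : ℝ × ℝ → Fin n → ℝ} (hf : DifferentiableAt ℝ f p)
    (ξ : ℝ × ℝ) (i : Fin n) : fderiv ℝ f p ξ i = fderiv ℝ (fun q => f q i) p ξ := by
  rw [fderiv_apply hf]; rfl

lemma differentiableAt_coord {n : ℕ} {f : ℝ × ℝ → Fin n → ℝ} (hf : DifferentiableAt ℝ f p)
    (i : Fin n) : DifferentiableAt ℝ (fun q => f q i) p :=
  differentiableAt_pi.1 hf i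

lemma smoothOn_coord {n : ℕ} {f : ℝ × ℝ → Fin n → ℝ} (hf : ContDiffOn ℝ ∞ f U)
    (i : Fin n) : ContDiffOn ℝ ∞ (fun q => f q i) U :=
  contDiffOn_pi.1 hf i

lemma fderiv_mul_apply {f g : ℝ × ℝ → ℝ} (hf : DifferentiableAt ℝ f p)
    (hg : DifferentiableAt ℝ g p) (ξ : ℝ × ℝ) :
    fderiv ℝ (fun q => f q * g q) p ξ = fderiv ℝ f p ξ * g p + f p * fderiv ℝ g p ξ := by
  rw [fderiv_fun_mul hf hg]; simp; ring

lemma fderiv_dotProduct {n : ℕ} {f g : ℝ × ℝ → Fin n → ℝ} (hf : DifferentiableAt ℝ f p)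
    (hg : DifferentiableAt ℝ g p) (ξ : ℝ × ℝ) :
    fderiv ℝ (fun q => f q ⬝ᵥ g q) p ξ = fderiv ℝ f p ξ ⬝ᵥ g p + f p ⬝ᵥ fderiv ℝ g p ξ := by
  simp only [dotProduct]
  have h (i : Fin n) : DifferentiableAt ℝ (fun q => f q i * g q i) p :=
    (differentiableAt_coord hf i).mul (differentiableAt_coord hg i)
  rw [fderiv_fun_sum fun i _ => h i,
    _root_.sum_apply, ← Finset.sum_add_distrib]
  refine Finset.sum_congr rfl fun i _ => ?_
  rw [fderiv_mul_apply (differentiableAt_coord hf i) (differentiableAt_coord hg i),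
    fderiv_apply_coord hf, fderiv_apply_coord hg]

lemma fderiv_smul_apply {f : ℝ × ℝ → ℝ} {g : ℝ × ℝ → E} (hf : DifferentiableAt ℝ f p)
    (hg : DifferentiableAt ℝ g p) (ξ : ℝ × ℝ) :
    fderiv ℝ (fun q => f q • g q) p ξ = fderiv ℝ f p ξ • g p + f p • fderiv ℝ g p ξ := by
  rw [fderiv_fun_smul hf hg]; simp; abel

end Calculus

/-! ### The differential of the confocal paraboloids -/

section Quadric
variable {ε a₁ a₂ z : ℝ}

lemma sqrtSign_mul_self (hε : ε = 1 ∨ ε = -1) : sqrtSign ε * sqrtSign ε = (ε : ℂ) := by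
  have h : √(-1 : ℝ) = 0 := Real.sqrt_eq_zero_of_nonpos (by norm_num)
  rcases hε with rfl | rfl <;> apply Complex.ext <;> simp [sqrtSign, h]

lemma sqrtSign_ne_zero (hε : ε = 1 ∨ ε = -1) : sqrtSign ε ≠ 0 := by
  intro h
  have := sqrtSign_mul_self hε
  rw [h] at this
  rcases hε with rfl | rfl <;> simp at this

/-- The components of the differential of `x_z`. -/
noncomputable def quadricDeriv (ε a₁ a₂ z : ℝ) (V w : Fin 2 → ℝ) : Fin 3 → ℂ :=
  ![((√(a₁ - z) * w 0 : ℝ) : ℂ),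
    ((√(-a₂ + z) : ℝ) : ℂ) * sqrtSign ε * ((w 1 : ℝ) : ℂ),
    ((V 0 * w 0 - ε * V 1 * w 1 : ℝ) : ℂ)]

lemma fderiv_quadric {E : Type*} [NormedAddCommGroup E] [NormedSpace ℝ E]
    {V : E → Fin 2 → ℝ} {p : E} (hV : DifferentiableAt ℝ V p) :
    DifferentiableAt ℝ (fun q => quadric ε a₁ a₂ z (V q)) p ∧ ∀ ξ,
      fderiv ℝ (fun q => quadric ε a₁ a₂ z (V q)) p ξ =
        quadricDeriv ε a₁ a₂ z (V p) (fderiv ℝ V p ξ) := by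
  have h0 : HasFDerivAt (fun q => V q 0) _ p := hasFDerivAt_pi'.1 hV.hasFDerivAt 0
  have h1 : HasFDerivAt (fun q => V q 1) _ p := hasFDerivAt_pi'.1 hV.hasFDerivAt 1
  have c0 : HasFDerivAt (fun q => quadric ε a₁ a₂ z (V q) 0) _ p :=
    Complex.ofRealCLM.hasFDerivAt.comp p (h0.const_mul √(a₁ - z))
  have c1 : HasFDerivAt (fun q => quadric ε a₁ a₂ z (V q) 1) _ p :=
    (Complex.ofRealCLM.hasFDerivAt.comp p h1).const_mul (((√(-a₂ + z) : ℝ) : ℂ) * sqrtSign ε)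
  have c2 : HasFDerivAt (fun q => quadric ε a₁ a₂ z (V q) 2) _ p :=
    Complex.ofRealCLM.hasFDerivAt.comp p
      ((((h0.pow 2).sub ((h1.pow 2).const_mul ε)).add_const z).mul_const (2⁻¹ : ℝ))
  have hd : DifferentiableAt ℝ (fun q => quadric ε a₁ a₂ z (V q)) p := by
    refine differentiableAt_pi.2 fun i => ?_
    fin_cases i
    exacts [c0.differentiableAt, c1.differentiableAt, c2.differentiableAt]
  refine ⟨hd, fun ξ => ?_⟩
  funext i
  have hi : fderiv ℝ (fun q => quadric ε a₁ a₂ z (V q)) p ξ i =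
      fderiv ℝ (fun q => quadric ε a₁ a₂ z (V q) i) p ξ := by
    rw [fderiv_apply hd]; rfl
  rw [hi]
  fin_cases i
  · simp only [Fin.zero_eta]
    rw [c0.fderiv]; simp [quadricDeriv]
  · simp only [Fin.mk_one]
    rw [c1.fderiv]; simp [quadricDeriv]
  · simp only [Fin.reduceFinMk]
    rw [c2.fderiv]; simp [quadricDeriv]; ring

end Quadric

/-! ### The frame of a deformation and its Gram matrix -/

section Deformation
variable {ε a₁ a₂ : ℝ} {U : Set (ℝ × ℝ)} {x : ℝ × ℝ → Fin 3 → ℝ} {V : ℝ × ℝ → Fin 2 → ℝ}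
  {p : ℝ × ℝ}

/-- The derivatives `x_α` (`j = 0`) and `x_β` (`j = 1`). -/
noncomputable def frameCol (x : ℝ × ℝ → Fin 3 → ℝ) (V : ℝ × ℝ → Fin 2 → ℝ) (j : Fin 2) (p : ℝ × ℝ) :
    Fin 3 → ℝ :=
  (frame x V p)ᵀ j

/-- The linear element of `x_0` in the coordinates `V`. -/
noncomputable def metric (ε a₁ a₂ : ℝ) (V : Fin 2 → ℝ) (v w : Fin 2 → ℝ) : ℝ :=
  a₁ * v 0 * w 0 - ε * a₂ * v 1 * w 1 + (V 0 * v 0 - ε * V 1 * v 1) * (V 0 * w 0 - ε * V 1 * w 1)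

lemma frame_mulVec (w : Fin 2 → ℝ) :
    frame x V p *ᵥ w = w 0 • frameCol x V 0 p + w 1 • frameCol x V 1 p := by
  ext i
  simp [Matrix.mulVec, dotProduct, Fin.sum_univ_two, frameCol, mul_comm]

lemma det_jac (V : ℝ × ℝ → Fin 2 → ℝ) (p : ℝ × ℝ) :
    (jac V p).det = partialU V p 0 * partialV V p 1 - partialV V p 0 * partialU V p 1 := by
  rw [Matrix.det_fin_two]; simp [jac]

/-- The chain rule `dx = [x_α x_β] dV`. -/
lemma fderiv_eq_frame (h : (jac V p).det ≠ 0) (ξ : ℝ × ℝ) :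
    fderiv ℝ x p ξ =
      fderiv ℝ V p ξ 0 • frameCol x V 0 p + fderiv ℝ V p ξ 1 • frameCol x V 1 p := by
  have hm : frame x V p * jac V p = jac x p := by
    rw [frame, Matrix.mul_assoc, Matrix.nonsing_inv_mul _ (isUnit_iff_ne_zero.2 h), Matrix.mul_one]
  have hu : partialU x p =
      partialU V p 0 • frameCol x V 0 p + partialU V p 1 • frameCol x V 1 p := by
    ext i
    have := congrFun (congrFun hm i) 0
    simp [Matrix.mul_apply, Fin.sum_univ_two, jac] at this
    simp [frameCol, ← this, mul_comm]
  have hv : partialV x p =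
      partialV V p 0 • frameCol x V 0 p + partialV V p 1 • frameCol x V 1 p := by
    ext i
    have := congrFun (congrFun hm i) 1
    simp [Matrix.mul_apply, Fin.sum_univ_two, jac] at this
    simp [frameCol, ← this, mul_comm]
  rw [fderiv_eq_partials x, fderiv_eq_partials V, hu, hv]
  ext i
  simp; ring

/-- `V` is a local coordinate system, so `dV` takes every value; this is used to read off
coefficients of `dα` and `dβ`. -/
lemma exists_fderiv_eq (h : (jac V p).det ≠ 0) (w : Fin 2 → ℝ) : ∃ ξ, fderiv ℝ V p ξ = w := by
  rw [det_jac] at h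
  set d := partialU V p 0 * partialV V p 1 - partialV V p 0 * partialU V p 1 with hd
  refine ⟨((w 0 * partialV V p 1 - w 1 * partialV V p 0) / d,
    (w 1 * partialU V p 0 - w 0 * partialU V p 1) / d), ?_⟩
  rw [fderiv_eq_partials]
  ext i
  fin_cases i
  · simp; field_simp; rw [hd]; ring
  · simp; field_simp; rw [hd]; ring

lemma smoothOn_frameCol (hU : IsOpen U) (hx : ContDiffOn ℝ ∞ x U) (hV : ContDiffOn ℝ ∞ V U)
    (h : ∀ p ∈ U, (jac V p).det ≠ 0) (j : Fin 2) : ContDiffOn ℝ ∞ (frameCol x V j) U := by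
  have V' (i : Fin 2) (ξ : ℝ × ℝ) : ContDiffOn ℝ ∞ (fun q => fderiv ℝ V q ξ i) U :=
    smoothOn_coord (smoothOn_fderiv_apply hU hV ξ) i
  have x' (i : Fin 3) (ξ : ℝ × ℝ) : ContDiffOn ℝ ∞ (fun q => fderiv ℝ x q ξ i) U :=
    smoothOn_coord (smoothOn_fderiv_apply hU hx ξ) i
  have hd : ContDiffOn ℝ ∞ (fun q => ((jac V q).det)⁻¹) U := by
    refine ContDiffOn.inv ?_ h
    refine ContDiffOn.congr (((V' 0 (1, 0)).mul (V' 1 (0, 1))).sub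
      ((V' 0 (0, 1)).mul (V' 1 (1, 0)))) fun q _ => ?_
    rw [det_jac]; rfl
  refine contDiffOn_pi.2 fun i => ?_
  fin_cases j
  · refine ContDiffOn.congr (hd.mul (((x' i (1, 0)).mul (V' 1 (0, 1))).sub
      ((x' i (0, 1)).mul (V' 1 (1, 0))))) fun q _ => ?_
    simp [frameCol, frame, Matrix.inv_def, Matrix.adjugate_fin_two, Matrix.mul_apply,
      Fin.sum_univ_two, jac, partialU, partialV]
    ring
  · refine ContDiffOn.congr (hd.mul (((x' i (0, 1)).mul (V' 0 (1, 0))).sub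
      ((x' i (1, 0)).mul (V' 0 (0, 1))))) fun q _ => ?_
    simp [frameCol, frame, Matrix.inv_def, Matrix.adjugate_fin_two, Matrix.mul_apply,
      Fin.sum_univ_two, jac, partialU, partialV]
    ring

lemma metric_of_isometric (hε : ε = 1 ∨ ε = -1) (ha₁ : 0 < a₁) (ha₂ : a₂ < 0) (hU : IsOpen U)
    (h : IsDeformation ε a₁ a₂ U x V) (hp : p ∈ U) (ξ : ℝ × ℝ) :
    fderiv ℝ x p ξ ⬝ᵥ fderiv ℝ x p ξ = metric ε a₁ a₂ (V p) (fderiv ℝ V p ξ) (fderiv ℝ V p ξ) := by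
  have hq := (fderiv_quadric (ε := ε) (a₁ := a₁) (a₂ := a₂) (z := 0)
    (differentiableAt_of_smoothOn hU h.smooth_V hp)).2 ξ
  have := h.isometric p hp ξ
  rw [hq] at this
  set w := fderiv ℝ V p ξ
  have h1 : ((√a₁ : ℝ) : ℂ) * (√a₁ : ℝ) = (a₁ : ℝ) := by
    rw [← Complex.ofReal_mul, Real.mul_self_sqrt ha₁.le]
  have h2 : ((√(-a₂) : ℝ) : ℂ) * (√(-a₂) : ℝ) = ((-a₂ : ℝ) : ℂ) := by
    rw [← Complex.ofReal_mul, Real.mul_self_sqrt (by linarith)]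
  have h3 := sqrtSign_mul_self hε
  apply Complex.ofReal_injective
  rw [this]
  simp [quadricDeriv, dotProduct, Fin.sum_univ_three, metric] at h1 h2 ⊢
  linear_combination (w 0 : ℂ) ^ 2 * h1 + (w 1 : ℂ) ^ 2 * sqrtSign ε ^ 2 * h2
    - (a₂ : ℂ) * (w 1 : ℂ) ^ 2 * h3

/-- The frame `[x_α x_β]` of a deformation has the Gram matrix of the frame of `x_0`. -/
lemma frame_metric (hε : ε = 1 ∨ ε = -1) (ha₁ : 0 < a₁) (ha₂ : a₂ < 0) (hU : IsOpen U)
    (h : IsDeformation ε a₁ a₂ U x V) (hp : p ∈ U) :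
    frameCol x V 0 p ⬝ᵥ frameCol x V 0 p = a₁ + V p 0 ^ 2 ∧
    frameCol x V 0 p ⬝ᵥ frameCol x V 1 p = -ε * V p 0 * V p 1 ∧
    frameCol x V 1 p ⬝ᵥ frameCol x V 1 p = -ε * a₂ + V p 1 ^ 2 := by
  have key (w : Fin 2 → ℝ) : (w 0 • frameCol x V 0 p + w 1 • frameCol x V 1 p) ⬝ᵥ
      (w 0 • frameCol x V 0 p + w 1 • frameCol x V 1 p) = metric ε a₁ a₂ (V p) w w := by
    obtain ⟨ξ, rfl⟩ := exists_fderiv_eq (h.regular p hp) w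
    rw [← fderiv_eq_frame (h.regular p hp), metric_of_isometric hε ha₁ ha₂ hU h hp]
  have ee := eps_mul_self hε
  have k1 := key ![1, 0]
  have k2 := key ![0, 1]
  have k3 := key ![1, 1]
  simp [metric, dotProduct_comm (frameCol x V 1 p) (frameCol x V 0 p)] at k1 k2 k3
  refine ⟨by linarith, ?_, ?_⟩
  · linear_combination (k3 - k1 - k2) / 2
  · linear_combination k2 + V p 1 ^ 2 * ee

end Deformation

/-! ### Structure equations of a deformation -/

section Normal
variable {ε a₁ a₂ : ℝ} {U : Set (ℝ × ℝ)} {x : ℝ × ℝ → Fin 3 → ℝ} {V : ℝ × ℝ → Fin 2 → ℝ}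
  {p : ℝ × ℝ}

/-- The covector `𝓔 w`. -/
def lower (ε : ℝ) (w : Fin 2 → ℝ) : Fin 2 → ℝ := ![w 0, -ε * w 1]

/-- `x_α Γ¹ + x_β Γ²`, where `Γ = ε A' V / H`; the Christoffel symbols of the linear element of
`x_0` are `Γ^k_{ij} = 𝓔_{ij} Γ^k`. -/
noncomputable def christoffel (ε a₁ a₂ : ℝ) (x : ℝ × ℝ → Fin 3 → ℝ) (V : ℝ × ℝ → Fin 2 → ℝ)
    (p : ℝ × ℝ) : Fin 3 → ℝ :=
  (ε / quadricH ε a₁ a₂ (V p)) •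
    ((V p 0 / a₁) • frameCol x V 0 p + (V p 1 / a₂) • frameCol x V 1 p)

lemma cross_frame (p : ℝ × ℝ) (h : 0 < -(a₁ * a₂ * quadricH ε a₁ a₂ (V p))) :
    frameCol x V 0 p ⨯₃ frameCol x V 1 p =
      √(-(a₁ * a₂ * quadricH ε a₁ a₂ (V p))) • normal ε a₁ a₂ x V p := by
  rw [normal, smul_smul, mul_inv_cancel₀ (Real.sqrt_pos.2 h).ne', one_smul]
  rfl

lemma normal_dot_frameCol (p : ℝ × ℝ) (j : Fin 2) :
    normal ε a₁ a₂ x V p ⬝ᵥ frameCol x V j p = 0 := by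
  rw [normal, smul_dotProduct, dotProduct_comm]
  fin_cases j
  · simp [frameCol]
  · simp [frameCol]

lemma scaled_H_pos (ha₁ : 0 < a₁) (ha₂ : a₂ < 0) (h : IsDeformation ε a₁ a₂ U x V)
    (hp : p ∈ U) : 0 < -(a₁ * a₂ * quadricH ε a₁ a₂ (V p)) := by
  have := mul_pos (mul_pos ha₁ (neg_pos.2 ha₂)) (h.region p hp)
  linarith

lemma smoothOn_normal (ha₁ : 0 < a₁) (ha₂ : a₂ < 0) (hU : IsOpen U)
    (h : IsDeformation ε a₁ a₂ U x V) : ContDiffOn ℝ ∞ (normal ε a₁ a₂ x V) U := by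
  have hF (j : Fin 2) (i : Fin 3) : ContDiffOn ℝ ∞ (fun q => frameCol x V j q i) U :=
    smoothOn_coord (smoothOn_frameCol hU h.smooth_x h.smooth_V h.regular j) i
  have hα := smoothOn_coord h.smooth_V 0
  have hβ := smoothOn_coord h.smooth_V 1
  have hH : ContDiffOn ℝ ∞ (fun q => -(a₁ * a₂ * quadricH ε a₁ a₂ (V q))) U :=
    (contDiffOn_const.mul (((((contDiffOn_const.mul (hα.pow 2)).div_const _).sub
      ((hβ.pow 2).div_const _))).add contDiffOn_const)).neg
  have hs : ContDiffOn ℝ ∞ (fun q => (√(-(a₁ * a₂ * quadricH ε a₁ a₂ (V q))))⁻¹) U :=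
    (hH.sqrt fun q hq => (scaled_H_pos ha₁ ha₂ h hq).ne').inv
      fun q hq => (Real.sqrt_pos.2 (scaled_H_pos ha₁ ha₂ h hq)).ne'
  have hc : ContDiffOn ℝ ∞ (fun q => frameCol x V 0 q ⨯₃ frameCol x V 1 q) U := by
    refine contDiffOn_pi.2 fun i => ?_
    fin_cases i
    · simpa [cross_apply] using ((hF 0 1).mul (hF 1 2)).sub ((hF 0 2).mul (hF 1 1))
    · simpa [cross_apply] using ((hF 0 2).mul (hF 1 0)).sub ((hF 0 0).mul (hF 1 2))
    · simpa [cross_apply] using ((hF 0 0).mul (hF 1 1)).sub ((hF 0 1).mul (hF 1 0))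
  exact hs.smul hc

lemma normal_dot_normal (hε : ε = 1 ∨ ε = -1) (ha₁ : 0 < a₁) (ha₂ : a₂ < 0) (hU : IsOpen U)
    (h : IsDeformation ε a₁ a₂ U x V) (hp : p ∈ U) :
    normal ε a₁ a₂ x V p ⬝ᵥ normal ε a₁ a₂ x V p = 1 := by
  have hpos := scaled_H_pos ha₁ ha₂ h hp
  obtain ⟨g1, g2, g3⟩ := frame_metric hε ha₁ ha₂ hU h hp
  have hc := cross_dot_cross (frameCol x V 0 p) (frameCol x V 1 p) (frameCol x V 0 p)
    (frameCol x V 1 p)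
  rw [dotProduct_comm (frameCol x V 1 p) (frameCol x V 0 p), g1, g2, g3, cross_frame p hpos] at hc
  simp only [smul_dotProduct, dotProduct_smul, smul_eq_mul] at hc
  rw [← mul_assoc, Real.mul_self_sqrt hpos.le] at hc
  refine mul_left_cancel₀ hpos.ne' ?_
  rw [hc, quadricH]
  have ee := eps_mul_self hε
  have := ha₁.ne'
  have := ha₂.ne
  field_simp
  linear_combination (-V p 0 ^ 2 * V p 1 ^ 2) * ee

/-- A vector orthogonal to `x_α`, `x_β` and `N` vanishes; equations between vectors are verified
against the moving frame in this way. -/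
lemma eq_zero_of_dot_frame (hε : ε = 1 ∨ ε = -1) (ha₁ : 0 < a₁) (ha₂ : a₂ < 0) (hU : IsOpen U)
    (h : IsDeformation ε a₁ a₂ U x V) (hp : p ∈ U) {w : Fin 3 → ℝ}
    (h0 : frameCol x V 0 p ⬝ᵥ w = 0) (h1 : frameCol x V 1 p ⬝ᵥ w = 0)
    (hn : normal ε a₁ a₂ x V p ⬝ᵥ w = 0) : w = 0 := by
  have hpos := scaled_H_pos ha₁ ha₂ h hp
  have hc := cross_frame (x := x) p hpos
  have hcw : (frameCol x V 0 p ⨯₃ frameCol x V 1 p) ⬝ᵥ w = 0 := by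
    rw [hc, smul_dotProduct, hn, smul_zero]
  have hcc : 0 < (frameCol x V 0 p ⨯₃ frameCol x V 1 p) ⬝ᵥ
      (frameCol x V 0 p ⨯₃ frameCol x V 1 p) := by
    rw [hc, smul_dotProduct, dotProduct_smul, normal_dot_normal hε ha₁ ha₂ hU h hp]
    have := Real.sqrt_pos.2 hpos
    simp only [smul_eq_mul]; positivity
  have hl := cross_dot_cross (frameCol x V 0 p ⨯₃ frameCol x V 1 p) w
    (frameCol x V 0 p ⨯₃ frameCol x V 1 p) w
  have hz : (frameCol x V 0 p ⨯₃ frameCol x V 1 p) ⨯₃ w = 0 := by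
    rw [cross_cross_eq_smul_sub_smul, h0, h1]
    simp
  rw [hz, hcw] at hl
  simp only [zero_dotProduct, zero_mul, sub_zero] at hl
  have : w ⬝ᵥ w = 0 := by
    rcases mul_eq_zero.1 hl.symm with h' | h'
    · exact absurd h' hcc.ne'
    · exact h'
  exact dotProduct_self_eq_zero.1 this

lemma frameCol_dot_christoffel (hε : ε = 1 ∨ ε = -1) (ha₁ : 0 < a₁) (ha₂ : a₂ < 0)
    (hU : IsOpen U) (h : IsDeformation ε a₁ a₂ U x V) (hp : p ∈ U) :
    frameCol x V 0 p ⬝ᵥ christoffel ε a₁ a₂ x V p = V p 0 ∧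
    frameCol x V 1 p ⬝ᵥ christoffel ε a₁ a₂ x V p = -ε * V p 1 ∧
    normal ε a₁ a₂ x V p ⬝ᵥ christoffel ε a₁ a₂ x V p = 0 ∧
    christoffel ε a₁ a₂ x V p ⬝ᵥ christoffel ε a₁ a₂ x V p =
      1 - ε / quadricH ε a₁ a₂ (V p) := by
  obtain ⟨g1, g2, g3⟩ := frame_metric hε ha₁ ha₂ hU h hp
  have ee := eps_mul_self hε
  have hH := (h.region p hp).ne'
  have := ha₁.ne'
  have := ha₂.ne
  have e0 : frameCol x V 0 p ⬝ᵥ christoffel ε a₁ a₂ x V p = V p 0 := by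
    simp only [christoffel, dotProduct_smul, dotProduct_add, smul_eq_mul, g1, g2]
    rw [div_mul_eq_mul_div, div_eq_iff hH, quadricH]
    field_simp
    linear_combination (a₁ * a₂ * V p 0 * 0 - V p 0 * V p 1 ^ 2 * a₁) * ee
  have e1 : frameCol x V 1 p ⬝ᵥ christoffel ε a₁ a₂ x V p = -ε * V p 1 := by
    simp only [christoffel, dotProduct_smul, dotProduct_add, smul_eq_mul, g3,
      dotProduct_comm (frameCol x V 1 p) (frameCol x V 0 p), g2]
    rw [div_mul_eq_mul_div, div_eq_iff hH, quadricH]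
    field_simp
    ring
  refine ⟨e0, e1, ?_, ?_⟩
  · simp only [christoffel, dotProduct_smul, dotProduct_add, smul_eq_mul, normal_dot_frameCol]
    simp
  · nth_rewrite 1 [christoffel]
    simp only [smul_dotProduct, add_dotProduct, smul_eq_mul, e0, e1]
    have hd : V p 0 / a₁ * V p 0 + V p 1 / a₂ * (-ε * V p 1) + 1 =
        ε * quadricH ε a₁ a₂ (V p) := by
      rw [quadricH]
      linear_combination (-V p 0 ^ 2 / a₁ - 1) * ee
    have hc : ε / quadricH ε a₁ a₂ (V p) * (ε * quadricH ε a₁ a₂ (V p)) = 1 := by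
      field_simp
      linear_combination ee
    linear_combination ε / quadricH ε a₁ a₂ (V p) * hd + hc

/-- The derivative of `dx = [x_α x_β] dV`. -/
lemma fderiv_fderiv_eq_frame (hU : IsOpen U) (h : IsDeformation ε a₁ a₂ U x V) (hp : p ∈ U)
    (ξ η : ℝ × ℝ) :
    fderiv ℝ (fun q => fderiv ℝ x q η) p ξ =
      (fderiv ℝ (fun q => fderiv ℝ V q η) p ξ 0 • frameCol x V 0 p +
        fderiv ℝ V p η 0 • fderiv ℝ (frameCol x V 0) p ξ) +
      (fderiv ℝ (fun q => fderiv ℝ V q η) p ξ 1 • frameCol x V 1 p +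
        fderiv ℝ V p η 1 • fderiv ℝ (frameCol x V 1) p ξ) := by
  have hF (j : Fin 2) := differentiableAt_of_smoothOn hU
    (smoothOn_frameCol hU h.smooth_x h.smooth_V h.regular j) hp
  have hV := differentiableAt_of_smoothOn hU (smoothOn_fderiv_apply hU h.smooth_V η) hp
  have hd (j : Fin 2) : DifferentiableAt ℝ (fun q => fderiv ℝ V q η j • frameCol x V j q) p :=
    (differentiableAt_coord hV j).smul (hF j)
  rw [fderiv_congr_on hU hp fun q hq => fderiv_eq_frame (h.regular q hq) η,
    fderiv_fun_add (hd 0) (hd 1), add_apply,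
    fderiv_smul_apply (differentiableAt_coord hV 0) (hF 0),
    fderiv_smul_apply (differentiableAt_coord hV 1) (hF 1),
    fderiv_apply_coord hV, fderiv_apply_coord hV]

/-- The integrability condition `d[x_α x_β] ∧ dV = 0`. -/
lemma frame_symm (hU : IsOpen U) (h : IsDeformation ε a₁ a₂ U x V) (hp : p ∈ U) (ξ η : ℝ × ℝ) :
    fderiv ℝ V p η 0 • fderiv ℝ (frameCol x V 0) p ξ +
        fderiv ℝ V p η 1 • fderiv ℝ (frameCol x V 1) p ξ =
      fderiv ℝ V p ξ 0 • fderiv ℝ (frameCol x V 0) p η +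
        fderiv ℝ V p ξ 1 • fderiv ℝ (frameCol x V 1) p η := by
  have e := fderiv_fderiv_comm hU h.smooth_x hp ξ η
  rw [fderiv_fderiv_eq_frame hU h hp, fderiv_fderiv_eq_frame hU h hp,
    fderiv_fderiv_comm hU h.smooth_V hp ξ η] at e
  linear_combination (exp := 1) e

lemma secondForm_eq (hU : IsOpen U) (h : IsDeformation ε a₁ a₂ U x V) (hp : p ∈ U)
    (ξ η : ℝ × ℝ) :
    secondForm ε a₁ a₂ x V p ξ η =
      fderiv ℝ V p η 0 * (normal ε a₁ a₂ x V p ⬝ᵥ fderiv ℝ (frameCol x V 0) p ξ) +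
      fderiv ℝ V p η 1 * (normal ε a₁ a₂ x V p ⬝ᵥ fderiv ℝ (frameCol x V 1) p ξ) := by
  rw [secondForm, fderiv_fderiv_eq_frame hU h hp]
  simp only [dotProduct_add, dotProduct_smul, normal_dot_frameCol, smul_eq_mul]
  ring

lemma secondForm_comm (hU : IsOpen U) (h : IsDeformation ε a₁ a₂ U x V) (hp : p ∈ U)
    (ξ η : ℝ × ℝ) : secondForm ε a₁ a₂ x V p ξ η = secondForm ε a₁ a₂ x V p η ξ := by
  rw [secondForm, secondForm, fderiv_fderiv_comm hU h.smooth_x hp]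

/-- Tangential part of the derivative of the frame. The linear element determines the symmetric
part of `(x_i · dx_j)`, and the symmetry of the second derivatives of `x` then determines the
rest. -/
lemma frameCol_dot_fderiv (hε : ε = 1 ∨ ε = -1) (ha₁ : 0 < a₁) (ha₂ : a₂ < 0)
    (hU : IsOpen U) (h : IsDeformation ε a₁ a₂ U x V) (hp : p ∈ U) (ξ : ℝ × ℝ) (i j : Fin 2) :
    frameCol x V i p ⬝ᵥ fderiv ℝ (frameCol x V j) p ξ =
      lower ε (V p) i * lower ε (fderiv ℝ V p ξ) j := by
  have hF (j : Fin 2) := differentiableAt_of_smoothOn hU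
    (smoothOn_frameCol hU h.smooth_x h.smooth_V h.regular j) hp
  have hV := differentiableAt_of_smoothOn hU h.smooth_V hp
  have hV0 := differentiableAt_coord hV 0
  have hV1 := differentiableAt_coord hV 1
  have ee := eps_mul_self hε
  have dg (i j : Fin 2) (ξ : ℝ × ℝ) := fderiv_dotProduct (hF i) (hF j) ξ
  -- the derivative of the Gram matrix gives the symmetric part
  have t00 (ξ : ℝ × ℝ) : frameCol x V 0 p ⬝ᵥ fderiv ℝ (frameCol x V 0) p ξ =
      V p 0 * fderiv ℝ V p ξ 0 := by
    have := dg 0 0 ξ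
    rw [fderiv_congr_on hU hp fun q hq => (frame_metric hε ha₁ ha₂ hU h hq).1] at this
    simp only [pow_two] at this
    rw [fderiv_const_add, fderiv_mul_apply hV0 hV0, ← fderiv_apply_coord hV,
      dotProduct_comm (fderiv ℝ (frameCol x V 0) p ξ)] at this
    linarith
  have t11 (ξ : ℝ × ℝ) : frameCol x V 1 p ⬝ᵥ fderiv ℝ (frameCol x V 1) p ξ =
      V p 1 * fderiv ℝ V p ξ 1 := by
    have := dg 1 1 ξ
    rw [fderiv_congr_on hU hp fun q hq => (frame_metric hε ha₁ ha₂ hU h hq).2.2] at this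
    simp only [pow_two] at this
    rw [fderiv_const_add, fderiv_mul_apply hV1 hV1, ← fderiv_apply_coord hV,
      dotProduct_comm (fderiv ℝ (frameCol x V 1) p ξ)] at this
    linarith
  have t01 (ξ : ℝ × ℝ) : frameCol x V 0 p ⬝ᵥ fderiv ℝ (frameCol x V 1) p ξ +
      frameCol x V 1 p ⬝ᵥ fderiv ℝ (frameCol x V 0) p ξ =
      -ε * (fderiv ℝ V p ξ 0 * V p 1 + V p 0 * fderiv ℝ V p ξ 1) := by
    have := dg 0 1 ξ
    rw [fderiv_congr_on hU hp fun q hq => (frame_metric hε ha₁ ha₂ hU h hq).2.1] at this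
    rw [fderiv_mul_apply (hV0.const_mul _) hV1, fderiv_const_mul hV0, ← fderiv_apply_coord hV,
      dotProduct_comm (fderiv ℝ (frameCol x V 0) p ξ)] at this
    simp only [_root_.smul_apply, smul_eq_mul, ← fderiv_apply_coord hV] at this
    linarith
  have s0 (ξ η : ℝ × ℝ) := congrArg (fun w => frameCol x V 0 p ⬝ᵥ w) (frame_symm hU h hp ξ η)
  have s1 (ξ η : ℝ × ℝ) := congrArg (fun w => frameCol x V 1 p ⬝ᵥ w) (frame_symm hU h hp ξ η)
  simp only [dotProduct_add, dotProduct_smul, smul_eq_mul, t00, t11] at s0 s1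
  -- the skew part: `frame_symm` against the directions with `dV = (1, 0)` and `dV = (0, 1)`
  obtain ⟨η, hη⟩ := exists_fderiv_eq (h.regular p hp) ![1, 0]
  obtain ⟨η', hη'⟩ := exists_fderiv_eq (h.regular p hp) ![0, 1]
  have y1 : frameCol x V 0 p ⬝ᵥ fderiv ℝ (frameCol x V 1) p η = 0 := by
    have := s0 η η'
    simp [hη, hη'] at this
    linarith
  have y (ξ : ℝ × ℝ) : frameCol x V 1 p ⬝ᵥ fderiv ℝ (frameCol x V 0) p ξ =
      -ε * V p 1 * fderiv ℝ V p ξ 0 := by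
    have e1 := s1 ξ η
    have e2 := t01 η
    rw [y1] at e2
    simp [hη] at e1 e2
    linear_combination e1 + fderiv ℝ V p ξ 0 * e2
  have y' := t01 ξ
  rw [y ξ] at y'
  fin_cases i <;> fin_cases j
  · simpa [lower] using t00 ξ
  · simp [lower]; linarith
  · simp [lower]; linarith [y ξ]
  · simp [lower]; linear_combination t11 ξ - V p 1 * fderiv ℝ V p ξ 1 * ee

/-- The Gauss formula for the frame. -/
lemma fderiv_frameCol (hε : ε = 1 ∨ ε = -1) (ha₁ : 0 < a₁) (ha₂ : a₂ < 0)
    (hU : IsOpen U) (h : IsDeformation ε a₁ a₂ U x V) (hp : p ∈ U) (ξ : ℝ × ℝ) (j : Fin 2) :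
    fderiv ℝ (frameCol x V j) p ξ =
      lower ε (fderiv ℝ V p ξ) j • christoffel ε a₁ a₂ x V p +
        (normal ε a₁ a₂ x V p ⬝ᵥ fderiv ℝ (frameCol x V j) p ξ) • normal ε a₁ a₂ x V p := by
  obtain ⟨c0, c1, cn, -⟩ := frameCol_dot_christoffel hε ha₁ ha₂ hU h hp
  rw [← sub_eq_zero]
  refine eq_zero_of_dot_frame hε ha₁ ha₂ hU h hp ?_ ?_ ?_
  · rw [dotProduct_sub, dotProduct_add, dotProduct_smul, dotProduct_smul,
      frameCol_dot_fderiv hε ha₁ ha₂ hU h hp, c0, dotProduct_comm _ (normal ε a₁ a₂ x V p),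
      normal_dot_frameCol]
    simp [lower]; ring
  · rw [dotProduct_sub, dotProduct_add, dotProduct_smul, dotProduct_smul,
      frameCol_dot_fderiv hε ha₁ ha₂ hU h hp, c1, dotProduct_comm _ (normal ε a₁ a₂ x V p),
      normal_dot_frameCol]
    simp [lower]; ring
  · rw [dotProduct_sub, dotProduct_add, dotProduct_smul, dotProduct_smul, cn,
      normal_dot_normal hε ha₁ ha₂ hU h hp]
    simp

/-- The Gauss equation: the curvature of the linear element of `x_0` is
`-1 / (H · det g)`. -/
lemma gauss_equation (hε : ε = 1 ∨ ε = -1) (ha₁ : 0 < a₁) (ha₂ : a₂ < 0)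
    (hU : IsOpen U) (h : IsDeformation ε a₁ a₂ U x V) (hp : p ∈ U) :
    secondForm ε a₁ a₂ x V p (1, 0) (1, 0) * secondForm ε a₁ a₂ x V p (0, 1) (0, 1) -
        secondForm ε a₁ a₂ x V p (1, 0) (0, 1) ^ 2 =
      -(jac V p).det ^ 2 / quadricH ε a₁ a₂ (V p) := by
  have hF (j : Fin 2) := smoothOn_frameCol hU h.smooth_x h.smooth_V h.regular j
  have hFd (j : Fin 2) := differentiableAt_of_smoothOn hU (hF j) hp
  have hV := differentiableAt_of_smoothOn hU h.smooth_V hp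
  have ee := eps_mul_self hε
  have hH := (h.region p hp).ne'
  -- the derivative along `ξ` of `x_α · ∂_η x_β = -ε α ∂_η β`; the terms with second derivatives
  -- cancel between `(ξ, η) = (∂_u, ∂_v)` and `(∂_v, ∂_u)`
  have key (ξ η : ℝ × ℝ) :
      fderiv ℝ (frameCol x V 0) p ξ ⬝ᵥ fderiv ℝ (frameCol x V 1) p η +
        frameCol x V 0 p ⬝ᵥ fderiv ℝ (fun q => fderiv ℝ (frameCol x V 1) q η) p ξ =
      fderiv ℝ V p ξ 0 * (-ε * fderiv ℝ V p η 1) +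
        V p 0 * (-ε * fderiv ℝ (fun q => fderiv ℝ V q η) p ξ 1) := by
    have hV' := differentiableAt_of_smoothOn hU (smoothOn_fderiv_apply hU h.smooth_V η) hp
    have e := fderiv_dotProduct (hFd 0)
      (differentiableAt_of_smoothOn hU (smoothOn_fderiv_apply hU (hF 1) η) hp) ξ
    rw [fderiv_congr_on hU hp fun q hq => frameCol_dot_fderiv hε ha₁ ha₂ hU h hq η 0 1] at e
    rw [← e]
    simp only [lower, Matrix.cons_val_zero, Matrix.cons_val_one]
    rw [fderiv_mul_apply (differentiableAt_coord hV 0) ((differentiableAt_coord hV' 1).const_mul _),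
      fderiv_const_mul (differentiableAt_coord hV' 1)]
    simp [fderiv_apply_coord hV, fderiv_apply_coord hV']
  have k1 := key (0, 1) (1, 0)
  have k2 := key (1, 0) (0, 1)
  rw [fderiv_fderiv_comm hU (hF 1) hp, fderiv_fderiv_comm hU h.smooth_V hp] at k1
  obtain ⟨-, -, cn, cc⟩ := frameCol_dot_christoffel hε ha₁ ha₂ hU h hp
  have nn := normal_dot_normal hε ha₁ ha₂ hU h hp
  -- by the Gauss formula, the remaining scalar products involve only `Γ · Γ` and the normal parts
  have dd (ξ η : ℝ × ℝ) : fderiv ℝ (frameCol x V 0) p ξ ⬝ᵥ fderiv ℝ (frameCol x V 1) p η =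
      fderiv ℝ V p ξ 0 * (-ε * fderiv ℝ V p η 1) * (1 - ε / quadricH ε a₁ a₂ (V p)) +
      (normal ε a₁ a₂ x V p ⬝ᵥ fderiv ℝ (frameCol x V 0) p ξ) *
        (normal ε a₁ a₂ x V p ⬝ᵥ fderiv ℝ (frameCol x V 1) p η) := by
    conv_lhs => rw [fderiv_frameCol hε ha₁ ha₂ hU h hp ξ 0, fderiv_frameCol hε ha₁ ha₂ hU h hp η 1]
    simp only [add_dotProduct, dotProduct_add, smul_dotProduct, dotProduct_smul, cc, nn, cn,
      dotProduct_comm (christoffel ε a₁ a₂ x V p) (normal ε a₁ a₂ x V p), smul_eq_mul, lower,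
      Matrix.cons_val_zero, Matrix.cons_val_one]
    ring
  rw [dd] at k1 k2
  have sy := secondForm_comm hU h hp (1, 0) (0, 1)
  rw [pow_two]
  nth_rewrite 2 [sy]
  simp only [secondForm_eq hU h hp, det_jac, partialU, partialV]
  rw [eq_div_iff hH]
  generalize normal ε a₁ a₂ x V p ⬝ᵥ fderiv ℝ (frameCol x V 0) p (1, 0) = A at *
  generalize normal ε a₁ a₂ x V p ⬝ᵥ fderiv ℝ (frameCol x V 0) p (0, 1) = B at *
  generalize normal ε a₁ a₂ x V p ⬝ᵥ fderiv ℝ (frameCol x V 1) p (1, 0) = C at *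
  generalize normal ε a₁ a₂ x V p ⬝ᵥ fderiv ℝ (frameCol x V 1) p (0, 1) = D at *
  generalize quadricH ε a₁ a₂ (V p) = H at *
  generalize fderiv ℝ V p (1, 0) 0 = u0 at *
  generalize fderiv ℝ V p (1, 0) 1 = u1 at *
  generalize fderiv ℝ V p (0, 1) 0 = v0 at *
  generalize fderiv ℝ V p (0, 1) 1 = v1 at *
  have kk : (A * D - B * C) * H = -(u0 * v1 - v0 * u1) := by
    have : A * D - B * C = -(ε * ε) * (u0 * v1 - v0 * u1) / H := by
      linear_combination k2 - k1
    rw [this, ee]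
    field_simp
  linear_combination (u0 * v1 - v0 * u1) * kk

/-- `x_u × x_v` is a nonzero multiple of `N`, which makes conjugacy the vanishing of `N · x_uv`. -/
lemma cross_partials (ha₁ : 0 < a₁) (ha₂ : a₂ < 0) (h : IsDeformation ε a₁ a₂ U x V)
    (hp : p ∈ U) : partialU x p ⨯₃ partialV x p = (jac V p).det •
        √(-(a₁ * a₂ * quadricH ε a₁ a₂ (V p))) • normal ε a₁ a₂ x V p := by
  rw [← cross_frame p (scaled_H_pos ha₁ ha₂ h hp), partialU, partialV,
    fderiv_eq_frame (h.regular p hp), fderiv_eq_frame (h.regular p hp), det_jac,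
    partialU, partialV]
  simp only [map_add, map_smul, LinearMap.add_apply, LinearMap.smul_apply, cross_self]
  rw [← cross_anticomm (frameCol x V 0 p) (frameCol x V 1 p)]
  module

/-- With conjugate and isothermic parameters, the Gauss equation determines the second fundamental
form up to sign. -/
lemma hasSecondForm_of_isothermic (hε : ε = 1 ∨ ε = -1) (ha₁ : 0 < a₁) (ha₂ : a₂ < 0)
    (hU : IsOpen U) (h : IsDeformation ε a₁ a₂ U x V)
    (hi : IsIsothermicConjugate ε a₁ a₂ U x V) {θ : ℝ × ℝ → ℝ} {Λ : ℝ × ℝ → Fin 2 → ℝ}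
    (hA : IsAngleData ε a₁ a₂ U x V θ Λ) : HasSecondForm ε a₁ a₂ U x V Λ := by
  intro p hp ξ η
  have hpos := scaled_H_pos ha₁ ha₂ h hp
  have hH := h.region p hp
  have hdet : (jac V p).det = Λ p 0 * Λ p 1 := by
    rw [hA.angle p hp, Matrix.det_mul, det_rot hε]; simp
  have hB : secondForm ε a₁ a₂ x V p (1, 0) (0, 1) = 0 := by
    have hc := hi.conj p hp
    rw [IsConjugateAt, cross_partials ha₁ ha₂ h hp, smul_dotProduct, smul_dotProduct] at hc
    rw [secondForm_comm hU h hp]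
    have hc' : normal ε a₁ a₂ x V p ⬝ᵥ partialV (partialU x) p = 0 := by
      simpa [h.regular p hp, (Real.sqrt_pos.2 hpos).ne'] using hc
    exact hc'
  have hg := gauss_equation hε ha₁ ha₂ hU h hp
  have hC := hi.isothermic p hp
  have ho := hA.oriented p hp
  rw [hB, hdet] at hg
  have hB' := secondForm_comm hU h hp (1, 0) (0, 1)
  rw [hB] at hB'
  have hs : (0 : ℝ) < √(quadricH ε a₁ a₂ (V p)) := Real.sqrt_pos.2 hH
  have hss := Real.sq_sqrt hH.le
  have hval : secondForm ε a₁ a₂ x V p (1, 0) (1, 0) =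
      Λ p 0 * Λ p 1 / √(quadricH ε a₁ a₂ (V p)) := by
    rw [eq_div_iff hs.ne']
    set A := secondForm ε a₁ a₂ x V p (1, 0) (1, 0)
    set r := √(quadricH ε a₁ a₂ (V p))
    have h2 : (A * r) ^ 2 = (Λ p 0 * Λ p 1) ^ 2 := by
      rw [mul_pow, hss]
      field_simp at hg
      rw [show secondForm ε a₁ a₂ x V p (0, 1) (0, 1) = -A by linarith] at hg
      linarith
    -- the orientation of the angle data excludes the other square root
    rcases sq_eq_sq_iff_eq_or_eq_neg.1 h2 with h3 | h3
    · exact h3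
    · have : Λ p 0 * Λ p 1 * A * r < 0 := by
        have : 0 < (A * r) ^ 2 := by
          have : A ≠ 0 := by rintro h0; rw [h0] at ho; simp at ho
          positivity
        nlinarith
      nlinarith [mul_pos ho hs]
  have hexp : secondForm ε a₁ a₂ x V p ξ η =
      ξ.1 * η.1 * secondForm ε a₁ a₂ x V p (1, 0) (1, 0) +
      ξ.1 * η.2 * secondForm ε a₁ a₂ x V p (1, 0) (0, 1) +
      ξ.2 * η.1 * secondForm ε a₁ a₂ x V p (0, 1) (1, 0) +
      ξ.2 * η.2 * secondForm ε a₁ a₂ x V p (0, 1) (0, 1) := by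
    simp only [secondForm_eq hU h hp]
    rw [fderiv_eq_partials V p η, fderiv_eq_partials (frameCol x V 0) p ξ,
      fderiv_eq_partials (frameCol x V 1) p ξ]
    simp only [partialU, partialV, dotProduct_add, dotProduct_smul, Pi.add_apply, Pi.smul_apply,
      smul_eq_mul]
    ring
  rw [hexp, hB, ← hB', show secondForm ε a₁ a₂ x V p (0, 1) (0, 1) =
    -secondForm ε a₁ a₂ x V p (1, 0) (1, 0) by linarith, hval]
  ring

end Normal

/-! ### Angle data: the linear system and the Gordon equation -/

section Angle
variable {ε a₁ a₂ : ℝ} {U : Set (ℝ × ℝ)} {x : ℝ × ℝ → Fin 3 → ℝ} {V : ℝ × ℝ → Fin 2 → ℝ}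
  {θ : ℝ × ℝ → ℝ} {Λ : ℝ × ℝ → Fin 2 → ℝ} {p : ℝ × ℝ}

lemma fderiv_cosE_comp (hε : ε = 1 ∨ ε = -1) (hθ : DifferentiableAt ℝ θ p) :
    DifferentiableAt ℝ (fun q => cosE ε (θ q)) p ∧
      ∀ ξ, fderiv ℝ (fun q => cosE ε (θ q)) p ξ = ε * sinE ε (θ p) * fderiv ℝ θ p ξ := by
  have h : HasFDerivAt (fun q => cosE ε (θ q)) _ p :=
    (hasDerivAt_cosE hε (θ p)).comp_hasFDerivAt p hθ.hasFDerivAt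
  exact ⟨h.differentiableAt, fun ξ => by rw [h.fderiv]; simp⟩

lemma fderiv_sinE_comp (hε : ε = 1 ∨ ε = -1) (hθ : DifferentiableAt ℝ θ p) :
    DifferentiableAt ℝ (fun q => sinE ε (θ q)) p ∧
      ∀ ξ, fderiv ℝ (fun q => sinE ε (θ q)) p ξ = cosE ε (θ p) * fderiv ℝ θ p ξ := by
  have h : HasFDerivAt (fun q => sinE ε (θ q)) _ p :=
    (hasDerivAt_sinE hε (θ p)).comp_hasFDerivAt p hθ.hasFDerivAt
  exact ⟨h.differentiableAt, fun ξ => by rw [h.fderiv]; simp⟩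

/-- The entries of `dV = R δ Λ`. -/
lemma IsAngleData.partials (h : IsAngleData ε a₁ a₂ U x V θ Λ) (hp : p ∈ U) :
    fderiv ℝ V p (1, 0) 0 = cosE ε (θ p) * Λ p 0 ∧
    fderiv ℝ V p (1, 0) 1 = sinE ε (θ p) * Λ p 0 ∧
    fderiv ℝ V p (0, 1) 0 = ε * sinE ε (θ p) * Λ p 1 ∧
    fderiv ℝ V p (0, 1) 1 = cosE ε (θ p) * Λ p 1 := by
  have e := h.angle p hp
  refine ⟨?_, ?_, ?_, ?_⟩
  · simpa [jac, rot, partialU] using congrFun (congrFun e 0) 0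
  · simpa [jac, rot, partialU] using congrFun (congrFun e 1) 0
  · simpa [jac, rot, partialV] using congrFun (congrFun e 0) 1
  · simpa [jac, rot, partialV] using congrFun (congrFun e 1) 1

lemma IsAngleData.ne_zero (h : IsAngleData ε a₁ a₂ U x V θ Λ) (hp : p ∈ U) :
    Λ p 0 ≠ 0 ∧ Λ p 1 ≠ 0 := by
  have := (h.oriented p hp).ne'
  simp only [ne_eq, mul_eq_zero, not_or] at this
  exact this.1

/-- The normalization of `Λ`, as a relation between `V` and `Λ` and as `μ² - ε λ² = H`. -/
lemma IsAngleData.normalized_apply (hε : ε = 1 ∨ ε = -1) (h : IsAngleData ε a₁ a₂ U x V θ Λ)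
    (hp : p ∈ U) :
    Λ p 0 * Λ p 0 - ε * (Λ p 1 * Λ p 1) =
      -(a₁⁻¹ * (V p 0 * V p 0) - ε * a₂⁻¹ * (V p 1 * V p 1)) - 1 ∧
    Λ p 0 ^ 2 - ε * Λ p 1 ^ 2 = -ε * quadricH ε a₁ a₂ (V p) := by
  have ee := eps_mul_self hε
  have e := h.normalized p hp
  simp [signMat, invA, Matrix.mulVec_diagonal, dotProduct, Fin.sum_univ_two] at e
  constructor
  · linarith
  · rw [quadricH]
    linear_combination e + (a₁⁻¹ * V p 0 ^ 2 + 1) * ee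

/-- The differential of `Λ`. The derivatives of `λ` along `v` and of `μ` along `u` come from
`V_uv = V_vu`, and then the other two from differentiating the normalization. -/
lemma IsAngleData.fderiv_Λ (hε : ε = 1 ∨ ε = -1) (hU : IsOpen U)
    (hV : ContDiffOn ℝ ∞ V U) (h : IsAngleData ε a₁ a₂ U x V θ Λ) (hp : p ∈ U) :
    fderiv ℝ Λ p (1, 0) 0 = ε * (Λ p 1 * fderiv ℝ θ p (0, 1)) -
      (cosE ε (θ p) * (a₁⁻¹ * V p 0) - ε * (sinE ε (θ p) * (a₂⁻¹ * V p 1))) ∧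
    fderiv ℝ Λ p (0, 1) 0 = ε * (Λ p 1 * fderiv ℝ θ p (1, 0)) ∧
    fderiv ℝ Λ p (1, 0) 1 = Λ p 0 * fderiv ℝ θ p (0, 1) ∧
    fderiv ℝ Λ p (0, 1) 1 = Λ p 0 * fderiv ℝ θ p (1, 0) -
      (-(sinE ε (θ p) * (a₁⁻¹ * V p 0)) + cosE ε (θ p) * (a₂⁻¹ * V p 1)) := by
  have ee := eps_mul_self hε
  have hcs := cosE_sq_sub hε (θ p)
  have dθ := differentiableAt_of_smoothOn hU h.smooth_θ hp
  have dΛ := differentiableAt_of_smoothOn hU h.smooth_Λ hp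
  have dV := differentiableAt_of_smoothOn hU hV hp
  have dV' (ξ : ℝ × ℝ) := differentiableAt_of_smoothOn hU (smoothOn_fderiv_apply hU hV ξ) hp
  obtain ⟨dc, fc⟩ := fderiv_cosE_comp hε dθ
  obtain ⟨ds, fs⟩ := fderiv_sinE_comp hε dθ
  have dl := differentiableAt_coord dΛ 0
  have dm := differentiableAt_coord dΛ 1
  -- `V_uv = V_vu`, a linear system for `λ_v` and `μ_u` with the matrix `R`
  have c0 := congrFun (fderiv_fderiv_comm hU hV hp (0, 1) (1, 0)) 0
  have c1 := congrFun (fderiv_fderiv_comm hU hV hp (0, 1) (1, 0)) 1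
  rw [fderiv_apply_coord (dV' _), fderiv_apply_coord (dV' _),
    fderiv_congr_on hU hp fun q hq => (h.partials hq).1,
    fderiv_congr_on hU hp fun q hq => (h.partials hq).2.2.1,
    fderiv_mul_apply dc dl, fderiv_mul_apply (ds.const_mul ε) dm, fderiv_const_mul ds,
    _root_.smul_apply, fc, fs, ← fderiv_apply_coord dΛ, ← fderiv_apply_coord dΛ, smul_eq_mul] at c0
  rw [fderiv_apply_coord (dV' _), fderiv_apply_coord (dV' _),
    fderiv_congr_on hU hp fun q hq => (h.partials hq).2.1,
    fderiv_congr_on hU hp fun q hq => (h.partials hq).2.2.2,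
    fderiv_mul_apply ds dl, fderiv_mul_apply dc dm, fc, fs, ← fderiv_apply_coord dΛ,
    ← fderiv_apply_coord dΛ] at c1
  have lv : fderiv ℝ Λ p (0, 1) 0 = ε * (Λ p 1 * fderiv ℝ θ p (1, 0)) := by
    linear_combination cosE ε (θ p) * c0 - ε * sinE ε (θ p) * c1
      + (ε * Λ p 1 * fderiv ℝ θ p (1, 0) - fderiv ℝ Λ p (0, 1) 0) * hcs
  have mu : fderiv ℝ Λ p (1, 0) 1 = Λ p 0 * fderiv ℝ θ p (0, 1) := by
    linear_combination sinE ε (θ p) * c0 - cosE ε (θ p) * c1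
      + (Λ p 0 * fderiv ℝ θ p (0, 1) - fderiv ℝ Λ p (1, 0) 1) * hcs
  -- the derivative of the normalization
  have n (ξ : ℝ × ℝ) : Λ p 0 * fderiv ℝ Λ p ξ 0 - ε * (Λ p 1 * fderiv ℝ Λ p ξ 1) =
      -(a₁⁻¹ * (V p 0 * fderiv ℝ V p ξ 0) - ε * a₂⁻¹ * (V p 1 * fderiv ℝ V p ξ 1)) := by
    have e := congrArg (fun L => L ξ)
      (fderiv_congr_on hU hp fun q hq => (h.normalized_apply hε hq).1)
    have dα := differentiableAt_coord dV 0
    have dβ := differentiableAt_coord dV 1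
    rw [fderiv_fun_sub (dl.fun_mul dl) ((dm.fun_mul dm).const_mul ε),
      fderiv_const_mul (dm.fun_mul dm),
      fderiv_sub_const, fderiv_fun_neg,
      fderiv_fun_sub ((dα.fun_mul dα).const_mul a₁⁻¹) ((dβ.fun_mul dβ).const_mul (ε * a₂⁻¹)),
      fderiv_const_mul (dα.fun_mul dα), fderiv_const_mul (dβ.fun_mul dβ)] at e
    simp only [_root_.sub_apply, _root_.neg_apply, _root_.smul_apply, smul_eq_mul,
      fderiv_mul_apply dl dl, fderiv_mul_apply dm dm, fderiv_mul_apply dα dα,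
      fderiv_mul_apply dβ dβ, ← fderiv_apply_coord dΛ, ← fderiv_apply_coord dV] at e
    linear_combination e / 2
  obtain ⟨hl, hm⟩ := h.ne_zero hp
  obtain ⟨pu0, pu1, pv0, pv1⟩ := h.partials hp
  refine ⟨?_, lv, mu, ?_⟩
  · have := n (1, 0)
    rw [pu0, pu1, mu] at this
    refine mul_left_cancel₀ hl ?_
    linear_combination this
  · have := n (0, 1)
    rw [pv0, pv1, lv] at this
    refine mul_left_cancel₀ hm ?_
    linear_combination (-ε) * this + (Λ p 1 * Λ p 0 * fderiv ℝ θ p (1, 0)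
      - Λ p 1 * fderiv ℝ Λ p (0, 1) 1 + Λ p 1 * sinE ε (θ p) * (a₁⁻¹ * V p 0)
      - Λ p 1 * cosE ε (θ p) * (a₂⁻¹ * V p 1)) * ee

lemma IsAngleData.fderiv_V_apply (h : IsAngleData ε a₁ a₂ U x V θ Λ) (hp : p ∈ U) (ξ : ℝ × ℝ) :
    fderiv ℝ V p ξ 0 = cosE ε (θ p) * (ξ.1 * Λ p 0) + ε * sinE ε (θ p) * (ξ.2 * Λ p 1) ∧
    fderiv ℝ V p ξ 1 = sinE ε (θ p) * (ξ.1 * Λ p 0) + cosE ε (θ p) * (ξ.2 * Λ p 1) := by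
  obtain ⟨pu0, pu1, pv0, pv1⟩ := h.partials hp
  rw [fderiv_eq_partials]
  simp only [partialU, partialV, Pi.add_apply, Pi.smul_apply, smul_eq_mul, pu0, pu1, pv0, pv1]
  constructor <;> ring

lemma IsAngleData.solvesLinearSystem (hε : ε = 1 ∨ ε = -1) (hU : IsOpen U)
    (hV : ContDiffOn ℝ ∞ V U) (h : IsAngleData ε a₁ a₂ U x V θ Λ) :
    SolvesLinearSystem ε a₁ a₂ U V θ Λ := by
  intro p hp ξ
  obtain ⟨lu, lv, mu, mv⟩ := h.fderiv_Λ hε hU hV hp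
  obtain ⟨v0, v1⟩ := h.fderiv_V_apply hp ξ
  have dθ := differentiableAt_of_smoothOn hU h.smooth_θ hp
  rw [Matrix.fromBlocks_mulVec, connOmega_eq hε dθ, rot_inv hε]
  ext (i | i) <;> fin_cases i
  · simp [rot, delta, Matrix.vecMul_diagonal, dotProduct, Fin.sum_univ_two, v0]; ring
  · simp [rot, delta, Matrix.vecMul_diagonal, dotProduct, Fin.sum_univ_two, v1]; ring
  · simp [delta, invA, dotProduct, Fin.sum_univ_two,
      fderiv_eq_partials Λ p ξ, fderiv_eq_partials θ p (ξ.2, ξ.1), partialU, partialV, lu, lv]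
    ring
  · simp [delta, invA, dotProduct, Fin.sum_univ_two,
      fderiv_eq_partials Λ p ξ, fderiv_eq_partials θ p (ξ.2, ξ.1), partialU, partialV, mu, mv]
    ring

/-- The Gordon equation is the condition `λ_uv = λ_vu` for the linear system. -/
lemma IsAngleData.solvesGordon (hε : ε = 1 ∨ ε = -1) (ha : a₁⁻¹ - a₂⁻¹ = 1) (hU : IsOpen U)
    (hV : ContDiffOn ℝ ∞ V U) (h : IsAngleData ε a₁ a₂ U x V θ Λ) : SolvesGordon ε U θ := by
  intro p hp
  have ee := eps_mul_self hε
  have dθ := differentiableAt_of_smoothOn hU h.smooth_θ hp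
  have dθ' (ξ : ℝ × ℝ) := differentiableAt_of_smoothOn hU (smoothOn_fderiv_apply hU h.smooth_θ ξ) hp
  have dΛ := differentiableAt_of_smoothOn hU h.smooth_Λ hp
  have dΛ' (ξ : ℝ × ℝ) := differentiableAt_of_smoothOn hU (smoothOn_fderiv_apply hU h.smooth_Λ ξ) hp
  have dV := differentiableAt_of_smoothOn hU hV hp
  obtain ⟨dc, fc⟩ := fderiv_cosE_comp hε dθ
  obtain ⟨ds, fs⟩ := fderiv_sinE_comp hε dθ
  have dm := differentiableAt_coord dΛ 1
  have dα := differentiableAt_coord dV 0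
  have dβ := differentiableAt_coord dV 1
  have c := congrFun (fderiv_fderiv_comm hU h.smooth_Λ hp (0, 1) (1, 0)) 0
  have d1 := dm.fun_mul (dθ' (0, 1))
  have d2 := dm.fun_mul (dθ' (1, 0))
  have d3 := dc.fun_mul (dα.const_mul a₁⁻¹)
  have d4 := ds.fun_mul (dβ.const_mul a₂⁻¹)
  rw [fderiv_apply_coord (dΛ' _), fderiv_apply_coord (dΛ' _),
    fderiv_congr_on hU hp fun q hq => (h.fderiv_Λ hε hU hV hq).1,
    fderiv_congr_on hU hp fun q hq => (h.fderiv_Λ hε hU hV hq).2.1,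
    fderiv_fun_sub (d1.const_mul ε) (d3.fun_sub (d4.const_mul ε)),
    fderiv_fun_sub d3 (d4.const_mul ε),
    fderiv_const_mul d1, fderiv_const_mul d2, fderiv_const_mul d4] at c
  simp only [_root_.sub_apply, _root_.smul_apply, smul_eq_mul, fderiv_mul_apply dm (dθ' _),
    fderiv_mul_apply dc (dα.const_mul a₁⁻¹), fderiv_mul_apply ds (dβ.const_mul a₂⁻¹),
    fderiv_const_mul dα, fderiv_const_mul dβ, fc, fs, ← fderiv_apply_coord dΛ,
    ← fderiv_apply_coord dV] at c
  obtain ⟨lu, lv, mu, mv⟩ := h.fderiv_Λ hε hU hV hp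
  obtain ⟨pu0, pu1, pv0, pv1⟩ := h.partials hp
  obtain ⟨hl, hm⟩ := h.ne_zero hp
  rw [mu, mv, pv0, pv1] at c
  have e1 : partialV (partialV θ) p = fderiv ℝ (fun q => fderiv ℝ θ q (0, 1)) p (0, 1) := rfl
  have e2 : partialU (partialU θ) p = fderiv ℝ (fun q => fderiv ℝ θ q (1, 0)) p (1, 0) := rfl
  rw [e1, e2]
  refine mul_left_cancel₀ hm ?_
  set X := fderiv ℝ (fun q => fderiv ℝ θ q (0, 1)) p (0, 1) -
    fderiv ℝ (fun q => fderiv ℝ θ q (1, 0)) p (1, 0) with hX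
  linear_combination ε * c -
    Λ p 1 * (X - cosE ε (θ p) * sinE ε (θ p) * (a₁⁻¹ - a₂⁻¹)) * ee +
    Λ p 1 * cosE ε (θ p) * sinE ε (θ p) * ha

lemma SolvesGordon.sign_mul {s : ℝ} (hs : s = 1 ∨ s = -1) (h : SolvesGordon ε U θ) :
    SolvesGordon ε U (fun q => s * θ q) := by
  rcases hs with rfl | rfl
  · simpa using h
  · intro p hp
    have e (ξ : ℝ × ℝ) (f : ℝ × ℝ → ℝ) : (fun q => fderiv ℝ (fun q => -1 * f q) q ξ) =
        fun q => -1 * fderiv ℝ f q ξ := by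
      funext q; simp [fderiv_fun_neg]
    have eU (f : ℝ × ℝ → ℝ) : partialU (fun q => -1 * f q) = fun q => -1 * partialU f q := e _ f
    have eV (f : ℝ × ℝ → ℝ) : partialV (fun q => -1 * f q) = fun q => -1 * partialV f q := e _ f
    rw [eU, eU, eV, eV]
    have := h p hp
    simp only [neg_one_mul, cosE_neg, sinE_neg]
    linarith

end Angle

/-! ### Matrix form and classical form of the Bäcklund transformation -/

section Backlund
variable {ε a₁ a₂ z s s' σ d₁ d₂ : ℝ} {θ0 θ1 : ℝ × ℝ → ℝ} {p : ℝ × ℝ}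

lemma matDz_eq (a₁ a₂ z s' : ℝ) : matDz a₁ a₂ z s' =
    Matrix.diagonal ![(s' * √z)⁻¹ * √(1 - z * a₁⁻¹), (s' * √z)⁻¹ * √(1 - z * a₂⁻¹)] := by
  rw [matDz, sqrtR, ← Matrix.diagonal_smul]
  congr 1
  ext i; fin_cases i <;> simp

/-- Multiplied by `R1⁻¹` from the left, the matrix equation has zero diagonal, and its two
off-diagonal entries are the same equation for `dθ1`. -/
lemma isMatrixBacklundAt_iff_fderiv (hε : ε = 1 ∨ ε = -1) (hs : s = 1 ∨ s = -1)
    (h0 : DifferentiableAt ℝ θ0 p) (h1 : DifferentiableAt ℝ θ1 p) :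
    IsMatrixBacklundAt ε s (Matrix.diagonal ![d₁, d₂]) θ0 θ1 p ↔
      ∀ ξ : ℝ × ℝ, fderiv ℝ θ1 p ξ = s * fderiv ℝ θ0 p (ξ.2, ξ.1) +
        s * (cosE ε (θ0 p) * d₂ * sinE ε (θ1 p) - sinE ε (θ0 p) * d₁ * cosE ε (θ1 p)) * ξ.2 -
        (cosE ε (θ0 p) * d₁ * sinE ε (θ1 p) - sinE ε (θ0 p) * d₂ * cosE ε (θ1 p)) * ξ.1 := by
  have ee := eps_mul_self hε
  have ss := eps_mul_self hs
  have k := cosE_sq_sub hε (θ1 p)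
  unfold IsMatrixBacklundAt
  refine forall_congr' fun ξ => ?_
  rw [matD_rot hε h1, connOmega_eq hε h0, rot_inv hε, rot, rot]
  generalize fderiv ℝ θ1 p ξ = t
  generalize fderiv ℝ θ0 p (ξ.2, ξ.1) = o
  generalize cosE ε (θ0 p) = C0
  generalize sinE ε (θ0 p) = S0
  generalize cosE ε (θ1 p) = C at *
  generalize sinE ε (θ1 p) = S at *
  rw [← Matrix.ext_iff]
  simp only [Fin.forall_fin_two, signMat, delta, Matrix.mul_apply, Fin.sum_univ_two,
    Matrix.add_apply, Matrix.sub_apply, Matrix.neg_apply, Matrix.smul_apply, Matrix.of_apply,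
    Matrix.diagonal_apply, Matrix.cons_val_zero, Matrix.cons_val_one, Matrix.cons_val',
    smul_eq_mul, if_true, zero_ne_one, one_ne_zero, if_false, Matrix.cons_val_fin_one]
  obtain ⟨du, dv⟩ := ξ
  dsimp only
  constructor
  · rintro ⟨⟨e11, -⟩, e21, -⟩
    linear_combination (-S) * e11 + C * e21 -
      (t - s * o - s * dv * (C0 * d₂ * S - S0 * d₁ * C)) * k
  · intro e
    refine ⟨⟨?_, ?_⟩, ?_, ?_⟩
    · linear_combination ε * S * e + d₁ * C0 * du * k
    · linear_combination (-s * ε * C) * e + ε * dv * d₁ * S0 * k +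
        ε * (S * (-(ε * S0 * d₁ * S) + C0 * d₂ * C) * dv - C * o -
          C * (C0 * d₂ * S - S0 * d₁ * C) * dv) * ss
    · linear_combination C * e + du * d₂ * S0 * k
    · linear_combination (-s * ε * S) * e + dv * d₂ * C0 * k +
        (C * (-(ε * S0 * d₁ * S) + C0 * d₂ * C) * dv - ε * S * o -
          ε * S * (C0 * d₂ * S - S0 * d₁ * C) * dv) * ss

/-- The classical equations after expanding `𝐒(φ1 ± φ0)` by the addition theorem. -/
lemma isBacklundAt_iff_fderiv (hε : ε = 1 ∨ ε = -1) (hs : s = 1 ∨ s = -1)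
    (h1 : DifferentiableAt ℝ θ1 p)
    (hσ₁ : (σ - σ⁻¹) / 2 = -d₁) (hσ₂ : (σ + σ⁻¹) / 2 = s * d₂) :
    IsBacklundAt ε σ θ0 (fun q => s * θ1 q) p ↔
      (s * partialV θ1 p - partialU θ0 p = cosE ε (θ0 p) * d₂ * sinE ε (θ1 p) -
          sinE ε (θ0 p) * d₁ * cosE ε (θ1 p)) ∧
      (s * partialU θ1 p - partialV θ0 p = -s * (cosE ε (θ0 p) * d₁ * sinE ε (θ1 p) -
          sinE ε (θ0 p) * d₂ * cosE ε (θ1 p))) := by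
  have ss := eps_mul_self hs
  have hU : partialU (fun q => s * θ1 q) p = s * partialU θ1 p := by
    rw [partialU, fderiv_const_mul h1]; rfl
  have hV : partialV (fun q => s * θ1 q) p = s * partialV θ1 p := by
    rw [partialV, fderiv_const_mul h1]; rfl
  have i1 : (σ * (s * sinE ε (θ1 p) * cosE ε (θ0 p) + cosE ε (θ1 p) * sinE ε (θ0 p)) +
      σ⁻¹ * (s * sinE ε (θ1 p) * cosE ε (θ0 p) - cosE ε (θ1 p) * sinE ε (θ0 p))) / 2 =
      cosE ε (θ0 p) * d₂ * sinE ε (θ1 p) - sinE ε (θ0 p) * d₁ * cosE ε (θ1 p) := by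
    linear_combination s * sinE ε (θ1 p) * cosE ε (θ0 p) * hσ₂ +
      cosE ε (θ1 p) * sinE ε (θ0 p) * hσ₁ + d₂ * sinE ε (θ1 p) * cosE ε (θ0 p) * ss
  have i2 : (σ * (s * sinE ε (θ1 p) * cosE ε (θ0 p) + cosE ε (θ1 p) * sinE ε (θ0 p)) -
      σ⁻¹ * (s * sinE ε (θ1 p) * cosE ε (θ0 p) - cosE ε (θ1 p) * sinE ε (θ0 p))) / 2 =
      -s * (cosE ε (θ0 p) * d₁ * sinE ε (θ1 p) - sinE ε (θ0 p) * d₂ * cosE ε (θ1 p)) := by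
    linear_combination s * sinE ε (θ1 p) * cosE ε (θ0 p) * hσ₁ +
      cosE ε (θ1 p) * sinE ε (θ0 p) * hσ₂
  rw [IsBacklundAt, hU, hV, sinE_add hε, sinE_sub hε, sinE_sign_mul hs, cosE_sign_mul hs, i1, i2]

lemma isMatrixBacklundAt_iff_isBacklundAt (hε : ε = 1 ∨ ε = -1) (hs : s = 1 ∨ s = -1)
    (h0 : DifferentiableAt ℝ θ0 p) (h1 : DifferentiableAt ℝ θ1 p)
    (hσ₁ : (σ - σ⁻¹) / 2 = -d₁) (hσ₂ : (σ + σ⁻¹) / 2 = s * d₂) :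
    IsMatrixBacklundAt ε s (Matrix.diagonal ![d₁, d₂]) θ0 θ1 p ↔
      IsBacklundAt ε σ θ0 (fun q => s * θ1 q) p := by
  have ss := eps_mul_self hs
  rw [isMatrixBacklundAt_iff_fderiv hε hs h0 h1, isBacklundAt_iff_fderiv hε hs h1 hσ₁ hσ₂]
  constructor
  · intro h
    have hu := h (1, 0)
    have hv := h (0, 1)
    constructor
    · rw [partialV, partialU, hv]
      linear_combination (fderiv ℝ θ0 p (1, 0) + (cosE ε (θ0 p) * d₂ * sinE ε (θ1 p) -
          sinE ε (θ0 p) * d₁ * cosE ε (θ1 p))) * ss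
    · rw [partialV, partialU, hu]
      linear_combination fderiv ℝ θ0 p (0, 1) * ss
  · rintro ⟨hv, hu⟩ ξ
    rw [fderiv_eq_partials θ1, fderiv_eq_partials θ0]
    simp only [smul_eq_mul]
    linear_combination s * ξ.1 * hu + s * ξ.2 * hv + (-(ξ.1 * partialU θ1 p) -
      ξ.2 * partialV θ1 p - ξ.1 * (cosE ε (θ0 p) * d₁ * sinE ε (θ1 p) -
          sinE ε (θ0 p) * d₂ * cosE ε (θ1 p))) * ss

lemma IsBacklundAt.symm {φ0 φ1 : ℝ × ℝ → ℝ} (h : IsBacklundAt ε σ φ0 φ1 p) :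
    IsBacklundAt ε (-σ) φ1 φ0 p := by
  obtain ⟨h1, h2⟩ := h
  have e : φ0 p - φ1 p = -(φ1 p - φ0 p) := by ring
  constructor
  · rw [e, sinE_neg, add_comm (φ0 p), inv_neg]; linarith
  · rw [e, sinE_neg, add_comm (φ0 p), inv_neg]; linarith

end Backlund

/-! ### The tangency configuration and the differential of a leaf -/

section Leaf
variable {ε a₁ a₂ z : ℝ} {U : Set (ℝ × ℝ)} {x x0 x1 : ℝ × ℝ → Fin 3 → ℝ}
  {V V0 V1 : ℝ × ℝ → Fin 2 → ℝ} {p : ℝ × ℝ}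

/-- The coordinates `√R'_z V - W` of a chord with respect to the frame at `W`. -/
noncomputable def chord (a₁ a₂ z : ℝ) (V W : Fin 2 → ℝ) : Fin 2 → ℝ := sqrtR a₁ a₂ z *ᵥ V - W

lemma chord_zero (V W : Fin 2 → ℝ) : chord a₁ a₂ z V W 0 = √(1 - z * a₁⁻¹) * V 0 - W 0 := by
  simp [chord, sqrtR]

lemma chord_one (V W : Fin 2 → ℝ) : chord a₁ a₂ z V W 1 = √(1 - z * a₂⁻¹) * V 1 - W 1 := by
  simp [chord, sqrtR]

lemma sqrtR_sq (hz : 0 < z) (hza : z < a₁) (ha₂ : a₂ < 0) :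
    √(1 - z * a₁⁻¹) ^ 2 = 1 - z * a₁⁻¹ ∧ √(1 - z * a₂⁻¹) ^ 2 = 1 - z * a₂⁻¹ := by
  have ha₁ : 0 < a₁ := hz.trans hza
  constructor
  · refine Real.sq_sqrt ?_
    rw [← div_eq_mul_inv, sub_nonneg, div_le_one ha₁]; exact hza.le
  · refine Real.sq_sqrt ?_
    have := inv_lt_zero.2 ha₂
    nlinarith

/-- The tangency condition `x_z(W) ∈ T x_0` at `x_0(V)` is symmetric in `V` and `W`. -/
lemma tangency_iff (hε : ε = 1 ∨ ε = -1) (hz : 0 < z) (hza : z < a₁) (ha₂ : a₂ < 0)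
    (V W : Fin 2 → ℝ) :
    (∃ ξ : Fin 2 → ℝ, quadric ε a₁ a₂ z W =
      quadric ε a₁ a₂ 0 V + fderiv ℝ (quadric ε a₁ a₂ 0) V ξ) ↔
    W 0 ^ 2 - ε * W 1 ^ 2 + (V 0 ^ 2 - ε * V 1 ^ 2) + z =
      2 * (√(1 - z * a₁⁻¹) * (V 0 * W 0) - ε * (√(1 - z * a₂⁻¹) * (V 1 * W 1))) := by
  have ha₁ : 0 < a₁ := hz.trans hza
  have hd (ξ : Fin 2 → ℝ) :
      fderiv ℝ (quadric ε a₁ a₂ 0) V ξ = quadricDeriv ε a₁ a₂ 0 V ξ := by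
    have := (fderiv_quadric (ε := ε) (a₁ := a₁) (a₂ := a₂) (z := 0)
      (V := fun W : Fin 2 → ℝ => W) (p := V) differentiableAt_id).2 ξ
    simpa using this
  have s1 : √(a₁ - z) = √a₁ * √(1 - z * a₁⁻¹) := by
    rw [← Real.sqrt_mul ha₁.le]; congr 1; field_simp
  have s2 : √(-a₂ + z) = √(-a₂) * √(1 - z * a₂⁻¹) := by
    rw [← Real.sqrt_mul (by linarith)]; congr 1; have := ha₂.ne; field_simp; ring
  have n1 : √a₁ ≠ 0 := (Real.sqrt_pos.2 ha₁).ne'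
  have n2 : √(-a₂) ≠ 0 := (Real.sqrt_pos.2 (by linarith)).ne'
  have n3 := sqrtSign_ne_zero hε
  constructor
  · rintro ⟨ξ, e⟩
    rw [hd] at e
    have e0 := congrFun e 0
    have e1 := congrFun e 1
    have e2 := congrFun e 2
    simp only [quadric, quadricDeriv, Matrix.cons_val_zero, Matrix.cons_val_one, Matrix.cons_val,
      Pi.add_apply, sub_zero, add_zero, s1, s2, Complex.ofReal_mul] at e0 e1 e2
    rw [← Complex.ofReal_add] at e2
    have e2 := Complex.ofReal_injective e2
    have f0 : √(1 - z * a₁⁻¹) * W 0 = V 0 + ξ 0 := by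
      apply Complex.ofReal_injective
      have : ((√a₁ : ℝ) : ℂ) ≠ 0 := by exact_mod_cast n1
      refine mul_left_cancel₀ this ?_
      push_cast
      linear_combination e0
    have f1 : √(1 - z * a₂⁻¹) * W 1 = V 1 + ξ 1 := by
      apply Complex.ofReal_injective
      have : ((√(-a₂) : ℝ) : ℂ) ≠ 0 := by exact_mod_cast n2
      refine mul_left_cancel₀ (mul_ne_zero this n3) ?_
      push_cast
      linear_combination e1
    linear_combination 2 * e2 - 2 * V 0 * f0 + 2 * ε * V 1 * f1
  · intro e
    refine ⟨chord a₁ a₂ z W V, ?_⟩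
    rw [hd]
    funext i
    fin_cases i
    · simp [quadric, quadricDeriv, s1, chord_zero]; ring
    · simp [quadric, quadricDeriv, s2, chord_one]; ring
    · simp only [quadric, quadricDeriv, Pi.add_apply, chord_zero, chord_one, Fin.reduceFinMk,
        Matrix.cons_val]
      rw [← Complex.ofReal_add]
      congr 1
      linear_combination e / 2

lemma IsLeaf.tangency_eq (hε : ε = 1 ∨ ε = -1) (hz : 0 < z) (hza : z < a₁) (ha₂ : a₂ < 0)
    (hl : IsLeaf ε a₁ a₂ z U x0 V0 x1 V1) (hp : p ∈ U) :
    V1 p 0 ^ 2 - ε * V1 p 1 ^ 2 + (V0 p 0 ^ 2 - ε * V0 p 1 ^ 2) + z =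
      2 * (√(1 - z * a₁⁻¹) * (V0 p 0 * V1 p 0) - ε * (√(1 - z * a₂⁻¹) * (V0 p 1 * V1 p 1))) :=
  (tangency_iff hε hz hza ha₂ _ _).1 (hl.tangency p hp)

/-- The `𝓔`-length of a chord, by the tangency condition. -/
lemma chord_norm (hε : ε = 1 ∨ ε = -1) (hz : 0 < z) (hza : z < a₁) (ha₂ : a₂ < 0)
    {V W : Fin 2 → ℝ} (h : W 0 ^ 2 - ε * W 1 ^ 2 + (V 0 ^ 2 - ε * V 1 ^ 2) + z =
      2 * (√(1 - z * a₁⁻¹) * (V 0 * W 0) - ε * (√(1 - z * a₂⁻¹) * (V 1 * W 1)))) :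
    chord a₁ a₂ z V W 0 ^ 2 - ε * chord a₁ a₂ z V W 1 ^ 2 = -(z * ε * quadricH ε a₁ a₂ V) := by
  obtain ⟨q1, q2⟩ := sqrtR_sq hz hza ha₂
  have ee := eps_mul_self hε
  rw [chord_zero, chord_one, quadricH, div_eq_mul_inv, div_eq_mul_inv]
  linear_combination h + V 0 ^ 2 * q1 - ε * V 1 ^ 2 * q2 + (z * V 0 ^ 2 * a₁⁻¹ + z) * ee

lemma fderiv_chord (hV : DifferentiableAt ℝ V0 p) (hW : DifferentiableAt ℝ V1 p) (ξ : ℝ × ℝ) :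
    (DifferentiableAt ℝ (fun q => chord a₁ a₂ z (V0 q) (V1 q) 0) p ∧
      fderiv ℝ (fun q => chord a₁ a₂ z (V0 q) (V1 q) 0) p ξ =
        √(1 - z * a₁⁻¹) * fderiv ℝ V0 p ξ 0 - fderiv ℝ V1 p ξ 0) ∧
    (DifferentiableAt ℝ (fun q => chord a₁ a₂ z (V0 q) (V1 q) 1) p ∧
      fderiv ℝ (fun q => chord a₁ a₂ z (V0 q) (V1 q) 1) p ξ =
        √(1 - z * a₂⁻¹) * fderiv ℝ V0 p ξ 1 - fderiv ℝ V1 p ξ 1) := by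
  simp only [chord_zero, chord_one]
  have a := (differentiableAt_coord hV 0).const_mul √(1 - z * a₁⁻¹)
  have b := (differentiableAt_coord hV 1).const_mul √(1 - z * a₂⁻¹)
  refine ⟨⟨a.fun_sub (differentiableAt_coord hW 0), ?_⟩,
    b.fun_sub (differentiableAt_coord hW 1), ?_⟩
  · rw [fderiv_fun_sub a (differentiableAt_coord hW 0),
      fderiv_const_mul (differentiableAt_coord hV 0)]
    simp [fderiv_apply_coord hV, fderiv_apply_coord hW]
  · rw [fderiv_fun_sub b (differentiableAt_coord hW 1),
      fderiv_const_mul (differentiableAt_coord hV 1)]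
    simp [fderiv_apply_coord hV, fderiv_apply_coord hW]

/-- The differential of the tangency condition. -/
lemma IsLeaf.fderiv_tangency (hε : ε = 1 ∨ ε = -1) (hz : 0 < z) (hza : z < a₁) (ha₂ : a₂ < 0)
    (hU : IsOpen U) (h0 : IsDeformation ε a₁ a₂ U x0 V0)
    (hl : IsLeaf ε a₁ a₂ z U x0 V0 x1 V1) (hp : p ∈ U) (ξ : ℝ × ℝ) :
    fderiv ℝ V0 p ξ 0 * chord a₁ a₂ z (V1 p) (V0 p) 0 -
        ε * (fderiv ℝ V0 p ξ 1 * chord a₁ a₂ z (V1 p) (V0 p) 1) =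
      -(fderiv ℝ V1 p ξ 0 * chord a₁ a₂ z (V0 p) (V1 p) 0 -
        ε * (fderiv ℝ V1 p ξ 1 * chord a₁ a₂ z (V0 p) (V1 p) 1)) := by
  have d0 := differentiableAt_of_smoothOn hU h0.smooth_V hp
  have d1 := differentiableAt_of_smoothOn hU hl.deformation.smooth_V hp
  have c0 (i : Fin 2) : HasFDerivAt (fun q => V0 q i) _ p :=
    (differentiableAt_coord d0 i).hasFDerivAt
  have c1 (i : Fin 2) : HasFDerivAt (fun q => V1 q i) _ p :=
    (differentiableAt_coord d1 i).hasFDerivAt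
  have L := (((c1 0).pow 2).sub (((c1 1).pow 2).const_mul ε)).add
    (((c0 0).pow 2).sub (((c0 1).pow 2).const_mul ε)) |>.add_const z
  have R := ((((c0 0).mul (c1 0)).const_mul √(1 - z * a₁⁻¹)).sub
    ((((c0 1).mul (c1 1)).const_mul √(1 - z * a₂⁻¹)).const_mul ε)).const_mul 2
  have e : fderiv ℝ _ p = fderiv ℝ _ p := fderiv_congr_on hU hp fun q hq =>
    hl.tangency_eq hε hz hza ha₂ hq
  have e' := congrArg (fun l => l ξ) (L.fderiv.symm.trans (e.trans R.fderiv))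
  simp [← fderiv_apply_coord d0, ← fderiv_apply_coord d1] at e'
  simp only [chord_zero, chord_one]
  linear_combination -e' / 2

lemma matD_frame_mulVec (w : Fin 2 → ℝ) (ξ : ℝ × ℝ)
    (hF : ∀ j, DifferentiableAt ℝ (frameCol x V j) p) :
    matD (frame x V) p ξ *ᵥ w =
      w 0 • fderiv ℝ (frameCol x V 0) p ξ + w 1 • fderiv ℝ (frameCol x V 1) p ξ := by
  ext i
  have e (j : Fin 2) : fderiv ℝ (frameCol x V j) p ξ i = fderiv ℝ (fun q => frame x V q i j) p ξ :=
    fderiv_apply_coord (hF j) ξ i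
  simp [matD, Matrix.mulVec, dotProduct, Fin.sum_univ_two, e, mul_comm]

lemma IsLeaf.position_eq (hl : IsLeaf ε a₁ a₂ z U x0 V0 x1 V1) (hp : p ∈ U) :
    x1 p = x0 p + (chord a₁ a₂ z (V1 p) (V0 p) 0 • frameCol x0 V0 0 p +
      chord a₁ a₂ z (V1 p) (V0 p) 1 • frameCol x0 V0 1 p) := by
  rw [hl.position p hp, frame_mulVec]; rfl

lemma IsLeaf.fderiv_position (hU : IsOpen U) (h0 : IsDeformation ε a₁ a₂ U x0 V0)
    (hl : IsLeaf ε a₁ a₂ z U x0 V0 x1 V1) (hp : p ∈ U) (ξ : ℝ × ℝ) :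
    fderiv ℝ x1 p ξ =
      (√(1 - z * a₁⁻¹) * fderiv ℝ V1 p ξ 0) • frameCol x0 V0 0 p +
      (√(1 - z * a₂⁻¹) * fderiv ℝ V1 p ξ 1) • frameCol x0 V0 1 p +
      (chord a₁ a₂ z (V1 p) (V0 p) 0 • fderiv ℝ (frameCol x0 V0 0) p ξ +
        chord a₁ a₂ z (V1 p) (V0 p) 1 • fderiv ℝ (frameCol x0 V0 1) p ξ) := by
  have d0 := differentiableAt_of_smoothOn hU h0.smooth_V hp
  have d1 := differentiableAt_of_smoothOn hU hl.deformation.smooth_V hp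
  have hF (j : Fin 2) := differentiableAt_of_smoothOn hU
    (smoothOn_frameCol hU h0.smooth_x h0.smooth_V h0.regular j) hp
  obtain ⟨⟨dc0, e0⟩, dc1, e1⟩ := fderiv_chord (a₁ := a₁) (a₂ := a₂) (z := z) d1 d0 ξ
  have t0 := dc0.fun_smul (hF 0)
  have t1 := dc1.fun_smul (hF 1)
  rw [fderiv_congr_on hU hp fun q hq => hl.position_eq hq,
    fderiv_fun_add (differentiableAt_of_smoothOn hU h0.smooth_x hp) (t0.fun_add t1),
    fderiv_fun_add t0 t1, _root_.add_apply, _root_.add_apply, fderiv_smul_apply dc0 (hF 0),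
    fderiv_smul_apply dc1 (hF 1), e0, e1, fderiv_eq_frame (h0.regular p hp)]
  module

/-- The left side of the equation that defines the sign of a leaf is the normal component of the
differential of the leaf. -/
lemma IsLeaf.normal_dot_matD (hU : IsOpen U) (h0 : IsDeformation ε a₁ a₂ U x0 V0)
    (hl : IsLeaf ε a₁ a₂ z U x0 V0 x1 V1) (hp : p ∈ U) (ξ : ℝ × ℝ) :
    normal ε a₁ a₂ x0 V0 p ⬝ᵥ
        (matD (frame x0 V0) p ξ *ᵥ (sqrtR a₁ a₂ z *ᵥ V1 p - V0 p)) =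
      normal ε a₁ a₂ x0 V0 p ⬝ᵥ fderiv ℝ x1 p ξ := by
  have hF (j : Fin 2) := differentiableAt_of_smoothOn hU
    (smoothOn_frameCol hU h0.smooth_x h0.smooth_V h0.regular j) hp
  rw [matD_frame_mulVec _ _ hF, hl.fderiv_position hU h0 hp ξ]
  simp only [dotProduct_add, dotProduct_smul, normal_dot_frameCol, smul_zero, zero_add]
  rfl

/-- The differential of a leaf in the moving frame of the seed: its tangential part is
`[x_α x_β] (√R'_z - Γ ξ'ᵀ 𝓔) dV1`, where `ξ' = √R'_z V0 - V1`. -/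
lemma IsLeaf.fderiv_eq (hε : ε = 1 ∨ ε = -1) (hz : 0 < z) (hza : z < a₁) (ha₂ : a₂ < 0)
    (hU : IsOpen U) (h0 : IsDeformation ε a₁ a₂ U x0 V0)
    (hl : IsLeaf ε a₁ a₂ z U x0 V0 x1 V1) (hp : p ∈ U) (ξ : ℝ × ℝ) :
    fderiv ℝ x1 p ξ =
      (√(1 - z * a₁⁻¹) * fderiv ℝ V1 p ξ 0) • frameCol x0 V0 0 p +
      (√(1 - z * a₂⁻¹) * fderiv ℝ V1 p ξ 1) • frameCol x0 V0 1 p -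
      (fderiv ℝ V1 p ξ 0 * chord a₁ a₂ z (V0 p) (V1 p) 0 -
        ε * (fderiv ℝ V1 p ξ 1 * chord a₁ a₂ z (V0 p) (V1 p) 1)) • christoffel ε a₁ a₂ x0 V0 p +
      (normal ε a₁ a₂ x0 V0 p ⬝ᵥ fderiv ℝ x1 p ξ) • normal ε a₁ a₂ x0 V0 p := by
  have ha₁ := hz.trans hza
  have ht := hl.fderiv_tangency hε hz hza ha₂ hU h0 hp ξ
  have hn : normal ε a₁ a₂ x0 V0 p ⬝ᵥ fderiv ℝ x1 p ξ =
      chord a₁ a₂ z (V1 p) (V0 p) 0 *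
        (normal ε a₁ a₂ x0 V0 p ⬝ᵥ fderiv ℝ (frameCol x0 V0 0) p ξ) +
      chord a₁ a₂ z (V1 p) (V0 p) 1 *
        (normal ε a₁ a₂ x0 V0 p ⬝ᵥ fderiv ℝ (frameCol x0 V0 1) p ξ) := by
    rw [hl.fderiv_position hU h0 hp ξ]
    simp only [dotProduct_add, dotProduct_smul, normal_dot_frameCol, smul_eq_mul]
    ring
  rw [hn, hl.fderiv_position hU h0 hp ξ, fderiv_frameCol hε ha₁ ha₂ hU h0 hp ξ 0,
    fderiv_frameCol hε ha₁ ha₂ hU h0 hp ξ 1]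
  have nn := normal_dot_normal hε ha₁ ha₂ hU h0 hp
  obtain ⟨-, -, cn, -⟩ := frameCol_dot_christoffel hε ha₁ ha₂ hU h0 hp
  simp only [dotProduct_add, dotProduct_smul, nn, cn, smul_eq_mul, mul_zero, zero_add, mul_one,
    lower, Matrix.cons_val_zero, Matrix.cons_val_one]
  linear_combination (norm := module) ht • christoffel ε a₁ a₂ x0 V0 p

/-- Since the leaf has the linear element of `x_0`, the normal component of its differential is
determined up to sign. -/
lemma IsLeaf.normal_component_sq (hε : ε = 1 ∨ ε = -1) (hz : 0 < z) (hza : z < a₁) (ha₂ : a₂ < 0)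
    (hU : IsOpen U) (h0 : IsDeformation ε a₁ a₂ U x0 V0)
    (hl : IsLeaf ε a₁ a₂ z U x0 V0 x1 V1) (hp : p ∈ U) (ξ : ℝ × ℝ) :
    (normal ε a₁ a₂ x0 V0 p ⬝ᵥ fderiv ℝ x1 p ξ) ^ 2 =
      (fderiv ℝ V1 p ξ 0 * chord a₁ a₂ z (V0 p) (V1 p) 1 -
        fderiv ℝ V1 p ξ 1 * chord a₁ a₂ z (V0 p) (V1 p) 0) ^ 2 /
        quadricH ε a₁ a₂ (V0 p) := by
  have ha₁ := hz.trans hza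
  have ee := eps_mul_self hε
  obtain ⟨q1, q2⟩ := sqrtR_sq hz hza ha₂
  obtain ⟨g1, g2, g3⟩ := frame_metric hε ha₁ ha₂ hU h0 hp
  obtain ⟨c0, c1, cn, cc⟩ := frameCol_dot_christoffel hε ha₁ ha₂ hU h0 hp
  have nn := normal_dot_normal hε ha₁ ha₂ hU h0 hp
  have hT := hl.tangency_eq hε hz hza ha₂ hp
  have hN := chord_norm hε hz hza ha₂ hT
  have hH := (h0.region p hp).ne'
  have hm := metric_of_isometric hε ha₁ ha₂ hU hl.deformation hp ξ
  rw [hl.fderiv_eq hε hz hza ha₂ hU h0 hp ξ] at hm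
  have n0 := normal_dot_frameCol (ε := ε) (a₁ := a₁) (a₂ := a₂) (x := x0) (V := V0) p 0
  have n1 := normal_dot_frameCol (ε := ε) (a₁ := a₁) (a₂ := a₂) (x := x0) (V := V0) p 1
  simp only [dotProduct_add, add_dotProduct, dotProduct_sub, sub_dotProduct, dotProduct_smul,
    smul_dotProduct, g1, g2, g3, dotProduct_comm (frameCol x0 V0 1 p) (frameCol x0 V0 0 p),
    dotProduct_comm (christoffel ε a₁ a₂ x0 V0 p) (frameCol x0 V0 0 p),
    dotProduct_comm (christoffel ε a₁ a₂ x0 V0 p) (frameCol x0 V0 1 p),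
    dotProduct_comm (christoffel ε a₁ a₂ x0 V0 p) (normal ε a₁ a₂ x0 V0 p),
    dotProduct_comm (frameCol x0 V0 0 p) (normal ε a₁ a₂ x0 V0 p),
    dotProduct_comm (frameCol x0 V0 1 p) (normal ε a₁ a₂ x0 V0 p),
    c0, c1, cn, cc, nn, n0, n1, smul_eq_mul, metric] at hm
  have a1 : a₁ * a₁⁻¹ = 1 := mul_inv_cancel₀ ha₁.ne'
  have a2 : a₂ * a₂⁻¹ = 1 := mul_inv_cancel₀ ha₂.ne
  have r0 := chord_zero (a₁ := a₁) (a₂ := a₂) (z := z) (V0 p) (V1 p)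
  have r1 := chord_one (a₁ := a₁) (a₂ := a₂) (z := z) (V0 p) (V1 p)
  generalize normal ε a₁ a₂ x0 V0 p ⬝ᵥ fderiv ℝ x1 p ξ = τ at *
  generalize chord a₁ a₂ z (V0 p) (V1 p) 0 = P at *
  generalize chord a₁ a₂ z (V0 p) (V1 p) 1 = Q at *
  generalize fderiv ℝ V1 p ξ 0 = x at *
  generalize fderiv ℝ V1 p ξ 1 = y at *
  generalize quadricH ε a₁ a₂ (V0 p) = H at *
  generalize √(1 - z * a₁⁻¹) = ρ₁ at *
  generalize √(1 - z * a₂⁻¹) = ρ₂ at *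
  have e0 : V1 p 0 = ρ₁ * V0 p 0 - P := by linarith
  have e1 : V1 p 1 = ρ₂ * V0 p 1 - Q := by linarith
  rw [e0, e1] at hm
  have k1 : τ ^ 2 = z * (x ^ 2 - ε * y ^ 2) + ε / H * (x * P - ε * (y * Q)) ^ 2 := by
    linear_combination hm - a₁ * x ^ 2 * q1 + ε * a₂ * y ^ 2 * q2 + x ^ 2 * z * a1
      - ε * y ^ 2 * z * a2 + y ^ 2 * ρ₂ ^ 2 * V0 p 1 ^ 2 * ee
  rw [k1, eq_div_iff hH]
  have k2 : ε / H * H = ε := div_mul_cancel₀ ε hH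
  linear_combination (x * P - ε * (y * Q)) ^ 2 * k2 + ε * (x ^ 2 - ε * y ^ 2) * hN +
    ((x * Q - y * P) ^ 2 - z * H * (x ^ 2 - ε * y ^ 2)) * ee

end Leaf

/-! ### The sign of a leaf, and the symmetry between seed and leaf -/

section LeafSign
variable {ε a₁ a₂ z s : ℝ} {U : Set (ℝ × ℝ)} {x0 x1 : ℝ × ℝ → Fin 3 → ℝ}
  {V0 V1 : ℝ × ℝ → Fin 2 → ℝ} {p : ℝ × ℝ}

/-- The linear form `w ↦ wᵀ ω (√R'_z V0 - V1)`, where `ω = [0, 1; -1, 0]`. -/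
noncomputable def skewForm (a₁ a₂ z : ℝ) (V0 V1 : Fin 2 → ℝ) (w : Fin 2 → ℝ) : ℝ :=
  w 0 * chord a₁ a₂ z V0 V1 1 - w 1 * chord a₁ a₂ z V0 V1 0

/-- The normal component of the differential of the leaf is `s dV1ᵀ ω (√R'_z V0 - V1) / √H0`. -/
def HasNormalComponent (ε a₁ a₂ z s : ℝ) (U : Set (ℝ × ℝ)) (x0 x1 : ℝ × ℝ → Fin 3 → ℝ)
    (V0 V1 : ℝ × ℝ → Fin 2 → ℝ) : Prop :=
  ∀ p ∈ U, ∀ ξ, normal ε a₁ a₂ x0 V0 p ⬝ᵥ fderiv ℝ x1 p ξ =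
    s / √(quadricH ε a₁ a₂ (V0 p)) * skewForm a₁ a₂ z (V0 p) (V1 p) (fderiv ℝ V1 p ξ)

lemma IsLeaf.hasLeafSign (hU : IsOpen U) (h0 : IsDeformation ε a₁ a₂ U x0 V0)
    (hl : IsLeaf ε a₁ a₂ z U x0 V0 x1 V1) (hs : HasNormalComponent ε a₁ a₂ z s U x0 x1 V0 V1) :
    HasLeafSign ε a₁ a₂ z s U x0 V0 V1 := by
  intro p hp ξ
  rw [hl.normal_dot_matD hU h0 hp, hs p hp ξ]
  congr 1
  change _ = fderiv ℝ V1 p ξ ⬝ᵥ (_ *ᵥ chord a₁ a₂ z (V0 p) (V1 p))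
  simp [skewForm, dotProduct, Matrix.mulVec, Fin.sum_univ_two]
  ring

lemma smoothOn_chord {V W : ℝ × ℝ → Fin 2 → ℝ} (hV : ContDiffOn ℝ ∞ V U)
    (hW : ContDiffOn ℝ ∞ W U) (j : Fin 2) :
    ContDiffOn ℝ ∞ (fun q => chord a₁ a₂ z (V q) (W q) j) U := by
  fin_cases j
  · simpa [chord_zero] using
      (contDiffOn_const.mul (smoothOn_coord hV 0)).sub (smoothOn_coord hW 0)
  · simpa [chord_one] using
      (contDiffOn_const.mul (smoothOn_coord hV 1)).sub (smoothOn_coord hW 1)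

lemma smoothOn_quadricH {V : ℝ × ℝ → Fin 2 → ℝ} (hV : ContDiffOn ℝ ∞ V U) :
    ContDiffOn ℝ ∞ (fun q => quadricH ε a₁ a₂ (V q)) U :=
  (((contDiffOn_const.mul ((smoothOn_coord hV 0).pow 2)).div_const _).sub
    (((smoothOn_coord hV 1).pow 2).div_const _)).add contDiffOn_const

/-- At each point, the normal component of `dx1` and `dV1ᵀ ω (√R'_z V0 - V1) / √H0` are linear
forms in `(du, dv)` with the same square, and they are not zero; hence they agree up to a sign,
which is constant by connectedness. -/
lemma IsLeaf.exists_sign (hε : ε = 1 ∨ ε = -1) (hz : 0 < z) (hza : z < a₁) (ha₂ : a₂ < 0)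
    (hU : IsOpen U) (hc : IsPreconnected U) (h0 : IsDeformation ε a₁ a₂ U x0 V0)
    (hl : IsLeaf ε a₁ a₂ z U x0 V0 x1 V1) :
    ∃ s : ℝ, (s = 1 ∨ s = -1) ∧ HasNormalComponent ε a₁ a₂ z s U x0 x1 V0 V1 := by
  have ha₁ := hz.trans hza
  set τ : ℝ × ℝ → ℝ × ℝ → ℝ := fun p ξ => normal ε a₁ a₂ x0 V0 p ⬝ᵥ fderiv ℝ x1 p ξ with hτ
  set ρ : ℝ × ℝ → ℝ × ℝ → ℝ := fun p ξ => (√(quadricH ε a₁ a₂ (V0 p)))⁻¹ *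
    skewForm a₁ a₂ z (V0 p) (V1 p) (fderiv ℝ V1 p ξ) with hρ
  have sq (p : ℝ × ℝ) (hp : p ∈ U) (ξ : ℝ × ℝ) : τ p ξ ^ 2 = ρ p ξ ^ 2 := by
    simp only [hτ, hρ]
    rw [hl.normal_component_sq hε hz hza ha₂ hU h0 hp, mul_pow, inv_pow,
      Real.sq_sqrt (h0.region p hp).le, skewForm]
    field_simp
  have τadd (p ξ η : ℝ × ℝ) : τ p (ξ + η) = τ p ξ + τ p η := by simp [hτ]
  have ρadd (p ξ η : ℝ × ℝ) : ρ p (ξ + η) = ρ p ξ + ρ p η := by simp [hρ, skewForm]; ring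
  have τexp (p ξ : ℝ × ℝ) : τ p ξ = ξ.1 * τ p (1, 0) + ξ.2 * τ p (0, 1) := by
    simp only [hτ]
    rw [fderiv_eq_partials, dotProduct_add, dotProduct_smul, dotProduct_smul]; rfl
  have ρexp (p ξ : ℝ × ℝ) : ρ p ξ = ξ.1 * ρ p (1, 0) + ξ.2 * ρ p (0, 1) := by
    simp only [hρ]
    rw [fderiv_eq_partials]; simp [skewForm, partialU, partialV]; ring
  have mix (p : ℝ × ℝ) (hp : p ∈ U) :
      τ p (1, 0) * τ p (0, 1) = ρ p (1, 0) * ρ p (0, 1) := by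
    have e := sq p hp ((1, 0) + (0, 1))
    rw [τadd, ρadd] at e
    linear_combination (e - sq p hp (1, 0) - sq p hp (0, 1)) / 2
  -- `dV1` takes every value, so `ρ p = 0` would force `√R'_z V0 = V1`, against `chord_norm`
  have ρne (p : ℝ × ℝ) (hp : p ∈ U) : ρ p (1, 0) ^ 2 + ρ p (0, 1) ^ 2 ≠ 0 := by
    intro e
    have e0 : ρ p (1, 0) = 0 := by nlinarith [sq_nonneg (ρ p (1, 0)), sq_nonneg (ρ p (0, 1))]
    have e1 : ρ p (0, 1) = 0 := by nlinarith [sq_nonneg (ρ p (1, 0)), sq_nonneg (ρ p (0, 1))]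
    have hz' (ξ : ℝ × ℝ) : skewForm a₁ a₂ z (V0 p) (V1 p) (fderiv ℝ V1 p ξ) = 0 := by
      have := ρexp p ξ
      rw [e0, e1] at this
      simpa [hρ, (Real.sqrt_pos.2 (h0.region p hp)).ne'] using this
    obtain ⟨ξ, hξ⟩ := exists_fderiv_eq (hl.deformation.regular p hp) ![1, 0]
    obtain ⟨η, hη⟩ := exists_fderiv_eq (hl.deformation.regular p hp) ![0, 1]
    have c1 := hz' ξ
    have c0 := hz' η
    simp [hξ, hη, skewForm] at c1 c0
    have e2 := chord_norm hε hz hza ha₂ (hl.tangency_eq hε hz hza ha₂ hp)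
    rw [c0, c1] at e2
    have hH := (h0.region p hp).ne'
    have : ε ≠ 0 := by rcases hε with rfl | rfl <;> norm_num
    exact mul_ne_zero (mul_ne_zero hz.ne' this) hH (by linear_combination e2)
  have τcont (ξ : ℝ × ℝ) : ContinuousOn (fun p => τ p ξ) U := by
    have hn := smoothOn_normal ha₁ ha₂ hU h0
    have hx := smoothOn_fderiv_apply hU hl.deformation.smooth_x ξ
    simp only [hτ, dotProduct]
    exact (ContDiffOn.sum fun i _ => (smoothOn_coord hn i).mul (smoothOn_coord hx i)).continuousOn
  have ρcont (ξ : ℝ × ℝ) : ContinuousOn (fun p => ρ p ξ) U := by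
    have hv := smoothOn_fderiv_apply hU hl.deformation.smooth_V ξ
    have hH := (((smoothOn_quadricH (ε := ε) (a₁ := a₁) (a₂ := a₂) h0.smooth_V).sqrt
      fun q hq => (h0.region q hq).ne').inv fun q hq => (Real.sqrt_pos.2 (h0.region q hq)).ne')
    have hk (j : Fin 2) := smoothOn_chord (a₁ := a₁) (a₂ := a₂) (z := z) h0.smooth_V
      hl.deformation.smooth_V j
    exact (hH.mul (((smoothOn_coord hv 0).mul (hk 1)).sub
      ((smoothOn_coord hv 1).mul (hk 0)))).continuousOn
  -- `τ p = ± ρ p`, so the scalar product of the coefficients of `τ p` and `ρ p` is `± |ρ p|²`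
  have key := hc.eq_or_eq_neg_of_sq_eq
    (f := fun p => τ p (1, 0) * ρ p (1, 0) + τ p (0, 1) * ρ p (0, 1))
    (g := fun p => ρ p (1, 0) ^ 2 + ρ p (0, 1) ^ 2)
    (((τcont _).mul (ρcont _)).add ((τcont _).mul (ρcont _)))
    (((ρcont _).pow 2).add ((ρcont _).pow 2))
    (fun p hp => by
      simp only [Pi.pow_apply]
      linear_combination ρ p (1, 0) ^ 2 * sq p hp (1, 0) + ρ p (0, 1) ^ 2 * sq p hp (0, 1)
        + 2 * ρ p (1, 0) * ρ p (0, 1) * mix p hp)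
    (fun {p} hp => ρne p hp)
  have of_inner (s : ℝ) (ss : s * s = 1) (h : ∀ p ∈ U,
      τ p (1, 0) * ρ p (1, 0) + τ p (0, 1) * ρ p (0, 1) =
        s * (ρ p (1, 0) ^ 2 + ρ p (0, 1) ^ 2)) :
      HasNormalComponent ε a₁ a₂ z s U x0 x1 V0 V1 := by
    intro p hp ξ
    have e : (τ p (1, 0) - s * ρ p (1, 0)) ^ 2 + (τ p (0, 1) - s * ρ p (0, 1)) ^ 2 = 0 := by
      linear_combination sq p hp (1, 0) + sq p hp (0, 1) - 2 * s * h p hp -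
        (ρ p (1, 0) ^ 2 + ρ p (0, 1) ^ 2) * ss
    have e0 : τ p (1, 0) - s * ρ p (1, 0) = 0 := by
      nlinarith [sq_nonneg (τ p (1, 0) - s * ρ p (1, 0)), sq_nonneg (τ p (0, 1) - s * ρ p (0, 1))]
    have e1 : τ p (0, 1) - s * ρ p (0, 1) = 0 := by
      nlinarith [sq_nonneg (τ p (1, 0) - s * ρ p (1, 0)), sq_nonneg (τ p (0, 1) - s * ρ p (0, 1))]
    have : τ p ξ = s * ρ p ξ := by
      rw [τexp, ρexp]
      linear_combination ξ.1 * e0 + ξ.2 * e1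
    simp only [hτ, hρ] at this
    rw [this]; ring
  rcases key with h | h
  · exact ⟨1, Or.inl rfl, of_inner 1 (by norm_num) fun p hp => by simpa using h hp⟩
  · exact ⟨-1, Or.inr rfl, of_inner (-1) (by norm_num) fun p hp => by simpa using h hp⟩

/-- The frame of the leaf in the moving frame of the seed. -/
lemma IsLeaf.frameCol_eq (hε : ε = 1 ∨ ε = -1) (hz : 0 < z) (hza : z < a₁) (ha₂ : a₂ < 0)
    (hU : IsOpen U) (h0 : IsDeformation ε a₁ a₂ U x0 V0)
    (hl : IsLeaf ε a₁ a₂ z U x0 V0 x1 V1) (hs : HasNormalComponent ε a₁ a₂ z s U x0 x1 V0 V1)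
    (hp : p ∈ U) :
    frameCol x1 V1 0 p = √(1 - z * a₁⁻¹) • frameCol x0 V0 0 p -
        chord a₁ a₂ z (V0 p) (V1 p) 0 • christoffel ε a₁ a₂ x0 V0 p +
        (s / √(quadricH ε a₁ a₂ (V0 p)) * chord a₁ a₂ z (V0 p) (V1 p) 1) •
          normal ε a₁ a₂ x0 V0 p ∧
    frameCol x1 V1 1 p = √(1 - z * a₂⁻¹) • frameCol x0 V0 1 p +
        (ε * chord a₁ a₂ z (V0 p) (V1 p) 1) • christoffel ε a₁ a₂ x0 V0 p -
        (s / √(quadricH ε a₁ a₂ (V0 p)) * chord a₁ a₂ z (V0 p) (V1 p) 0) •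
          normal ε a₁ a₂ x0 V0 p := by
  have hr := hl.deformation.regular p hp
  constructor
  · obtain ⟨ξ, hξ⟩ := exists_fderiv_eq hr ![1, 0]
    have e := hl.fderiv_eq hε hz hza ha₂ hU h0 hp ξ
    rw [hs p hp ξ, fderiv_eq_frame hr, hξ] at e
    simp [skewForm] at e
    simpa using e
  · obtain ⟨ξ, hξ⟩ := exists_fderiv_eq hr ![0, 1]
    have e := hl.fderiv_eq hε hz hza ha₂ hU h0 hp ξ
    rw [hs p hp ξ, fderiv_eq_frame hr, hξ] at e
    simp [skewForm] at e
    rw [e]; module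

/-- The chord seen from the leaf is the chord seen from the seed, reversed. -/
lemma IsLeaf.frame_chord (hε : ε = 1 ∨ ε = -1) (hz : 0 < z) (hza : z < a₁) (ha₂ : a₂ < 0)
    (hU : IsOpen U) (h0 : IsDeformation ε a₁ a₂ U x0 V0)
    (hl : IsLeaf ε a₁ a₂ z U x0 V0 x1 V1) (hs : HasNormalComponent ε a₁ a₂ z s U x0 x1 V0 V1)
    (hp : p ∈ U) :
    chord a₁ a₂ z (V0 p) (V1 p) 0 • frameCol x1 V1 0 p +
        chord a₁ a₂ z (V0 p) (V1 p) 1 • frameCol x1 V1 1 p =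
      -(chord a₁ a₂ z (V1 p) (V0 p) 0 • frameCol x0 V0 0 p +
        chord a₁ a₂ z (V1 p) (V0 p) 1 • frameCol x0 V0 1 p) := by
  obtain ⟨f0, f1⟩ := hl.frameCol_eq hε hz hza ha₂ hU h0 hs hp
  obtain ⟨q1, q2⟩ := sqrtR_sq hz hza ha₂
  have hN := chord_norm hε hz hza ha₂ (hl.tangency_eq hε hz hza ha₂ hp)
  have ee := eps_mul_self hε
  have hH := (h0.region p hp).ne'
  -- `Γ = ε A' V0 / H0`, and `H0` cancels against the `𝓔`-length of the chord
  have hΓ : -(chord a₁ a₂ z (V0 p) (V1 p) 0 ^ 2 - ε * chord a₁ a₂ z (V0 p) (V1 p) 1 ^ 2) •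
      christoffel ε a₁ a₂ x0 V0 p = (z * (a₁⁻¹ * V0 p 0)) • frameCol x0 V0 0 p +
        (z * (a₂⁻¹ * V0 p 1)) • frameCol x0 V0 1 p := by
    rw [hN, christoffel, smul_smul, smul_add, smul_smul, smul_smul]
    have : - -(z * ε * quadricH ε a₁ a₂ (V0 p)) * (ε / quadricH ε a₁ a₂ (V0 p)) = z := by
      field_simp; linear_combination ee
    rw [this]; congr 2 <;> ring
  rw [f0, f1]
  have c0 := chord_zero (a₁ := a₁) (a₂ := a₂) (z := z) (V0 p) (V1 p)
  have c1 := chord_one (a₁ := a₁) (a₂ := a₂) (z := z) (V0 p) (V1 p)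
  have e0 : chord a₁ a₂ z (V0 p) (V1 p) 0 * √(1 - z * a₁⁻¹) + z * (a₁⁻¹ * V0 p 0) =
      -chord a₁ a₂ z (V1 p) (V0 p) 0 := by
    rw [chord_zero, chord_zero]
    linear_combination V0 p 0 * q1
  have e1 : chord a₁ a₂ z (V0 p) (V1 p) 1 * √(1 - z * a₂⁻¹) + z * (a₂⁻¹ * V0 p 1) =
      -chord a₁ a₂ z (V1 p) (V0 p) 1 := by
    rw [chord_one, chord_one]
    linear_combination V0 p 1 * q2
  linear_combination (norm := module) hΓ + e0 • frameCol x0 V0 0 p + e1 • frameCol x0 V0 1 p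

/-- The seed is a leaf of the leaf. -/
lemma IsLeaf.symm (hε : ε = 1 ∨ ε = -1) (hz : 0 < z) (hza : z < a₁) (ha₂ : a₂ < 0)
    (hU : IsOpen U) (h0 : IsDeformation ε a₁ a₂ U x0 V0)
    (hl : IsLeaf ε a₁ a₂ z U x0 V0 x1 V1) (hs : HasNormalComponent ε a₁ a₂ z s U x0 x1 V0 V1) :
    IsLeaf ε a₁ a₂ z U x1 V1 x0 V0 where
  tangency p hp := (tangency_iff hε hz hza ha₂ _ _).2 <| by
    linear_combination hl.tangency_eq hε hz hza ha₂ hp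
  position p hp := by
    rw [frame_mulVec, hl.position_eq hp]
    have := hl.frame_chord hε hz hza ha₂ hU h0 hs hp
    change _ = _ + (chord a₁ a₂ z (V0 p) (V1 p) 0 • _ + chord a₁ a₂ z (V0 p) (V1 p) 1 • _)
    rw [this]
    module
  deformation := h0

/-- Scalar products of a cross product of two vectors in the span of `f`, `g`, `n`. -/
lemma cross_combination_dot (f g n : Fin 3 → ℝ) (a b c d k l : ℝ) :
    ((a • f + b • g + k • n) ⨯₃ (c • f + d • g + l • n)) ⬝ᵥ f =
        (l * b - k * d) * ((f ⨯₃ g) ⬝ᵥ n) ∧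
    ((a • f + b • g + k • n) ⨯₃ (c • f + d • g + l • n)) ⬝ᵥ g =
        (k * c - l * a) * ((f ⨯₃ g) ⬝ᵥ n) := by
  simp only [cross_apply, dotProduct, Fin.sum_univ_three, Pi.add_apply, Pi.smul_apply, smul_eq_mul,
    Matrix.cons_val_zero, Matrix.cons_val_one, Matrix.cons_val]
  constructor <;> ring

/-- The normal of the leaf against the frame of the seed. The normal is the cross product of the
two vectors of `IsLeaf.frameCol_eq`. -/
lemma IsLeaf.normal_dot_frameCol (hε : ε = 1 ∨ ε = -1) (hz : 0 < z) (hza : z < a₁) (ha₂ : a₂ < 0)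
    (hU : IsOpen U) (h0 : IsDeformation ε a₁ a₂ U x0 V0)
    (hl : IsLeaf ε a₁ a₂ z U x0 V0 x1 V1) (hs : HasNormalComponent ε a₁ a₂ z s U x0 x1 V0 V1)
    (hp : p ∈ U) :
    normal ε a₁ a₂ x1 V1 p ⬝ᵥ frameCol x0 V0 0 p =
      s / √(quadricH ε a₁ a₂ (V1 p)) * chord a₁ a₂ z (V1 p) (V0 p) 1 ∧
    normal ε a₁ a₂ x1 V1 p ⬝ᵥ frameCol x0 V0 1 p =
      -(s / √(quadricH ε a₁ a₂ (V1 p)) * chord a₁ a₂ z (V1 p) (V0 p) 0) := by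
  have ha₁ := hz.trans hza
  obtain ⟨f0, f1⟩ := hl.frameCol_eq hε hz hza ha₂ hU h0 hs hp
  obtain ⟨q1, q2⟩ := sqrtR_sq hz hza ha₂
  have ee := eps_mul_self hε
  have hN := chord_norm hε hz hza ha₂ (hl.tangency_eq hε hz hza ha₂ hp)
  have hH0 := h0.region p hp
  have hH1 := hl.deformation.region p hp
  have p0 := scaled_H_pos ha₁ ha₂ h0 hp
  have p1 := scaled_H_pos ha₁ ha₂ hl.deformation hp
  have nn := normal_dot_normal hε ha₁ ha₂ hU h0 hp
  have x0n := cross_frame (x := x0) p p0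
  have x1n := cross_frame (x := x1) p p1
  have aa : 0 < -(a₁ * a₂) := by have := mul_pos ha₁ (neg_pos.2 ha₂); linarith
  have r0 : √(-(a₁ * a₂ * quadricH ε a₁ a₂ (V0 p))) =
      √(-(a₁ * a₂)) * √(quadricH ε a₁ a₂ (V0 p)) := by
    rw [← Real.sqrt_mul aa.le]; congr 1; ring
  have r1 : √(-(a₁ * a₂ * quadricH ε a₁ a₂ (V1 p))) =
      √(-(a₁ * a₂)) * √(quadricH ε a₁ a₂ (V1 p)) := by
    rw [← Real.sqrt_mul aa.le]; congr 1; ring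
  have b0 : 0 < √(quadricH ε a₁ a₂ (V0 p)) := Real.sqrt_pos.2 hH0
  have b1 : 0 < √(quadricH ε a₁ a₂ (V1 p)) := Real.sqrt_pos.2 hH1
  have b2 : 0 < √(-(a₁ * a₂)) := Real.sqrt_pos.2 aa
  set Γ0 := ε / quadricH ε a₁ a₂ (V0 p) * (V0 p 0 / a₁) with hΓ0
  set Γ1 := ε / quadricH ε a₁ a₂ (V0 p) * (V0 p 1 / a₂) with hΓ1
  have hΓ : christoffel ε a₁ a₂ x0 V0 p = Γ0 • frameCol x0 V0 0 p + Γ1 • frameCol x0 V0 1 p := by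
    rw [christoffel, smul_add, smul_smul, smul_smul]
  set P := chord a₁ a₂ z (V0 p) (V1 p) 0 with hP
  set Q := chord a₁ a₂ z (V0 p) (V1 p) 1 with hQ
  set k := s / √(quadricH ε a₁ a₂ (V0 p)) with hk
  have f0' : frameCol x1 V1 0 p = (√(1 - z * a₁⁻¹) - P * Γ0) • frameCol x0 V0 0 p +
      (-(P * Γ1)) • frameCol x0 V0 1 p + (k * Q) • normal ε a₁ a₂ x0 V0 p := by
    rw [f0, hΓ]; module
  have f1' : frameCol x1 V1 1 p = (ε * Q * Γ0) • frameCol x0 V0 0 p +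
      (√(1 - z * a₂⁻¹) + ε * Q * Γ1) • frameCol x0 V0 1 p +
      (-(k * P)) • normal ε a₁ a₂ x0 V0 p := by
    rw [f1, hΓ]; module
  obtain ⟨t0, t1⟩ := cross_combination_dot (frameCol x0 V0 0 p) (frameCol x0 V0 1 p)
    (normal ε a₁ a₂ x0 V0 p) (√(1 - z * a₁⁻¹) - P * Γ0) (-(P * Γ1)) (ε * Q * Γ0)
    (√(1 - z * a₂⁻¹) + ε * Q * Γ1) (k * Q) (-(k * P))
  rw [← f0', ← f1', x1n, x0n, smul_dotProduct, smul_dotProduct, nn, r0, r1] at t0 t1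
  have hG : (P ^ 2 - ε * Q ^ 2) * Γ0 = -(z * (a₁⁻¹ * V0 p 0)) ∧
      (P ^ 2 - ε * Q ^ 2) * Γ1 = -(z * (a₂⁻¹ * V0 p 1)) := by
    have hH := hH0.ne'
    have : z * ε * quadricH ε a₁ a₂ (V0 p) * (ε / quadricH ε a₁ a₂ (V0 p)) = z := by
      field_simp; linear_combination ee
    rw [hN, hΓ0, hΓ1, div_eq_mul_inv (V0 p 0), div_eq_mul_inv (V0 p 1)]
    constructor
    · linear_combination (-(V0 p 0 * a₁⁻¹)) * this
    · linear_combination (-(V0 p 1 * a₂⁻¹)) * this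
  have c0 := chord_zero (a₁ := a₁) (a₂ := a₂) (z := z) (V0 p) (V1 p)
  have c1 := chord_one (a₁ := a₁) (a₂ := a₂) (z := z) (V0 p) (V1 p)
  have d0 := chord_zero (a₁ := a₁) (a₂ := a₂) (z := z) (V1 p) (V0 p)
  have d1 := chord_one (a₁ := a₁) (a₂ := a₂) (z := z) (V1 p) (V0 p)
  rw [← hP] at c0
  rw [← hQ] at c1
  have kb : k * √(quadricH ε a₁ a₂ (V0 p)) = s := div_mul_cancel₀ _ b0.ne'
  have lb : s / √(quadricH ε a₁ a₂ (V1 p)) * √(quadricH ε a₁ a₂ (V1 p)) = s :=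
    div_mul_cancel₀ _ b1.ne'
  simp only [smul_eq_mul, mul_one] at t0 t1
  constructor
  · refine mul_left_cancel₀ (mul_pos b2 b1).ne' ?_
    rw [t0]
    have : -(k * P) * -(P * Γ1) - k * Q * (√(1 - z * a₂⁻¹) + ε * Q * Γ1) =
        k * chord a₁ a₂ z (V1 p) (V0 p) 1 := by
      rw [d1]
      linear_combination k * hG.2 - k * √(1 - z * a₂⁻¹) * c1 - k * V0 p 1 * q2
    rw [this]
    linear_combination √(-(a₁ * a₂)) * chord a₁ a₂ z (V1 p) (V0 p) 1 * (kb - lb)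
  · refine mul_left_cancel₀ (mul_pos b2 b1).ne' ?_
    rw [t1]
    have : k * Q * (ε * Q * Γ0) - -(k * P) * (√(1 - z * a₁⁻¹) - P * Γ0) =
        -(k * chord a₁ a₂ z (V1 p) (V0 p) 0) := by
      rw [d0]
      linear_combination -k * hG.1 + k * √(1 - z * a₁⁻¹) * c0 + k * V0 p 0 * q1
    rw [this]
    linear_combination (-√(-(a₁ * a₂))) * chord a₁ a₂ z (V1 p) (V0 p) 0 * (kb - lb)

/-- Leaf and seed have the same sign with respect to each other. -/
lemma IsLeaf.hasNormalComponent_symm (hε : ε = 1 ∨ ε = -1) (hz : 0 < z) (hza : z < a₁)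
    (ha₂ : a₂ < 0) (hU : IsOpen U) (h0 : IsDeformation ε a₁ a₂ U x0 V0)
    (hl : IsLeaf ε a₁ a₂ z U x0 V0 x1 V1) (hs : HasNormalComponent ε a₁ a₂ z s U x0 x1 V0 V1) :
    HasNormalComponent ε a₁ a₂ z s U x1 x0 V1 V0 := by
  intro p hp ξ
  obtain ⟨n0, n1⟩ := hl.normal_dot_frameCol hε hz hza ha₂ hU h0 hs hp
  rw [fderiv_eq_frame (h0.regular p hp), dotProduct_add, dotProduct_smul, dotProduct_smul, n0, n1,
    skewForm]
  simp only [smul_eq_mul]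
  ring

end LeafSign

/-! ### The differential of the coordinates of a leaf -/

section LeafFrame
variable {ε a₁ a₂ z s : ℝ} {U : Set (ℝ × ℝ)} {x0 x1 : ℝ × ℝ → Fin 3 → ℝ}
  {V0 V1 : ℝ × ℝ → Fin 2 → ℝ} {θ0 : ℝ × ℝ → ℝ} {Λ0 : ℝ × ℝ → Fin 2 → ℝ} {p : ℝ × ℝ}

/-- `R⁻¹ w`. -/
noncomputable def unrot (ε t : ℝ) (w : Fin 2 → ℝ) : Fin 2 → ℝ :=
  ![cosE ε t * w 0 - ε * (sinE ε t * w 1), -(sinE ε t * w 0) + cosE ε t * w 1]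

/-- The components of the chord `√R'_z V1 - V0` along the curves `u` and `v` of the seed. -/
noncomputable def chordAngle (ε a₁ a₂ z : ℝ) (V0 V1 : ℝ × ℝ → Fin 2 → ℝ) (θ0 : ℝ × ℝ → ℝ)
    (p : ℝ × ℝ) : Fin 2 → ℝ :=
  unrot ε (θ0 p) (chord a₁ a₂ z (V1 p) (V0 p))

/-- The vector `b` such that `√z b` is, up to sign, the first column of `R1`: the solution of
`bᵀ ω ξ' = s μ`, `bᵀ 𝓔 ξ' = -λ` for `ξ' = √R'_z V0 - V1`. -/
noncomputable def leafDir (ε a₁ a₂ z s : ℝ) (V0 V1 Λ0 : ℝ × ℝ → Fin 2 → ℝ) (p : ℝ × ℝ) :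
    Fin 2 → ℝ :=
  ![ε / (z * quadricH ε a₁ a₂ (V0 p)) * (Λ0 p 0 * chord a₁ a₂ z (V0 p) (V1 p) 0 +
      ε * s * (Λ0 p 1 * chord a₁ a₂ z (V0 p) (V1 p) 1)),
    ε / (z * quadricH ε a₁ a₂ (V0 p)) * (Λ0 p 0 * chord a₁ a₂ z (V0 p) (V1 p) 1 +
      s * (Λ0 p 1 * chord a₁ a₂ z (V0 p) (V1 p) 0))]

lemma unrot_norm (hε : ε = 1 ∨ ε = -1) (t : ℝ) (w : Fin 2 → ℝ) :
    unrot ε t w 0 ^ 2 - ε * unrot ε t w 1 ^ 2 = w 0 ^ 2 - ε * w 1 ^ 2 := by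
  simp [unrot]
  linear_combination (w 0 ^ 2 - ε * w 1 ^ 2) * cosE_sq_sub hε t

lemma rot_unrot (hε : ε = 1 ∨ ε = -1) (t : ℝ) (w : Fin 2 → ℝ) :
    w 0 = cosE ε t * unrot ε t w 0 + ε * (sinE ε t * unrot ε t w 1) ∧
    w 1 = sinE ε t * unrot ε t w 0 + cosE ε t * unrot ε t w 1 := by
  simp [unrot]
  constructor
  · linear_combination -w 0 * cosE_sq_sub hε t
  · linear_combination -w 1 * cosE_sq_sub hε t

/-- The normal components of the derivatives of the frame, from the second fundamental form
`λ μ (du² - dv²) / √H` and `dV = R δ Λ`. -/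
lemma normal_dot_fderiv_frameCol (hε : ε = 1 ∨ ε = -1) (hU : IsOpen U)
    (h0 : IsDeformation ε a₁ a₂ U x0 V0) (hA : IsAngleData ε a₁ a₂ U x0 V0 θ0 Λ0)
    (hII : HasSecondForm ε a₁ a₂ U x0 V0 Λ0) (hp : p ∈ U) :
    normal ε a₁ a₂ x0 V0 p ⬝ᵥ fderiv ℝ (frameCol x0 V0 0) p (1, 0) =
      cosE ε (θ0 p) * Λ0 p 1 / √(quadricH ε a₁ a₂ (V0 p)) ∧
    normal ε a₁ a₂ x0 V0 p ⬝ᵥ fderiv ℝ (frameCol x0 V0 1) p (1, 0) =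
      -(ε * (sinE ε (θ0 p) * Λ0 p 1 / √(quadricH ε a₁ a₂ (V0 p)))) ∧
    normal ε a₁ a₂ x0 V0 p ⬝ᵥ fderiv ℝ (frameCol x0 V0 0) p (0, 1) =
      sinE ε (θ0 p) * Λ0 p 0 / √(quadricH ε a₁ a₂ (V0 p)) ∧
    normal ε a₁ a₂ x0 V0 p ⬝ᵥ fderiv ℝ (frameCol x0 V0 1) p (0, 1) =
      -(cosE ε (θ0 p) * Λ0 p 0 / √(quadricH ε a₁ a₂ (V0 p))) := by
  obtain ⟨pu0, pu1, pv0, pv1⟩ := hA.partials hp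
  obtain ⟨hl, hm⟩ := hA.ne_zero hp
  have k := cosE_sq_sub hε (θ0 p)
  have uu := hII p hp (1, 0) (1, 0)
  have uv := hII p hp (1, 0) (0, 1)
  have vu := hII p hp (0, 1) (1, 0)
  have vv := hII p hp (0, 1) (0, 1)
  rw [secondForm_eq hU h0 hp] at uu uv vu vv
  rw [pu0, pu1] at uu vu
  rw [pv0, pv1] at uv vv
  generalize normal ε a₁ a₂ x0 V0 p ⬝ᵥ fderiv ℝ (frameCol x0 V0 0) p (1, 0) = A at *
  generalize normal ε a₁ a₂ x0 V0 p ⬝ᵥ fderiv ℝ (frameCol x0 V0 1) p (1, 0) = B at *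
  generalize normal ε a₁ a₂ x0 V0 p ⬝ᵥ fderiv ℝ (frameCol x0 V0 0) p (0, 1) = C at *
  generalize normal ε a₁ a₂ x0 V0 p ⬝ᵥ fderiv ℝ (frameCol x0 V0 1) p (0, 1) = D at *
  have u1 : cosE ε (θ0 p) * A + sinE ε (θ0 p) * B = Λ0 p 1 / √(quadricH ε a₁ a₂ (V0 p)) := by
    refine mul_left_cancel₀ hl ?_
    linear_combination uu
  have u2 : ε * sinE ε (θ0 p) * A + cosE ε (θ0 p) * B = 0 := by
    refine mul_left_cancel₀ hm ?_
    linear_combination uv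
  have v1 : cosE ε (θ0 p) * C + sinE ε (θ0 p) * D = 0 := by
    refine mul_left_cancel₀ hl ?_
    linear_combination vu
  have v2 : ε * sinE ε (θ0 p) * C + cosE ε (θ0 p) * D =
      -(Λ0 p 0 / √(quadricH ε a₁ a₂ (V0 p))) := by
    refine mul_left_cancel₀ hm ?_
    linear_combination vv
  refine ⟨?_, ?_, ?_, ?_⟩
  · linear_combination cosE ε (θ0 p) * u1 - sinE ε (θ0 p) * u2 - A * k
  · linear_combination -ε * sinE ε (θ0 p) * u1 + cosE ε (θ0 p) * u2 - B * k
  · linear_combination cosE ε (θ0 p) * v1 - sinE ε (θ0 p) * v2 - C * k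
  · linear_combination -ε * sinE ε (θ0 p) * v1 + cosE ε (θ0 p) * v2 - D * k

/-- The vector `√z b` lies on the conic `c² - ε σ² = 1`, and `√R'_z V0 - V1` is recovered from `b`
and `Λ0`. -/
lemma leafDir_spec (hε : ε = 1 ∨ ε = -1) (hs1 : s = 1 ∨ s = -1)
    (hz : 0 < z) (hza : z < a₁) (ha₂ : a₂ < 0)
    (h0 : IsDeformation ε a₁ a₂ U x0 V0) (hA : IsAngleData ε a₁ a₂ U x0 V0 θ0 Λ0)
    (hl : IsLeaf ε a₁ a₂ z U x0 V0 x1 V1) (hp : p ∈ U) :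
    leafDir ε a₁ a₂ z s V0 V1 Λ0 p 0 ^ 2 - ε * leafDir ε a₁ a₂ z s V0 V1 Λ0 p 1 ^ 2 = z⁻¹ ∧
    Λ0 p 0 * leafDir ε a₁ a₂ z s V0 V1 Λ0 p 0 - ε * (s * (Λ0 p 1 *
      leafDir ε a₁ a₂ z s V0 V1 Λ0 p 1)) = -(z⁻¹ * chord a₁ a₂ z (V0 p) (V1 p) 0) ∧
    s * (Λ0 p 1 * leafDir ε a₁ a₂ z s V0 V1 Λ0 p 0) - Λ0 p 0 *
      leafDir ε a₁ a₂ z s V0 V1 Λ0 p 1 = z⁻¹ * chord a₁ a₂ z (V0 p) (V1 p) 1 := by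
  have ee := eps_mul_self hε
  have ss := eps_mul_self hs1
  have hN := chord_norm hε hz hza ha₂ (hl.tangency_eq hε hz hza ha₂ hp)
  have hL := (hA.normalized_apply hε hp).2
  have hH := (h0.region p hp).ne'
  have hz' := hz.ne'
  simp only [leafDir, Matrix.cons_val_zero, Matrix.cons_val_one]
  generalize chord a₁ a₂ z (V0 p) (V1 p) 0 = P at *
  generalize chord a₁ a₂ z (V0 p) (V1 p) 1 = Q at *
  generalize quadricH ε a₁ a₂ (V0 p) = H at *
  generalize Λ0 p 0 = l at *
  generalize Λ0 p 1 = m at *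
  have hK : ε / (z * H) * (ε * H) = z⁻¹ := by field_simp; linear_combination ee
  have hK2 : ε / (z * H) * (z * ε * H) = 1 := by field_simp; linear_combination ee
  generalize ε / (z * H) = K at *
  refine ⟨?_, ?_, ?_⟩
  · have e : (K * (l * P + ε * s * (m * Q))) ^ 2 - ε * (K * (l * Q + s * (m * P))) ^ 2 =
        K ^ 2 * ((l ^ 2 - ε * m ^ 2) * (P ^ 2 - ε * Q ^ 2)) := by
      linear_combination K ^ 2 * (ε ^ 2 * m ^ 2 * Q ^ 2 - ε * m ^ 2 * P ^ 2) * ss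
    rw [e, hL, hN, ← hK]
    linear_combination K * (ε * H) * hK2
  · linear_combination K * P * hL - P * hK - ε * m ^ 2 * P * K * ss
  · linear_combination -(K * Q * hL) + Q * hK + ε * m ^ 2 * Q * K * ss

/-- The differential of the leaf coordinates `V1` in terms of the seed, with `ζ` the chord in the
directions `u`, `v` of the seed: `V1_u = ζ₀ b` and `V1_v = -s ζ₁ (ε b₁, b₀)`. The differentiated
tangency condition gives `dV1ᵀ 𝓔 ξ'`, the normal component of `dx1` gives `dV1ᵀ ω ξ'`, where
`ξ' = √R'_z V0 - V1`. -/
lemma IsLeaf.partials (hε : ε = 1 ∨ ε = -1) (hs1 : s = 1 ∨ s = -1)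
    (hz : 0 < z) (hza : z < a₁) (ha₂ : a₂ < 0)
    (hU : IsOpen U) (h0 : IsDeformation ε a₁ a₂ U x0 V0)
    (hA : IsAngleData ε a₁ a₂ U x0 V0 θ0 Λ0) (hII : HasSecondForm ε a₁ a₂ U x0 V0 Λ0)
    (hl : IsLeaf ε a₁ a₂ z U x0 V0 x1 V1) (hs : HasNormalComponent ε a₁ a₂ z s U x0 x1 V0 V1)
    (hp : p ∈ U) :
    fderiv ℝ V1 p (1, 0) 0 =
      chordAngle ε a₁ a₂ z V0 V1 θ0 p 0 * leafDir ε a₁ a₂ z s V0 V1 Λ0 p 0 ∧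
    fderiv ℝ V1 p (1, 0) 1 =
      chordAngle ε a₁ a₂ z V0 V1 θ0 p 0 * leafDir ε a₁ a₂ z s V0 V1 Λ0 p 1 ∧
    fderiv ℝ V1 p (0, 1) 0 =
      -(s * chordAngle ε a₁ a₂ z V0 V1 θ0 p 1 * (ε * leafDir ε a₁ a₂ z s V0 V1 Λ0 p 1)) ∧
    fderiv ℝ V1 p (0, 1) 1 =
      -(s * chordAngle ε a₁ a₂ z V0 V1 θ0 p 1 * leafDir ε a₁ a₂ z s V0 V1 Λ0 p 0) := by
  have ee := eps_mul_self hε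
  have ss := eps_mul_self hs1
  have hN := chord_norm hε hz hza ha₂ (hl.tangency_eq hε hz hza ha₂ hp)
  have hH := h0.region p hp
  have hw : √(quadricH ε a₁ a₂ (V0 p)) ≠ 0 := (Real.sqrt_pos.2 hH).ne'
  obtain ⟨nu0, nu1, nv0, nv1⟩ := normal_dot_fderiv_frameCol hε hU h0 hA hII hp
  obtain ⟨pu0, pu1, pv0, pv1⟩ := hA.partials hp
  have tu := hl.fderiv_tangency hε hz hza ha₂ hU h0 hp (1, 0)
  have tv := hl.fderiv_tangency hε hz hza ha₂ hU h0 hp (0, 1)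
  have su := hs p hp (1, 0)
  have sv := hs p hp (0, 1)
  rw [hl.fderiv_position hU h0 hp] at su sv
  simp only [dotProduct_add, dotProduct_smul, Paraboloid.normal_dot_frameCol, smul_eq_mul, nu0, nu1,
    nv0, nv1, skewForm] at su sv
  rw [pu0, pu1] at tu
  rw [pv0, pv1] at tv
  simp only [chordAngle, unrot, leafDir, Matrix.cons_val_zero, Matrix.cons_val_one]
  generalize chord a₁ a₂ z (V0 p) (V1 p) 0 = P at *
  generalize chord a₁ a₂ z (V0 p) (V1 p) 1 = Q at *
  generalize chord a₁ a₂ z (V1 p) (V0 p) 0 = X at *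
  generalize chord a₁ a₂ z (V1 p) (V0 p) 1 = Y at *
  generalize Λ0 p 0 = l at *
  generalize Λ0 p 1 = m at *
  have hK2 : ε / (z * quadricH ε a₁ a₂ (V0 p)) * (z * ε * quadricH ε a₁ a₂ (V0 p)) = 1 := by
    have := hz.ne'
    have := hH.ne'
    field_simp; linear_combination ee
  have su' : fderiv ℝ V1 p (1, 0) 0 * Q - fderiv ℝ V1 p (1, 0) 1 * P =
      s * (m * (cosE ε (θ0 p) * X - ε * (sinE ε (θ0 p) * Y))) := by
    field_simp at su
    linear_combination -s * su - (fderiv ℝ V1 p (1, 0) 0 * Q - fderiv ℝ V1 p (1, 0) 1 * P) * ss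
  have sv' : fderiv ℝ V1 p (0, 1) 0 * Q - fderiv ℝ V1 p (0, 1) 1 * P =
      -(s * (l * (-(sinE ε (θ0 p) * X) + cosE ε (θ0 p) * Y))) := by
    field_simp at sv
    linear_combination -s * sv - (fderiv ℝ V1 p (0, 1) 0 * Q - fderiv ℝ V1 p (0, 1) 1 * P) * ss
  generalize ε / (z * quadricH ε a₁ a₂ (V0 p)) = K at *
  have hN' : -(K * (P ^ 2 - ε * Q ^ 2)) = 1 := by rw [hN]; linear_combination hK2
  refine ⟨?_, ?_, ?_, ?_⟩
  · linear_combination (-fderiv ℝ V1 p (1, 0) 0) * hN' - K * P * tu + K * ε * Q * su'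
  · linear_combination (-fderiv ℝ V1 p (1, 0) 1) * hN' - K * Q * tu + K * P * su'
  · linear_combination (-fderiv ℝ V1 p (0, 1) 0) * hN' - K * P * tv + K * ε * Q * sv' -
      K * P * ε * m * (sinE ε (θ0 p) * X - cosE ε (θ0 p) * Y) * ss
  · linear_combination (-fderiv ℝ V1 p (0, 1) 1) * hN' - K * Q * tv + K * P * sv' -
      K * Q * ε * m * (sinE ε (θ0 p) * X - cosE ε (θ0 p) * Y) * ss

end LeafFrame

/-! ### Derivatives of the normal and of the Christoffel vector -/

section LeafSecondForm
variable {ε a₁ a₂ z s : ℝ} {U : Set (ℝ × ℝ)} {x x0 x1 : ℝ × ℝ → Fin 3 → ℝ}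
  {V V0 V1 : ℝ × ℝ → Fin 2 → ℝ} {θ0 : ℝ × ℝ → ℝ} {Λ0 : ℝ × ℝ → Fin 2 → ℝ} {p : ℝ × ℝ}

/-- The scalar products of `dN` with the moving frame. -/
lemma fderiv_normal_dot (hε : ε = 1 ∨ ε = -1) (ha₁ : 0 < a₁) (ha₂ : a₂ < 0) (hU : IsOpen U)
    (h : IsDeformation ε a₁ a₂ U x V) (hp : p ∈ U) (ξ : ℝ × ℝ) :
    (∀ j, frameCol x V j p ⬝ᵥ fderiv ℝ (normal ε a₁ a₂ x V) p ξ =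
      -(normal ε a₁ a₂ x V p ⬝ᵥ fderiv ℝ (frameCol x V j) p ξ)) ∧
    normal ε a₁ a₂ x V p ⬝ᵥ fderiv ℝ (normal ε a₁ a₂ x V) p ξ = 0 := by
  have dN := differentiableAt_of_smoothOn hU (smoothOn_normal ha₁ ha₂ hU h) hp
  constructor
  · intro j
    have dF := differentiableAt_of_smoothOn hU
      (smoothOn_frameCol hU h.smooth_x h.smooth_V h.regular j) hp
    have e := fderiv_dotProduct dN dF ξ
    rw [fderiv_congr_on (g := fun _ => (0 : ℝ)) hU hp fun q _ => normal_dot_frameCol q j,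
      dotProduct_comm (fderiv ℝ (normal ε a₁ a₂ x V) p ξ)] at e
    simp at e
    linarith
  · have e := fderiv_dotProduct dN dN ξ
    rw [fderiv_congr_on (g := fun _ => (1 : ℝ)) hU hp fun q hq =>
      normal_dot_normal hε ha₁ ha₂ hU h hq, dotProduct_comm (fderiv ℝ _ p ξ)] at e
    simp at e
    linarith

lemma fderiv_quadricH (hV : DifferentiableAt ℝ V p) (ξ : ℝ × ℝ) :
    DifferentiableAt ℝ (fun q => quadricH ε a₁ a₂ (V q)) p ∧
    fderiv ℝ (fun q => quadricH ε a₁ a₂ (V q)) p ξ =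
      2 * (ε * a₁⁻¹ * (V p 0 * fderiv ℝ V p ξ 0) - a₂⁻¹ * (V p 1 * fderiv ℝ V p ξ 1)) := by
  have c (i : Fin 2) : HasFDerivAt (fun q => V q i) _ p :=
    (differentiableAt_coord hV i).hasFDerivAt
  have e : (fun q => quadricH ε a₁ a₂ (V q)) =
      fun q => ε * a₁⁻¹ * V q 0 ^ 2 - a₂⁻¹ * V q 1 ^ 2 + ε := by
    funext q; simp only [quadricH]; ring
  rw [e]
  have L := ((((c 0).pow 2).const_mul (ε * a₁⁻¹)).sub (((c 1).pow 2).const_mul a₂⁻¹)).add_const ε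
  refine ⟨L.differentiableAt, ?_⟩
  refine (congrArg (fun l => l ξ) L.fderiv).trans ?_
  simp [← fderiv_apply_coord hV]
  ring

lemma fderiv_div_sqrt {H : ℝ × ℝ → ℝ} (hH : DifferentiableAt ℝ H p) (h : 0 < H p) (ξ : ℝ × ℝ) :
    DifferentiableAt ℝ (fun q => s / √(H q)) p ∧
    fderiv ℝ (fun q => s / √(H q)) p ξ = -(s / √(H p)) * (fderiv ℝ H p ξ / (2 * H p)) := by
  have L : HasFDerivAt (fun q => s / √(H q)) _ p :=
    ((hasDerivAt_inv (Real.sqrt_pos.2 h).ne').comp_hasFDerivAt p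
      (hH.hasFDerivAt.sqrt h.ne')).const_mul s
  refine ⟨L.differentiableAt, ?_⟩
  rw [L.fderiv]
  have hs := Real.sq_sqrt h.le
  have := (Real.sqrt_pos.2 h).ne'
  simp
  rw [hs]
  field_simp

lemma fderiv_christoffel (hU : IsOpen U) (h : IsDeformation ε a₁ a₂ U x V) (hp : p ∈ U)
    (ξ : ℝ × ℝ) :
    DifferentiableAt ℝ (christoffel ε a₁ a₂ x V) p ∧
    fderiv ℝ (christoffel ε a₁ a₂ x V) p ξ =
      -(fderiv ℝ (fun q => quadricH ε a₁ a₂ (V q)) p ξ / quadricH ε a₁ a₂ (V p)) •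
          christoffel ε a₁ a₂ x V p +
        (ε / quadricH ε a₁ a₂ (V p)) •
          (((fderiv ℝ V p ξ 0 / a₁) • frameCol x V 0 p +
              (V p 0 / a₁) • fderiv ℝ (frameCol x V 0) p ξ) +
            ((fderiv ℝ V p ξ 1 / a₂) • frameCol x V 1 p +
              (V p 1 / a₂) • fderiv ℝ (frameCol x V 1) p ξ)) := by
  have dV := differentiableAt_of_smoothOn hU h.smooth_V hp
  have dF (j : Fin 2) := differentiableAt_of_smoothOn hU
    (smoothOn_frameCol hU h.smooth_x h.smooth_V h.regular j) hp
  obtain ⟨dH, -⟩ := fderiv_quadricH (ε := ε) (a₁ := a₁) (a₂ := a₂) dV ξ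
  have hH := (h.region p hp).ne'
  have c (i : Fin 2) (a : ℝ) : DifferentiableAt ℝ (fun q => V q i / a) p :=
    by simpa only [div_eq_mul_inv] using (differentiableAt_coord dV i).mul_const a⁻¹
  have dc (i : Fin 2) (a : ℝ) : fderiv ℝ (fun q => V q i / a) p ξ = fderiv ℝ V p ξ i / a := by
    simp only [div_eq_mul_inv]
    rw [fderiv_mul_const (differentiableAt_coord dV i), fderiv_apply_coord dV]
    simp [mul_comm]
  have L : HasFDerivAt (fun q => ε / quadricH ε a₁ a₂ (V q)) _ p :=
    ((hasDerivAt_inv hH).comp_hasFDerivAt p dH.hasFDerivAt).const_mul ε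
  have t0 := (c 0 a₁).fun_smul (dF 0)
  have t1 := (c 1 a₂).fun_smul (dF 1)
  have e : christoffel ε a₁ a₂ x V = fun q => (ε / quadricH ε a₁ a₂ (V q)) •
    ((V q 0 / a₁) • frameCol x V 0 q + (V q 1 / a₂) • frameCol x V 1 q) := rfl
  rw [e]
  refine ⟨L.differentiableAt.fun_smul (t0.fun_add t1), ?_⟩
  rw [fderiv_smul_apply L.differentiableAt (t0.fun_add t1), fderiv_fun_add t0 t1,
    _root_.add_apply, fderiv_smul_apply (c 0 a₁) (dF 0), fderiv_smul_apply (c 1 a₂) (dF 1), dc, dc,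
    L.fderiv]
  simp only [smul_smul]
  congr 2
  simp
  field_simp

/-- The derivative along `v` of the normal. The Gram matrix of the frame is a correction of rank one
of `diag[a₁, -ε a₂]`, and the correction of its inverse is the term along `Γ`. -/
lemma fderiv_normal_snd (hε : ε = 1 ∨ ε = -1) (ha₁ : 0 < a₁) (ha₂ : a₂ < 0) (hU : IsOpen U)
    (h0 : IsDeformation ε a₁ a₂ U x0 V0) (hA : IsAngleData ε a₁ a₂ U x0 V0 θ0 Λ0)
    (hII : HasSecondForm ε a₁ a₂ U x0 V0 Λ0) (hp : p ∈ U) :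
    fderiv ℝ (normal ε a₁ a₂ x0 V0) p (0, 1) =
      -(ε * Λ0 p 0 / √(quadricH ε a₁ a₂ (V0 p))) •
        ((a₁⁻¹ * (ε * sinE ε (θ0 p))) • frameCol x0 V0 0 p +
          (a₂⁻¹ * cosE ε (θ0 p)) • frameCol x0 V0 1 p -
          (ε * (a₁⁻¹ * V0 p 0 * sinE ε (θ0 p) - a₂⁻¹ * V0 p 1 * cosE ε (θ0 p))) •
            christoffel ε a₁ a₂ x0 V0 p) := by
  have ee := eps_mul_self hε
  obtain ⟨hd, hn⟩ := fderiv_normal_dot hε ha₁ ha₂ hU h0 hp (0, 1)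
  obtain ⟨-, -, nv0, nv1⟩ := normal_dot_fderiv_frameCol hε hU h0 hA hII hp
  obtain ⟨g1, g2, g3⟩ := frame_metric hε ha₁ ha₂ hU h0 hp
  obtain ⟨c0, c1, cn, -⟩ := frameCol_dot_christoffel hε ha₁ ha₂ hU h0 hp
  have A1 : a₁ * a₁⁻¹ = 1 := mul_inv_cancel₀ ha₁.ne'
  have A2 : a₂ * a₂⁻¹ = 1 := mul_inv_cancel₀ ha₂.ne
  rw [← sub_eq_zero]
  refine eq_zero_of_dot_frame hε ha₁ ha₂ hU h0 hp ?_ ?_ ?_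
  · rw [dotProduct_sub, hd, nv0]
    simp only [dotProduct_smul, dotProduct_sub, dotProduct_add, g1, g2, c0, smul_eq_mul,
      neg_mul, mul_neg, div_eq_mul_inv]
    linear_combination (√(quadricH ε a₁ a₂ (V0 p)))⁻¹ * Λ0 p 0 * sinE ε (θ0 p) *
      (ee + ε * ε * A1)
  · rw [dotProduct_sub, hd, nv1]
    simp only [dotProduct_smul, dotProduct_sub, dotProduct_add, g2, g3,
      dotProduct_comm (frameCol x0 V0 1 p) (frameCol x0 V0 0 p), c1, smul_eq_mul,
      neg_mul, mul_neg, div_eq_mul_inv]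
    linear_combination (√(quadricH ε a₁ a₂ (V0 p)))⁻¹ * Λ0 p 0 *
      (-cosE ε (θ0 p) * (ee + ε * ε * A2) - ε * V0 p 1 ^ 2 * a₂⁻¹ * cosE ε (θ0 p) * ee)
  · rw [dotProduct_sub, hn]
    simp only [dotProduct_smul, dotProduct_sub, dotProduct_add, normal_dot_frameCol, cn,
      smul_zero, add_zero, sub_zero]

/-- The vector `b` against `ξ' = √R'_z V0 - V1`. -/
lemma leafDir_chord (hε : ε = 1 ∨ ε = -1) (hz : 0 < z) (hza : z < a₁) (ha₂ : a₂ < 0)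
    (h0 : IsDeformation ε a₁ a₂ U x0 V0) (hl : IsLeaf ε a₁ a₂ z U x0 V0 x1 V1) (hp : p ∈ U) :
    leafDir ε a₁ a₂ z s V0 V1 Λ0 p 0 * chord a₁ a₂ z (V0 p) (V1 p) 0 -
      ε * (leafDir ε a₁ a₂ z s V0 V1 Λ0 p 1 * chord a₁ a₂ z (V0 p) (V1 p) 1) = -Λ0 p 0 ∧
    leafDir ε a₁ a₂ z s V0 V1 Λ0 p 0 * chord a₁ a₂ z (V0 p) (V1 p) 1 -
      leafDir ε a₁ a₂ z s V0 V1 Λ0 p 1 * chord a₁ a₂ z (V0 p) (V1 p) 0 = s * Λ0 p 1 := by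
  have ee := eps_mul_self hε
  have hN := chord_norm hε hz hza ha₂ (hl.tangency_eq hε hz hza ha₂ hp)
  have hK2 : ε / (z * quadricH ε a₁ a₂ (V0 p)) * (z * ε * quadricH ε a₁ a₂ (V0 p)) = 1 := by
    have := hz.ne'
    have := (h0.region p hp).ne'
    field_simp; linear_combination ee
  simp only [leafDir, Matrix.cons_val_zero, Matrix.cons_val_one]
  generalize ε / (z * quadricH ε a₁ a₂ (V0 p)) = K at *
  constructor
  · linear_combination K * Λ0 p 0 * hN - Λ0 p 0 * hK2
  · linear_combination -K * s * Λ0 p 1 * hN + s * Λ0 p 1 * hK2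

end LeafSecondForm

/-! ### The common isothermic-conjugate system on a leaf -/

section LeafConjugate
variable {ε a₁ a₂ z s : ℝ} {U : Set (ℝ × ℝ)} {x x0 x1 : ℝ × ℝ → Fin 3 → ℝ}
  {V V0 V1 : ℝ × ℝ → Fin 2 → ℝ} {θ0 : ℝ × ℝ → ℝ} {Λ0 : ℝ × ℝ → Fin 2 → ℝ} {p : ℝ × ℝ}

lemma fderiv_smul_add_smul_add_smul (r : ℝ) {c k : ℝ × ℝ → ℝ} {F G N : ℝ × ℝ → Fin 3 → ℝ}
    (hc : DifferentiableAt ℝ c p) (hk : DifferentiableAt ℝ k p) (hF : DifferentiableAt ℝ F p)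
    (hG : DifferentiableAt ℝ G p) (hN : DifferentiableAt ℝ N p) (ξ : ℝ × ℝ) :
    fderiv ℝ (fun q => r • F q + c q • G q + k q • N q) p ξ =
      r • fderiv ℝ F p ξ + (fderiv ℝ c p ξ • G p + c p • fderiv ℝ G p ξ) +
        (fderiv ℝ k p ξ • N p + k p • fderiv ℝ N p ξ) := by
  rw [fderiv_fun_add ((hF.fun_const_smul r).fun_add (hc.fun_smul hG)) (hk.fun_smul hN),
    fderiv_fun_add (hF.fun_const_smul r) (hc.fun_smul hG), _root_.add_apply, _root_.add_apply,
    fderiv_smul_apply hc hG, fderiv_smul_apply hk hN, fderiv_fun_const_smul hF]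
  rfl

/-- The curves `u` and `v` are conjugate on the leaf: `N1 · x1_uv = 0`. As
`V1_u = ζ₀ b`, it suffices to consider `b₀ ∂_v x1_α + b₁ ∂_v x1_β`, and the frame of the leaf is
known in the frame of the seed. -/
lemma IsLeaf.secondForm_mixed (hε : ε = 1 ∨ ε = -1) (hs1 : s = 1 ∨ s = -1)
    (hz : 0 < z) (hza : z < a₁) (ha₂ : a₂ < 0)
    (hU : IsOpen U) (h0 : IsDeformation ε a₁ a₂ U x0 V0)
    (hA : IsAngleData ε a₁ a₂ U x0 V0 θ0 Λ0) (hII : HasSecondForm ε a₁ a₂ U x0 V0 Λ0)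
    (hl : IsLeaf ε a₁ a₂ z U x0 V0 x1 V1) (hs : HasNormalComponent ε a₁ a₂ z s U x0 x1 V0 V1)
    (hp : p ∈ U) : secondForm ε a₁ a₂ x1 V1 p (0, 1) (1, 0) = 0 := by
  have ha₁ := hz.trans hza
  have ee := eps_mul_self hε
  have ss := eps_mul_self hs1
  have dV0 := differentiableAt_of_smoothOn hU h0.smooth_V hp
  have dV1 := differentiableAt_of_smoothOn hU hl.deformation.smooth_V hp
  have dF (j : Fin 2) := differentiableAt_of_smoothOn hU
    (smoothOn_frameCol hU h0.smooth_x h0.smooth_V h0.regular j) hp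
  have dN := differentiableAt_of_smoothOn hU (smoothOn_normal ha₁ ha₂ hU h0) hp
  obtain ⟨dG, eG⟩ := fderiv_christoffel hU h0 hp (0, 1)
  obtain ⟨dH, eH⟩ := fderiv_quadricH (ε := ε) (a₁ := a₁) (a₂ := a₂) dV0 (0, 1)
  have hH := h0.region p hp
  obtain ⟨dk, ek⟩ := fderiv_div_sqrt (s := s) dH hH (0, 1)
  obtain ⟨⟨dP, eP⟩, dQ, eQ⟩ := fderiv_chord (a₁ := a₁) (a₂ := a₂) (z := z) dV0 dV1 (0, 1)
  have g0 : ∀ q ∈ U, frameCol x1 V1 0 q = √(1 - z * a₁⁻¹) • frameCol x0 V0 0 q +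
      (-chord a₁ a₂ z (V0 q) (V1 q) 0) • christoffel ε a₁ a₂ x0 V0 q +
      (s / √(quadricH ε a₁ a₂ (V0 q)) * chord a₁ a₂ z (V0 q) (V1 q) 1) •
        normal ε a₁ a₂ x0 V0 q := fun q hq => by
    rw [(hl.frameCol_eq hε hz hza ha₂ hU h0 hs hq).1]; module
  have g1 : ∀ q ∈ U, frameCol x1 V1 1 q = √(1 - z * a₂⁻¹) • frameCol x0 V0 1 q +
      (ε * chord a₁ a₂ z (V0 q) (V1 q) 1) • christoffel ε a₁ a₂ x0 V0 q +
      (-(s / √(quadricH ε a₁ a₂ (V0 q)) * chord a₁ a₂ z (V0 q) (V1 q) 0)) •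
        normal ε a₁ a₂ x0 V0 q := fun q hq => by
    rw [(hl.frameCol_eq hε hz hza ha₂ hU h0 hs hq).2]; module
  have f0 := congrArg (fun l => l (0, 1)) (fderiv_congr_on hU hp g0)
  have f1 := congrArg (fun l => l (0, 1)) (fderiv_congr_on hU hp g1)
  rw [fderiv_smul_add_smul_add_smul _ dP.fun_neg (dk.fun_mul dQ) (dF 0) dG dN,
    fderiv_mul_apply dk dQ, fderiv_fun_neg, _root_.neg_apply] at f0
  rw [fderiv_smul_add_smul_add_smul _ (dQ.const_mul ε) (dk.fun_mul dP).fun_neg (dF 1) dG dN,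
    fderiv_fun_neg, fderiv_const_mul dQ, _root_.neg_apply, fderiv_mul_apply dk dP,
    _root_.smul_apply] at f1
  obtain ⟨nu0, nu1, nv0, nv1⟩ := normal_dot_fderiv_frameCol hε hU h0 hA hII hp
  obtain ⟨pu0, pu1, pv0, pv1⟩ := hA.partials hp
  obtain ⟨y0, y1, w0, w1⟩ := hl.partials hε hs1 hz hza ha₂ hU h0 hA hII hs hp
  obtain ⟨a_norm, a_l, a_m⟩ := leafDir_spec hε hs1 hz hza ha₂ h0 hA hl hp
  obtain ⟨a_P, a_Q⟩ := leafDir_chord (s := s) (Λ0 := Λ0) hε hz hza ha₂ h0 hl hp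
  have hL := (hA.normalized_apply hε hp).2
  obtain ⟨q1, q2⟩ := sqrtR_sq hz hza ha₂
  have ζ1 : chordAngle ε a₁ a₂ z V0 V1 θ0 p 1 =
      -(sinE ε (θ0 p) * (√(1 - z * a₁⁻¹) * V1 p 0 - V0 p 0)) +
        cosE ε (θ0 p) * (√(1 - z * a₂⁻¹) * V1 p 1 - V0 p 1) := by
    simp only [chordAngle, unrot, Matrix.cons_val_one, Matrix.cons_val_zero, chord_zero, chord_one]
  have cP := chord_zero (a₁ := a₁) (a₂ := a₂) (z := z) (V0 p) (V1 p)
  have cQ := chord_one (a₁ := a₁) (a₂ := a₂) (z := z) (V0 p) (V1 p)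
  rw [secondForm_eq hU hl.deformation hp, y0, y1, f0, f1,
    fderiv_normal_snd hε ha₁ ha₂ hU h0 hA hII hp, eG,
    fderiv_frameCol hε ha₁ ha₂ hU h0 hp (0, 1) 0,
    fderiv_frameCol hε ha₁ ha₂ hU h0 hp (0, 1) 1,
    nv0, nv1, eH, ek, eP, eQ, eH]
  simp only [dotProduct_add, dotProduct_sub, dotProduct_smul, smul_eq_mul, lower,
    Matrix.cons_val_zero, Matrix.cons_val_one, pv0, pv1, w0, w1,
    div_eq_mul_inv]
  have hw : (√(quadricH ε a₁ a₂ (V0 p)))⁻¹ * (√(quadricH ε a₁ a₂ (V0 p)))⁻¹ =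
      (quadricH ε a₁ a₂ (V0 p))⁻¹ := by rw [← mul_inv, Real.mul_self_sqrt hH.le]
  have hH1 : quadricH ε a₁ a₂ (V0 p) * (quadricH ε a₁ a₂ (V0 p))⁻¹ = 1 := mul_inv_cancel₀ hH.ne'
  simp only [mul_inv]
  generalize normal ε a₁ a₂ x1 V1 p ⬝ᵥ normal ε a₁ a₂ x0 V0 p = κ at *
  generalize normal ε a₁ a₂ x1 V1 p ⬝ᵥ christoffel ε a₁ a₂ x0 V0 p = γ at *
  generalize normal ε a₁ a₂ x1 V1 p ⬝ᵥ frameCol x0 V0 0 p = n0 at *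
  generalize normal ε a₁ a₂ x1 V1 p ⬝ᵥ frameCol x0 V0 1 p = n1 at *
  generalize (√(quadricH ε a₁ a₂ (V0 p)))⁻¹ = w at *
  generalize (quadricH ε a₁ a₂ (V0 p))⁻¹ = h at *
  generalize quadricH ε a₁ a₂ (V0 p) = H at *
  generalize leafDir ε a₁ a₂ z s V0 V1 Λ0 p 0 = b0 at *
  generalize leafDir ε a₁ a₂ z s V0 V1 Λ0 p 1 = b1 at *
  generalize chordAngle ε a₁ a₂ z V0 V1 θ0 p 0 = Z0 at *
  generalize chordAngle ε a₁ a₂ z V0 V1 θ0 p 1 = Z1 at *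
  generalize chord a₁ a₂ z (V0 p) (V1 p) 0 = P at *
  generalize chord a₁ a₂ z (V0 p) (V1 p) 1 = Q at *
  generalize Λ0 p 0 = l at *
  generalize Λ0 p 1 = m at *
  generalize cosE ε (θ0 p) = C at *
  generalize sinE ε (θ0 p) = S at *
  generalize √(1 - z * a₁⁻¹) = r0 at *
  generalize √(1 - z * a₂⁻¹) = r1 at *
  generalize V0 p 0 = α at *
  generalize V0 p 1 = β at *
  -- the parts of `x1_uv` along `x_α`, `x_β`, `Γ` cancel, and the one along `N0` vanishes
  have hzz : z * z⁻¹ = 1 := mul_inv_cancel₀ hz.ne'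
  have hZ1 : z⁻¹ * Z1 = S * (a₁⁻¹ * α) - C * (a₂⁻¹ * β) + z⁻¹ * (S * (r0 * P) - C * (r1 * Q)) := by
    rw [ζ1, cP, cQ]
    linear_combination z⁻¹ * (C * β * q2 - S * α * q1) + (S * (a₁⁻¹ * α) - C * (a₂⁻¹ * β)) * hzz
  have hκ : S * r0 * (l * b0 - ε * (s * (m * b1))) + C * r1 * (s * (m * b0) - l * b1) +
      s * s * Z1 * (b0 ^ 2 - ε * b1 ^ 2) + ε * l ^ 2 * h * (a₁⁻¹ * α * S - a₂⁻¹ * β * C) -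
      s * s * m ^ 2 * h * (a₁⁻¹ * α * S * ε * ε - a₂⁻¹ * β * C) = 0 := by
    linear_combination S * r0 * a_l + C * r1 * a_m + s * s * Z1 * a_norm + Z1 * z⁻¹ * ss + hZ1 +
      (a₁⁻¹ * α * S - a₂⁻¹ * β * C) * (ε * h * hL - H * h * ee - hH1 + m ^ 2 * h * (ee - ss)) -
      s * s * m ^ 2 * h * (a₁⁻¹ * α * S) * ee
  linear_combination (exp := 1) Z0 * (
    -(-(2 * (ε * a₁⁻¹ * (α * (ε * S * m)) - a₂⁻¹ * (β * (C * m))) * h * γ) +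
      ε * h * (ε * S * m * a₁⁻¹ * n0 + α * a₁⁻¹ * (ε * S * m * γ + S * l * w * κ) +
        (C * m * a₂⁻¹ * n1 + β * a₂⁻¹ * (-ε * (C * m) * γ - C * l * w * κ)))) * a_P +
    (s * w * -(ε * l * w * (a₁⁻¹ * (ε * S) * n0 + a₂⁻¹ * C * n1 -
        ε * (a₁⁻¹ * α * S - a₂⁻¹ * β * C) * γ)) -
      s * w * κ * (m * h * (a₁⁻¹ * α * S * ε * ε - a₂⁻¹ * β * C))) * a_Q +
    (-2 * l * h * m * γ * (a₂⁻¹ * β * C)) * ee +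
    l * m * ε * (a₁⁻¹ * (ε * S) * n0 + a₂⁻¹ * C * n1 - ε * (a₁⁻¹ * α * S - a₂⁻¹ * β * C) * γ) *
      (-(w * w) * ss - hw) +
    κ * w * hκ)

/-- The Jacobian of the leaf coordinates. -/
lemma IsLeaf.det_jac (hε : ε = 1 ∨ ε = -1) (hs1 : s = 1 ∨ s = -1)
    (hz : 0 < z) (hza : z < a₁) (ha₂ : a₂ < 0)
    (hU : IsOpen U) (h0 : IsDeformation ε a₁ a₂ U x0 V0)
    (hA : IsAngleData ε a₁ a₂ U x0 V0 θ0 Λ0) (hII : HasSecondForm ε a₁ a₂ U x0 V0 Λ0)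
    (hl : IsLeaf ε a₁ a₂ z U x0 V0 x1 V1) (hs : HasNormalComponent ε a₁ a₂ z s U x0 x1 V0 V1)
    (hp : p ∈ U) :
    (jac V1 p).det = -(s * chordAngle ε a₁ a₂ z V0 V1 θ0 p 0 *
      chordAngle ε a₁ a₂ z V0 V1 θ0 p 1 / z) := by
  obtain ⟨y0, y1, w0, w1⟩ := hl.partials hε hs1 hz hza ha₂ hU h0 hA hII hs hp
  obtain ⟨a_norm, -, -⟩ := leafDir_spec hε hs1 hz hza ha₂ h0 hA hl hp
  rw [Paraboloid.det_jac, partialU, partialV, y0, y1, w0, w1, div_eq_mul_inv]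
  linear_combination -(s * chordAngle ε a₁ a₂ z V0 V1 θ0 p 0 *
      chordAngle ε a₁ a₂ z V0 V1 θ0 p 1) * a_norm

lemma IsLeaf.chordAngle_ne_zero (hε : ε = 1 ∨ ε = -1) (hs1 : s = 1 ∨ s = -1)
    (hz : 0 < z) (hza : z < a₁) (ha₂ : a₂ < 0)
    (hU : IsOpen U) (h0 : IsDeformation ε a₁ a₂ U x0 V0)
    (hA : IsAngleData ε a₁ a₂ U x0 V0 θ0 Λ0) (hII : HasSecondForm ε a₁ a₂ U x0 V0 Λ0)
    (hl : IsLeaf ε a₁ a₂ z U x0 V0 x1 V1) (hs : HasNormalComponent ε a₁ a₂ z s U x0 x1 V0 V1)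
    (hp : p ∈ U) :
    chordAngle ε a₁ a₂ z V0 V1 θ0 p 0 ≠ 0 ∧ chordAngle ε a₁ a₂ z V0 V1 θ0 p 1 ≠ 0 := by
  have h := hl.deformation.regular p hp
  rw [hl.det_jac hε hs1 hz hza ha₂ hU h0 hA hII hs hp] at h
  constructor <;> intro e <;> simp [e] at h

/-- The diagonal of the second fundamental form of the leaf. The chord `x0 - x1` is a combination
of the frame of the leaf, and the normal component of its derivative is known from the sign of
the seed as a leaf of the leaf. -/
lemma IsLeaf.secondForm_diagonal (hε : ε = 1 ∨ ε = -1) (hs1 : s = 1 ∨ s = -1)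
    (hz : 0 < z) (hza : z < a₁) (ha₂ : a₂ < 0)
    (hU : IsOpen U) (h0 : IsDeformation ε a₁ a₂ U x0 V0)
    (hA : IsAngleData ε a₁ a₂ U x0 V0 θ0 Λ0) (hII : HasSecondForm ε a₁ a₂ U x0 V0 Λ0)
    (hl : IsLeaf ε a₁ a₂ z U x0 V0 x1 V1) (hs : HasNormalComponent ε a₁ a₂ z s U x0 x1 V0 V1)
    (hp : p ∈ U) :
    secondForm ε a₁ a₂ x1 V1 p (1, 0) (1, 0) =
      (jac V1 p).det / √(quadricH ε a₁ a₂ (V1 p)) ∧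
    secondForm ε a₁ a₂ x1 V1 p (0, 1) (0, 1) =
      -((jac V1 p).det / √(quadricH ε a₁ a₂ (V1 p))) := by
  have ss := eps_mul_self hs1
  have hl' := hl.symm hε hz hza ha₂ hU h0 hs
  have hs' := hl.hasNormalComponent_symm hε hz hza ha₂ hU h0 hs
  have vu := hl.secondForm_mixed hε hs1 hz hza ha₂ hU h0 hA hII hs hp
  have uv := vu
  rw [secondForm_comm hU hl.deformation hp] at uv
  have nu := hs' p hp (1, 0)
  have nv := hs' p hp (0, 1)
  rw [hl'.fderiv_position hU hl.deformation hp] at nu nv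
  simp only [dotProduct_add, dotProduct_smul, Paraboloid.normal_dot_frameCol, smul_eq_mul,
    skewForm] at nu nv
  obtain ⟨pu0, pu1, pv0, pv1⟩ := hA.partials hp
  rw [pu0, pu1] at nu
  rw [pv0, pv1] at nv
  obtain ⟨y0, y1, w0, w1⟩ := hl.partials hε hs1 hz hza ha₂ hU h0 hA hII hs hp
  obtain ⟨-, a_l, a_m⟩ := leafDir_spec hε hs1 hz hza ha₂ h0 hA hl hp
  obtain ⟨Z0, Z1⟩ := hl.chordAngle_ne_zero hε hs1 hz hza ha₂ hU h0 hA hII hs hp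
  obtain ⟨hl0, hm0⟩ := hA.ne_zero hp
  have ζ0 : chordAngle ε a₁ a₂ z V0 V1 θ0 p 0 =
      cosE ε (θ0 p) * chord a₁ a₂ z (V1 p) (V0 p) 0 -
        ε * (sinE ε (θ0 p) * chord a₁ a₂ z (V1 p) (V0 p) 1) := by simp [chordAngle, unrot]
  have ζ1 : chordAngle ε a₁ a₂ z V0 V1 θ0 p 1 =
      -(sinE ε (θ0 p) * chord a₁ a₂ z (V1 p) (V0 p) 0) +
        cosE ε (θ0 p) * chord a₁ a₂ z (V1 p) (V0 p) 1 := by simp [chordAngle, unrot]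
  rw [hl.det_jac hε hs1 hz hza ha₂ hU h0 hA hII hs hp]
  rw [secondForm_eq hU hl.deformation hp] at vu uv ⊢
  rw [secondForm_eq hU hl.deformation hp]
  rw [y0, y1] at vu ⊢
  rw [w0, w1] at uv ⊢
  rw [div_eq_mul_inv] at nu nv
  simp only [div_eq_mul_inv]
  generalize (√(quadricH ε a₁ a₂ (V1 p)))⁻¹ = w at *
  generalize normal ε a₁ a₂ x1 V1 p ⬝ᵥ fderiv ℝ (frameCol x1 V1 0) p (1, 0) = A at *
  generalize normal ε a₁ a₂ x1 V1 p ⬝ᵥ fderiv ℝ (frameCol x1 V1 1) p (1, 0) = B at *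
  generalize normal ε a₁ a₂ x1 V1 p ⬝ᵥ fderiv ℝ (frameCol x1 V1 0) p (0, 1) = C at *
  generalize normal ε a₁ a₂ x1 V1 p ⬝ᵥ fderiv ℝ (frameCol x1 V1 1) p (0, 1) = D at *
  generalize leafDir ε a₁ a₂ z s V0 V1 Λ0 p 0 = b0 at *
  generalize leafDir ε a₁ a₂ z s V0 V1 Λ0 p 1 = b1 at *
  generalize chordAngle ε a₁ a₂ z V0 V1 θ0 p 0 = ζ at *
  generalize chordAngle ε a₁ a₂ z V0 V1 θ0 p 1 = η at *
  have e1 : ε * b1 * A + b0 * B = 0 := by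
    refine mul_left_cancel₀ Z1 ?_
    linear_combination -s * uv - η * (ε * b1 * A + b0 * B) * ss
  have e2 : b0 * C + b1 * D = 0 := by
    refine mul_left_cancel₀ Z0 ?_
    linear_combination vu
  constructor
  · refine mul_left_cancel₀ hl0 ?_
    linear_combination -z⁻¹ * ζ * nu + ζ * (A * a_l - B * a_m) + s * Λ0 p 1 * ζ * e1 +
      Λ0 p 0 * ζ * z⁻¹ * s * w * ζ1
  · refine mul_left_cancel₀ hm0 ?_
    linear_combination -z⁻¹ * η * nv + η * (C * a_l - D * a_m) - Λ0 p 0 * η * e2 -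
      Λ0 p 1 * s * η * z⁻¹ * w * ζ0

lemma fderiv_quadricDeriv {W : ℝ × ℝ → Fin 2 → ℝ} (hV : DifferentiableAt ℝ V p)
    (hW : DifferentiableAt ℝ W p) (ξ : ℝ × ℝ) :
    fderiv ℝ (fun q => quadricDeriv ε a₁ a₂ z (V q) (W q)) p ξ =
      quadricDeriv ε a₁ a₂ z (V p) (fderiv ℝ W p ξ) +
        ![0, 0, ((fderiv ℝ V p ξ 0 * W p 0 - ε * fderiv ℝ V p ξ 1 * W p 1 : ℝ) : ℂ)] := by
  have v (i : Fin 2) : HasFDerivAt (fun q => V q i) _ p :=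
    (differentiableAt_coord hV i).hasFDerivAt
  have w (i : Fin 2) : HasFDerivAt (fun q => W q i) _ p :=
    (differentiableAt_coord hW i).hasFDerivAt
  have c0 : HasFDerivAt (fun q => quadricDeriv ε a₁ a₂ z (V q) (W q) 0) _ p :=
    Complex.ofRealCLM.hasFDerivAt.comp p ((w 0).const_mul √(a₁ - z))
  have c1 : HasFDerivAt (fun q => quadricDeriv ε a₁ a₂ z (V q) (W q) 1) _ p :=
    (Complex.ofRealCLM.hasFDerivAt.comp p (w 1)).const_mul
      (((√(-a₂ + z) : ℝ) : ℂ) * sqrtSign ε)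
  have c2 : HasFDerivAt (fun q => quadricDeriv ε a₁ a₂ z (V q) (W q) 2) _ p :=
    Complex.ofRealCLM.hasFDerivAt.comp p
      (((v 0).mul (w 0)).sub (((v 1).const_mul ε).mul (w 1)))
  have hd : DifferentiableAt ℝ (fun q => quadricDeriv ε a₁ a₂ z (V q) (W q)) p := by
    refine differentiableAt_pi.2 fun i => ?_
    fin_cases i
    exacts [c0.differentiableAt, c1.differentiableAt, c2.differentiableAt]
  funext i
  have hi : fderiv ℝ (fun q => quadricDeriv ε a₁ a₂ z (V q) (W q)) p ξ i =
      fderiv ℝ (fun q => quadricDeriv ε a₁ a₂ z (V q) (W q) i) p ξ := by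
    rw [fderiv_apply hd]; rfl
  rw [hi]
  fin_cases i
  · simp only [Fin.zero_eta]
    rw [c0.fderiv]; simp [quadricDeriv, ← fderiv_apply_coord hW]
  · simp only [Fin.mk_one]
    rw [c1.fderiv]; simp [quadricDeriv, ← fderiv_apply_coord hW]
  · simp only [Fin.reduceFinMk]
    rw [c2.fderiv]
    simp [quadricDeriv, ← fderiv_apply_coord hW, ← fderiv_apply_coord hV]
    ring

/-- The second fundamental form of `x_0` is proportional to `dVᵀ 𝓔 dV`. -/
lemma isConjugateAt_quadric (hU : IsOpen U) (hV : ContDiffOn ℝ ∞ V U) (hp : p ∈ U)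
    (h : fderiv ℝ V p (1, 0) 0 * fderiv ℝ V p (0, 1) 0 -
      ε * (fderiv ℝ V p (1, 0) 1 * fderiv ℝ V p (0, 1) 1) = 0) :
    IsConjugateAt (fun q => quadric ε a₁ a₂ z (V q)) p := by
  have dV {q : ℝ × ℝ} (hq : q ∈ U) := differentiableAt_of_smoothOn hU hV hq
  have e : partialV (partialU fun q => quadric ε a₁ a₂ z (V q)) p =
      quadricDeriv ε a₁ a₂ z (V p) (fderiv ℝ (fun q => fderiv ℝ V q (1, 0)) p (0, 1)) := by
    rw [partialV, fderiv_congr_on (f := partialU fun q => quadric ε a₁ a₂ z (V q)) hU hp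
      fun q hq => (fderiv_quadric (dV hq)).2 (1, 0), fderiv_quadricDeriv (dV hp)
      (differentiableAt_of_smoothOn hU (smoothOn_fderiv_apply hU hV _) hp)]
    have : fderiv ℝ V p (0, 1) 0 * fderiv ℝ V p (1, 0) 0 -
        ε * fderiv ℝ V p (0, 1) 1 * fderiv ℝ V p (1, 0) 1 = 0 := by linear_combination h
    rw [this]
    funext i
    fin_cases i <;> simp
  rw [IsConjugateAt, e, partialU, partialV, (fderiv_quadric (dV hp)).2,
    (fderiv_quadric (dV hp)).2]
  simp only [quadricDeriv, cross_apply, dotProduct, Fin.sum_univ_three, Matrix.cons_val_zero,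
    Matrix.cons_val_one, Matrix.cons_val]
  push_cast
  ring

/-- The common isothermic-conjugate system is preserved. -/
lemma IsLeaf.isIsothermicConjugate (hε : ε = 1 ∨ ε = -1) (hs1 : s = 1 ∨ s = -1)
    (hz : 0 < z) (hza : z < a₁) (ha₂ : a₂ < 0)
    (hU : IsOpen U) (h0 : IsDeformation ε a₁ a₂ U x0 V0)
    (hA : IsAngleData ε a₁ a₂ U x0 V0 θ0 Λ0) (hII : HasSecondForm ε a₁ a₂ U x0 V0 Λ0)
    (hl : IsLeaf ε a₁ a₂ z U x0 V0 x1 V1)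
    (hs : HasNormalComponent ε a₁ a₂ z s U x0 x1 V0 V1) :
    IsIsothermicConjugate ε a₁ a₂ U x1 V1 where
  conj_quadric p hp := by
    refine isConjugateAt_quadric hU hl.deformation.smooth_V hp ?_
    obtain ⟨y0, y1, w0, w1⟩ := hl.partials hε hs1 hz hza ha₂ hU h0 hA hII hs hp
    rw [y0, y1, w0, w1]
    ring
  conj p hp := by
    have h : normal ε a₁ a₂ x1 V1 p ⬝ᵥ partialV (partialU x1) p = 0 :=
      hl.secondForm_mixed hε hs1 hz hza ha₂ hU h0 hA hII hs hp
    rw [IsConjugateAt, cross_partials (hz.trans hza) ha₂ hl.deformation hp, smul_dotProduct,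
      smul_dotProduct, h, smul_zero, smul_zero]
  isothermic p hp := by
    obtain ⟨h1, h2⟩ := hl.secondForm_diagonal hε hs1 hz hza ha₂ hU h0 hA hII hs hp
    rw [h1, h2, neg_neg]

end LeafConjugate

/-! ### Angle functions on simply connected domains -/

section Lift
variable {U : Set (ℝ × ℝ)}

lemma exists_sign_mul_pos (hc : IsPreconnected U) {f : ℝ × ℝ → ℝ} (hf : ContinuousOn f U)
    (h : ∀ p ∈ U, f p ≠ 0) : ∃ e : ℝ, (e = 1 ∨ e = -1) ∧ ∀ p ∈ U, 0 < e * f p := by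
  rcases hc.eq_or_eq_neg_of_sq_eq (g := fun p => |f p|) hf hf.abs
    (fun p _ => (sq_abs (f p)).symm) (fun hp => abs_ne_zero.2 (h _ hp)) with k | k
  · refine ⟨1, .inl rfl, fun p hp => ?_⟩
    rw [one_mul, k hp]
    exact abs_pos.2 (h p hp)
  · refine ⟨-1, .inr rfl, fun p hp => ?_⟩
    rw [k hp, Pi.neg_apply]
    have := abs_pos.2 (h p hp)
    linarith

lemma exists_arg_cosh_sinh (hc : IsPreconnected U) {c σ : ℝ × ℝ → ℝ}
    (hcs : ContDiffOn ℝ ∞ c U) (hσ : ContDiffOn ℝ ∞ σ U) (h : ∀ p ∈ U, c p ^ 2 - σ p ^ 2 = 1) :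
    ∃ e : ℝ, (e = 1 ∨ e = -1) ∧ ∃ θ : ℝ × ℝ → ℝ, ContDiffOn ℝ ∞ θ U ∧
      ∀ p ∈ U, Real.cosh (θ p) = e * c p ∧ Real.sinh (θ p) = e * σ p := by
  obtain ⟨e, he, hpos⟩ := exists_sign_mul_pos hc hcs.continuousOn fun p hp h0 => by
    have := h p hp
    rw [h0] at this
    nlinarith [sq_nonneg (σ p)]
  refine ⟨e, he, fun q => Real.arsinh (e * σ q),
    Real.contDiff_arsinh.comp_contDiffOn (contDiffOn_const.mul hσ), fun p hp => ⟨?_, by simp⟩⟩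
  rw [Real.cosh_arsinh]
  refine (congrArg Real.sqrt ?_).trans (Real.sqrt_sq (hpos p hp).le)
  have := h p hp
  rcases he with rfl | rfl <;> linarith

/-- On a simply connected domain a smooth map into the circle has a smooth angle function: the
map lifts through the covering `ℝ → S¹`, and locally the lift is given by the arcsine. -/
lemma exists_arg_cos_sin (hU : IsOpen U) (hsc : SimplyConnectedSpace U)
    {c σ : ℝ × ℝ → ℝ} (hcs : ContDiffOn ℝ ∞ c U) (hσ : ContDiffOn ℝ ∞ σ U)
    (h : ∀ p ∈ U, c p ^ 2 + σ p ^ 2 = 1) :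
    ∃ θ : ℝ × ℝ → ℝ, ContDiffOn ℝ ∞ θ U ∧
      ∀ p ∈ U, Real.cos (θ p) = c p ∧ Real.sin (θ p) = σ p := by
  classical
  have : LocallyPathConnectedSpace U := hU.locallyPathConnectedSpace
  have hm (p : U) : (⟨c p, σ p⟩ : ℂ) ∈ Submonoid.unitSphere ℂ := by
    have := h p p.2
    refine mem_sphere_zero_iff_norm.2 ?_
    rw [Complex.norm_def, Complex.normSq_mk, Real.sqrt_eq_one]
    linarith
  have cc : Continuous fun p : U => c p := hcs.continuousOn.domRestrict
  have cσ : Continuous fun p : U => σ p := hσ.continuousOn.domRestrict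
  let f : C(U, Circle) := ⟨fun p => ⟨⟨c p, σ p⟩, hm p⟩, by
    refine Continuous.subtype_mk ?_ _
    have : (fun p : U => (⟨c p, σ p⟩ : ℂ)) = fun p : U => (c p : ℂ) + σ p * Complex.I := by
      funext p; apply Complex.ext <;> simp
    rw [this]
    exact (Complex.continuous_ofReal.comp cc).add
      ((Complex.continuous_ofReal.comp cσ).mul continuous_const)⟩
  obtain ⟨p₀⟩ : Nonempty U := inferInstance
  obtain ⟨F, ⟨-, hF⟩, -⟩ := Circle.isCoveringMap_exp.existsUnique_continuousMap_lifts f p₀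
    _ (Circle.exp_arg (f p₀))
  have hF' (p : U) : Real.cos (F p) = c p ∧ Real.sin (F p) = σ p := by
    have e : ((Circle.exp (F p) : Circle) : ℂ) = ⟨c p, σ p⟩ := congrArg _ (congrFun hF p)
    rw [Circle.coe_exp, Complex.exp_mul_I] at e
    constructor
    · simpa [← Complex.ofReal_cos, ← Complex.ofReal_sin] using congrArg Complex.re e
    · simpa [← Complex.ofReal_cos, ← Complex.ofReal_sin] using congrArg Complex.im e
  let θ : ℝ × ℝ → ℝ := fun p => if hp : p ∈ U then F ⟨p, hp⟩ else 0
  have hθ {p : ℝ × ℝ} (hp : p ∈ U) : θ p = F ⟨p, hp⟩ := by simp [θ, hp]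
  have hcos (p : ℝ × ℝ) (hp : p ∈ U) : Real.cos (θ p) = c p ∧ Real.sin (θ p) = σ p := by
    rw [hθ hp]; exact hF' ⟨p, hp⟩
  have hcont : ContinuousOn θ U := by
    rw [continuousOn_iff_continuous_domRestrict]
    convert F.continuous using 1
    funext p
    exact hθ p.2
  refine ⟨θ, fun p hp => ?_, hcos⟩
  -- near `p`, `θ = θ(p) + arcsin (sin (θ - θ(p)))`
  have hsmooth : ContDiffAt ℝ ∞ (fun q => θ p +
      Real.arcsin (σ q * Real.cos (θ p) - c q * Real.sin (θ p))) p := by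
    have hcp := (hcs p hp).contDiffAt (hU.mem_nhds hp)
    have hsp := (hσ p hp).contDiffAt (hU.mem_nhds hp)
    have h0 : σ p * Real.cos (θ p) - c p * Real.sin (θ p) = 0 := by
      rw [(hcos p hp).1, (hcos p hp).2]; ring
    refine contDiffAt_const.add (ContDiffAt.comp p (g := Real.arcsin) ?_
      ((hsp.mul contDiffAt_const).sub (hcp.mul contDiffAt_const)))
    rw [h0]
    exact Real.contDiffAt_arcsin (by norm_num) (by norm_num)
  refine (hsmooth.congr_of_eventuallyEq ?_).contDiffWithinAt
  have hnear : ∀ᶠ q in nhds p, |θ q - θ p| < Real.pi / 2 := by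
    have : ContinuousAt (fun q => |θ q - θ p|) p :=
      ((hcont.continuousAt (hU.mem_nhds hp)).sub continuousAt_const).abs
    refine this.eventually_lt continuousAt_const ?_
    simp [Real.pi_pos]
  filter_upwards [hnear, hU.mem_nhds hp] with q hq hqU
  rw [abs_lt] at hq
  rw [← (hcos q hqU).1, ← (hcos q hqU).2, ← Real.sin_sub,
    Real.arcsin_sin hq.1.le hq.2.le]
  ring

/-- A smooth map into the conic `c² - ε σ² = 1` is, up to a sign, of the form `(𝐂, 𝐒)(θ)`. The
sign is the branch of the hyperbola for `ε = 1`. -/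
lemma exists_arg_cosE_sinE {ε : ℝ} (hε : ε = 1 ∨ ε = -1) (hU : IsOpen U)
    (hsc : SimplyConnectedSpace U) {c σ : ℝ × ℝ → ℝ} (hcs : ContDiffOn ℝ ∞ c U)
    (hσ : ContDiffOn ℝ ∞ σ U) (h : ∀ p ∈ U, c p ^ 2 - ε * σ p ^ 2 = 1) :
    ∃ e : ℝ, (e = 1 ∨ e = -1) ∧ ∃ θ : ℝ × ℝ → ℝ, ContDiffOn ℝ ∞ θ U ∧
      ∀ p ∈ U, cosE ε (θ p) = e * c p ∧ sinE ε (θ p) = e * σ p := by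
  rcases hε with rfl | rfl
  · have hc : IsPreconnected U := (isConnected_iff_connectedSpace.2 inferInstance).isPreconnected
    obtain ⟨e, he, θ, hθ, k⟩ := exists_arg_cosh_sinh hc hcs hσ fun p hp => by simpa using h p hp
    exact ⟨e, he, θ, hθ, fun p hp => by simpa [cosE, sinE] using k p hp⟩
  · obtain ⟨θ, hθ, k⟩ := exists_arg_cos_sin hU hsc hcs hσ fun p hp => by simpa using h p hp
    have n : ¬(-1 : ℝ) = 1 := by norm_num
    exact ⟨1, .inl rfl, θ, hθ, fun p hp => by simpa [cosE, sinE, n] using k p hp⟩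

end Lift

/-! ### Angle data of a leaf -/

section LeafAngle
variable {ε a₁ a₂ z s s' : ℝ} {U : Set (ℝ × ℝ)} {x0 x1 : ℝ × ℝ → Fin 3 → ℝ}
  {V0 V1 : ℝ × ℝ → Fin 2 → ℝ} {θ0 θ1 : ℝ × ℝ → ℝ} {Λ0 Λ1 : ℝ × ℝ → Fin 2 → ℝ} {p : ℝ × ℝ}

lemma smoothOn_leafDir (h0 : IsDeformation ε a₁ a₂ U x0 V0) (hV : ContDiffOn ℝ ∞ V1 U)
    (hA : IsAngleData ε a₁ a₂ U x0 V0 θ0 Λ0) (hz : 0 < z) (j : Fin 2) :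
    ContDiffOn ℝ ∞ (fun q => leafDir ε a₁ a₂ z s V0 V1 Λ0 q j) U := by
  have hP (i : Fin 2) := smoothOn_chord (a₁ := a₁) (a₂ := a₂) (z := z) h0.smooth_V hV i
  have hΛ (i : Fin 2) := smoothOn_coord hA.smooth_Λ i
  have hK : ContDiffOn ℝ ∞ (fun q => ε / (z * quadricH ε a₁ a₂ (V0 q))) U :=
    contDiffOn_const.div (contDiffOn_const.mul (smoothOn_quadricH h0.smooth_V))
      fun q hq => mul_ne_zero hz.ne' (h0.region q hq).ne'
  fin_cases j
  · exact hK.mul (((hΛ 0).mul (hP 0)).add (contDiffOn_const.mul ((hΛ 1).mul (hP 1))))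
  · exact hK.mul (((hΛ 0).mul (hP 1)).add (contDiffOn_const.mul ((hΛ 1).mul (hP 0))))

lemma smoothOn_chordAngle (hV0 : ContDiffOn ℝ ∞ V0 U) (hV1 : ContDiffOn ℝ ∞ V1 U)
    (hθ : ContDiffOn ℝ ∞ θ0 U) (j : Fin 2) :
    ContDiffOn ℝ ∞ (fun q => chordAngle ε a₁ a₂ z V0 V1 θ0 q j) U := by
  have hX (i : Fin 2) := smoothOn_chord (a₁ := a₁) (a₂ := a₂) (z := z) hV1 hV0 i
  have hC := (contDiff_cosE ε).comp_contDiffOn hθ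
  have hS := (contDiff_sinE ε).comp_contDiffOn hθ
  fin_cases j
  · exact (hC.mul (hX 0)).sub (contDiffOn_const.mul (hS.mul (hX 1)))
  · exact ((hS.mul (hX 0)).neg).add (hC.mul (hX 1))

/-- The leaf has angle data: up to a common sign, `Λ1 = 𝓔₁ R0⁻¹ (√R'_z V1 - V0) / √z`. -/
lemma IsLeaf.exists_angleData (hε : ε = 1 ∨ ε = -1) (hs1 : s = 1 ∨ s = -1)
    (hz : 0 < z) (hza : z < a₁) (ha₂ : a₂ < 0)
    (hU : IsOpen U) (hsc : SimplyConnectedSpace U) (h0 : IsDeformation ε a₁ a₂ U x0 V0)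
    (hA : IsAngleData ε a₁ a₂ U x0 V0 θ0 Λ0) (hII : HasSecondForm ε a₁ a₂ U x0 V0 Λ0)
    (hl : IsLeaf ε a₁ a₂ z U x0 V0 x1 V1)
    (hs : HasNormalComponent ε a₁ a₂ z s U x0 x1 V0 V1) :
    ∃ θ1 Λ1, IsAngleData ε a₁ a₂ U x1 V1 θ1 Λ1 := by
  have hb (j : Fin 2) := smoothOn_leafDir (s := s) h0 hl.deformation.smooth_V hA hz j
  have hζ (j : Fin 2) := smoothOn_chordAngle (ε := ε) (a₁ := a₁) (a₂ := a₂) (z := z)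
    h0.smooth_V hl.deformation.smooth_V hA.smooth_θ j
  have hw : √z * √z = z := Real.mul_self_sqrt hz.le
  have hw1 : √z * (√z)⁻¹ = 1 := mul_inv_cancel₀ (Real.sqrt_pos.2 hz).ne'
  have hw2 : (√z)⁻¹ * (√z)⁻¹ * z = 1 := by
    linear_combination -(√z)⁻¹ * (√z)⁻¹ * hw + (√z * (√z)⁻¹ + 1) * hw1
  obtain ⟨e, he, θ1, hθ1, hcs⟩ := exists_arg_cosE_sinE hε hU hsc
    (c := fun q => √z * leafDir ε a₁ a₂ z s V0 V1 Λ0 q 0)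
    (σ := fun q => √z * leafDir ε a₁ a₂ z s V0 V1 Λ0 q 1)
    (contDiffOn_const.mul (hb 0)) (contDiffOn_const.mul (hb 1)) fun p hp => by
      have := (leafDir_spec hε hs1 hz hza ha₂ h0 hA hl hp).1
      have zz : z * z⁻¹ = 1 := mul_inv_cancel₀ hz.ne'
      linear_combination z * this + zz + (leafDir ε a₁ a₂ z s V0 V1 Λ0 p 0 ^ 2 -
        ε * leafDir ε a₁ a₂ z s V0 V1 Λ0 p 1 ^ 2) * hw
  have hee := eps_mul_self he
  have ss := eps_mul_self hs1
  refine ⟨θ1, fun q => ![e * chordAngle ε a₁ a₂ z V0 V1 θ0 q 0 * (√z)⁻¹,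
    -(s * e * chordAngle ε a₁ a₂ z V0 V1 θ0 q 1 * (√z)⁻¹)], hθ1, ?_, fun p hp => ?_, fun p hp => ?_,
    fun p hp => ?_⟩
  · refine contDiffOn_pi.2 fun j => ?_
    fin_cases j
    · exact (contDiffOn_const.mul (hζ 0)).mul contDiffOn_const
    · exact ((contDiffOn_const.mul (hζ 1)).mul contDiffOn_const).neg
  · obtain ⟨y0, y1, w0, w1⟩ := hl.partials hε hs1 hz hza ha₂ hU h0 hA hII hs hp
    obtain ⟨hc, hs⟩ := hcs p hp
    ext i j
    fin_cases i <;> fin_cases j <;>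
      simp [jac, partialU, partialV, y0, y1, w0, w1, rot, hc, hs]
    · linear_combination (-(chordAngle ε a₁ a₂ z V0 V1 θ0 p 0 * leafDir ε a₁ a₂ z s V0 V1 Λ0 p 0)) *
        (hee + e * e * hw1)
    · linear_combination (-(s * chordAngle ε a₁ a₂ z V0 V1 θ0 p 1 *
        (ε * leafDir ε a₁ a₂ z s V0 V1 Λ0 p 1))) *
        (hee + e * e * hw1)
    · linear_combination (-(chordAngle ε a₁ a₂ z V0 V1 θ0 p 0 * leafDir ε a₁ a₂ z s V0 V1 Λ0 p 1)) *
        (hee + e * e * hw1)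
    · linear_combination (-(s * chordAngle ε a₁ a₂ z V0 V1 θ0 p 1 *
        leafDir ε a₁ a₂ z s V0 V1 Λ0 p 0)) *
        (hee + e * e * hw1)
  · have hN := chord_norm hε hz hza ha₂ (V := V1 p) (W := V0 p) (by
      linear_combination hl.tangency_eq hε hz hza ha₂ hp)
    have hu := unrot_norm hε (θ0 p) (chord a₁ a₂ z (V1 p) (V0 p))
    rw [hN] at hu
    change chordAngle ε a₁ a₂ z V0 V1 θ0 p 0 ^ 2 - ε * chordAngle ε a₁ a₂ z V0 V1 θ0 p 1 ^ 2 = _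
      at hu
    have ee := eps_mul_self hε
    simp [signMat, invA, Matrix.mulVec_diagonal, dotProduct, Fin.sum_univ_two]
    rw [quadricH] at hu
    linear_combination (√z)⁻¹ * (√z)⁻¹ * ((chordAngle ε a₁ a₂ z V0 V1 θ0 p 0 ^ 2 -
      ε * chordAngle ε a₁ a₂ z V0 V1 θ0 p 1 ^ 2) * hee + hu -
      ε * e * e * chordAngle ε a₁ a₂ z V0 V1 θ0 p 1 ^ 2 * ss) -
      ε * (ε * V1 p 0 ^ 2 / a₁ - V1 p 1 ^ 2 / a₂ + ε) * hw2 - (V1 p 0 ^ 2 * a₁⁻¹ + 1) * ee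
  · have hd := hl.det_jac hε hs1 hz hza ha₂ hU h0 hA hII hs hp
    have hreg := hl.deformation.regular p hp
    have e1 : e * chordAngle ε a₁ a₂ z V0 V1 θ0 p 0 * (√z)⁻¹ *
        -(s * e * chordAngle ε a₁ a₂ z V0 V1 θ0 p 1 * (√z)⁻¹) = (jac V1 p).det := by
      have zz : (√z)⁻¹ * (√z)⁻¹ = z⁻¹ := by rw [← mul_inv, hw]
      rw [hd, div_eq_mul_inv]
      linear_combination (-(s * chordAngle ε a₁ a₂ z V0 V1 θ0 p 0 *
        chordAngle ε a₁ a₂ z V0 V1 θ0 p 1)) * (e * e * zz + z⁻¹ * hee)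
    simp only [Matrix.cons_val_zero, Matrix.cons_val_one]
    rw [e1, (hl.secondForm_diagonal hε hs1 hz hza ha₂ hU h0 hA hII hs hp).1, ← mul_div_assoc]
    exact div_pos (mul_self_pos.2 hreg) (Real.sqrt_pos.2 (hl.deformation.region p hp))

/-- The angle data of the leaf, however chosen, are given by the two chords, up to one common
sign. -/
lemma IsLeaf.exists_chord_eq (hε : ε = 1 ∨ ε = -1) (hs1 : s = 1 ∨ s = -1)
    (hz : 0 < z) (hza : z < a₁) (ha₂ : a₂ < 0)
    (hU : IsOpen U) (hc : IsPreconnected U) (h0 : IsDeformation ε a₁ a₂ U x0 V0)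
    (hA : IsAngleData ε a₁ a₂ U x0 V0 θ0 Λ0) (hII : HasSecondForm ε a₁ a₂ U x0 V0 Λ0)
    (hl : IsLeaf ε a₁ a₂ z U x0 V0 x1 V1)
    (hs : HasNormalComponent ε a₁ a₂ z s U x0 x1 V0 V1)
    (hA1 : IsAngleData ε a₁ a₂ U x1 V1 θ1 Λ1) :
    ∃ s' : ℝ, (s' = 1 ∨ s' = -1) ∧
      (∀ p ∈ U, chord a₁ a₂ z (V0 p) (V1 p) =
        (s' * √z) • (rot ε (θ1 p) *ᵥ (signMat s *ᵥ Λ0 p))) ∧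
      ∀ p ∈ U, chord a₁ a₂ z (V1 p) (V0 p) =
        (-s' * √z) • (rot ε (θ0 p) *ᵥ (signMat s *ᵥ Λ1 p)) := by
  have hζ := smoothOn_chordAngle (ε := ε) (a₁ := a₁) (a₂ := a₂) (z := z)
    h0.smooth_V hl.deformation.smooth_V hA.smooth_θ 0
  have hw : √z * √z = z := Real.mul_self_sqrt hz.le
  have hw0 : 0 < √z := Real.sqrt_pos.2 hz
  have hl1 := smoothOn_coord hA1.smooth_Λ 0
  obtain ⟨e, he, hpos⟩ := exists_sign_mul_pos hc
    (f := fun q => chordAngle ε a₁ a₂ z V0 V1 θ0 q 0 * Λ1 q 0)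
    (hζ.mul hl1).continuousOn fun p hp => mul_ne_zero
      (hl.chordAngle_ne_zero hε hs1 hz hza ha₂ hU h0 hA hII hs hp).1 (hA1.ne_zero hp).1
  have hee := eps_mul_self he
  have ss := eps_mul_self hs1
  have key : ∀ p ∈ U, chordAngle ε a₁ a₂ z V0 V1 θ0 p 0 = e * √z * Λ1 p 0 ∧
      chordAngle ε a₁ a₂ z V0 V1 θ0 p 1 = -(s * (e * √z * Λ1 p 1)) ∧
      cosE ε (θ1 p) = e * √z * leafDir ε a₁ a₂ z s V0 V1 Λ0 p 0 ∧
      sinE ε (θ1 p) = e * √z * leafDir ε a₁ a₂ z s V0 V1 Λ0 p 1 := by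
    intro p hp
    obtain ⟨y0, y1, w0, w1⟩ := hl.partials hε hs1 hz hza ha₂ hU h0 hA hII hs hp
    obtain ⟨u0, u1, v0, v1⟩ := hA1.partials hp
    obtain ⟨a_norm, -, -⟩ := leafDir_spec hε hs1 hz hza ha₂ h0 hA hl hp
    have k := cosE_sq_sub hε (θ1 p)
    have hp0 := hpos p hp
    have hl0 := (hA1.ne_zero hp).1
    have zz : z * z⁻¹ = 1 := mul_inv_cancel₀ hz.ne'
    rw [y0] at u0
    rw [y1] at u1
    rw [w0] at v0
    rw [w1] at v1
    generalize leafDir ε a₁ a₂ z s V0 V1 Λ0 p 0 = b0 at *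
    generalize leafDir ε a₁ a₂ z s V0 V1 Λ0 p 1 = b1 at *
    generalize chordAngle ε a₁ a₂ z V0 V1 θ0 p 0 = ζ at *
    generalize chordAngle ε a₁ a₂ z V0 V1 θ0 p 1 = η at *
    -- the `𝓔`-lengths of `V1_u = ζ₀ b = λ₁ (𝐂, 𝐒)` give `ζ₀² = z λ₁²`, and `e` is the sign
    -- of `ζ₀ λ₁`, constant on `U`
    have hsq : ζ ^ 2 = (e * √z * Λ1 p 0) ^ 2 := by
      have h1 : ζ ^ 2 * z⁻¹ = Λ1 p 0 ^ 2 := by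
        linear_combination -ζ ^ 2 * a_norm + Λ1 p 0 ^ 2 * k +
          (ζ * b0 + cosE ε (θ1 p) * Λ1 p 0) * u0 - ε * (ζ * b1 + sinE ε (θ1 p) * Λ1 p 0) * u1
      linear_combination z * h1 - ζ ^ 2 * zz - √z * √z * Λ1 p 0 ^ 2 * hee - Λ1 p 0 ^ 2 * hw
    have h1 : ζ = e * √z * Λ1 p 0 := by
      rcases sq_eq_sq_iff_eq_or_eq_neg.1 hsq with h | h
      · exact h
      · exfalso
        rw [h] at hp0
        have : e * (-(e * √z * Λ1 p 0) * Λ1 p 0) = -(√z * Λ1 p 0 ^ 2) := by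
          linear_combination -√z * Λ1 p 0 ^ 2 * hee
        have := mul_nonneg hw0.le (sq_nonneg (Λ1 p 0))
        linarith
    have h3 : cosE ε (θ1 p) = e * √z * b0 := by
      refine mul_right_cancel₀ hl0 ?_
      linear_combination -u0 + b0 * h1
    have h4 : sinE ε (θ1 p) = e * √z * b1 := by
      refine mul_right_cancel₀ hl0 ?_
      linear_combination -u1 + b1 * h1
    refine ⟨h1, ?_, h3, h4⟩
    rw [h3] at v1
    rw [h4] at v0
    linear_combination -s * ((s * η + e * √z * Λ1 p 1) * (zz + z * a_norm) +
      z * (b0 * v1 - b1 * v0)) - η * ss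
  refine ⟨-e, by rcases he with rfl | rfl <;> simp, fun p hp => ?_, fun p hp => ?_⟩
  · obtain ⟨-, -, h3, h4⟩ := key p hp
    obtain ⟨-, a_l, a_m⟩ := leafDir_spec hε hs1 hz hza ha₂ h0 hA hl hp
    have zz : z * z⁻¹ = 1 := mul_inv_cancel₀ hz.ne'
    funext j
    fin_cases j
    · simp [rot, signMat,
        h3, h4]
      linear_combination (Λ0 p 0 * leafDir ε a₁ a₂ z s V0 V1 Λ0 p 0 -
        ε * (s * (Λ0 p 1 * leafDir ε a₁ a₂ z s V0 V1 Λ0 p 1))) * (√z * √z * hee + hw) + z * a_l -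
        chord a₁ a₂ z (V0 p) (V1 p) 0 * zz
    · simp [rot, signMat,
        h3, h4]
      linear_combination (-(s * (Λ0 p 1 * leafDir ε a₁ a₂ z s V0 V1 Λ0 p 0) -
        Λ0 p 0 * leafDir ε a₁ a₂ z s V0 V1 Λ0 p 1)) * (√z * √z * hee + hw) - z * a_m -
        chord a₁ a₂ z (V0 p) (V1 p) 1 * zz
  · obtain ⟨h1, h2, -, -⟩ := key p hp
    obtain ⟨k1, k2⟩ := rot_unrot hε (θ0 p) (chord a₁ a₂ z (V1 p) (V0 p))
    change _ = _ * chordAngle ε a₁ a₂ z V0 V1 θ0 p 0 +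
      ε * (_ * chordAngle ε a₁ a₂ z V0 V1 θ0 p 1) at k1
    change _ = _ * chordAngle ε a₁ a₂ z V0 V1 θ0 p 0 +
      _ * chordAngle ε a₁ a₂ z V0 V1 θ0 p 1 at k2
    rw [h1, h2] at k1 k2
    funext j
    fin_cases j
    · simp [rot, signMat]
      linear_combination k1
    · simp [rot, signMat]
      linear_combination k2

end LeafAngle

/-! ### The transformation of the angle data -/

section Chord
variable {ε a₁ a₂ z s s' : ℝ} {U : Set (ℝ × ℝ)} {x0 x1 : ℝ × ℝ → Fin 3 → ℝ}
  {V0 V1 : ℝ × ℝ → Fin 2 → ℝ} {θ0 θ1 : ℝ × ℝ → ℝ} {Λ0 Λ1 : ℝ × ℝ → Fin 2 → ℝ} {p : ℝ × ℝ}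

lemma smul_rot_signMat_mulVec (k t : ℝ) (w : Fin 2 → ℝ) :
    (k • (rot ε t *ᵥ (signMat s *ᵥ w))) 0 = k * (cosE ε t * w 0 - ε * sinE ε t * (s * w 1)) ∧
    (k • (rot ε t *ᵥ (signMat s *ᵥ w))) 1 = k * (sinE ε t * w 0 - cosE ε t * (s * w 1)) := by
  constructor <;> simp [rot, signMat] <;> left <;> ring

/-- The two chords determine the algebraic transformation. -/
lemma isAlgebraicTransform_of_chord (hε : ε = 1 ∨ ε = -1) (hs : s = 1 ∨ s = -1)
    (hs' : s' = 1 ∨ s' = -1) (hz : 0 < z) (hza : z < a₁) (ha₂ : a₂ < 0)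
    (h0 : ∀ p ∈ U, chord a₁ a₂ z (V0 p) (V1 p) =
      (s' * √z) • (rot ε (θ1 p) *ᵥ (signMat s *ᵥ Λ0 p)))
    (h1 : ∀ p ∈ U, chord a₁ a₂ z (V1 p) (V0 p) =
      (-s' * √z) • (rot ε (θ0 p) *ᵥ (signMat s *ᵥ Λ1 p))) :
    IsAlgebraicTransform ε a₁ a₂ z s s' U V0 θ0 Λ0 V1 θ1 Λ1 := by
  intro p hp
  have ss := eps_mul_self hs
  have ss' := eps_mul_self hs'
  have hw : √z * √z = z := Real.mul_self_sqrt hz.le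
  have hw0 : √z ≠ 0 := (Real.sqrt_pos.2 hz).ne'
  have hk : s' * √z ≠ 0 := mul_ne_zero (fun h => by simp [h] at ss') hw0
  obtain ⟨q1, q2⟩ := sqrtR_sq hz hza ha₂
  have k := cosE_sq_sub hε (θ0 p)
  obtain ⟨r0, r1⟩ := smul_rot_signMat_mulVec (ε := ε) (s := s) (s' * √z) (θ1 p) (Λ0 p)
  obtain ⟨t0, t1⟩ := smul_rot_signMat_mulVec (ε := ε) (s := s) (-s' * √z) (θ0 p) (Λ1 p)
  rw [← h0 p hp, chord_zero] at r0
  rw [← h0 p hp, chord_one] at r1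
  rw [← h1 p hp, chord_zero] at t0
  rw [← h1 p hp, chord_one] at t1
  have kk : (s' * √z) * (s' * √z) = z := by linear_combination √z * √z * ss' + hw
  rw [neg_mul] at t0 t1
  rw [Matrix.fromBlocks_multiply, Matrix.fromBlocks_multiply, Matrix.fromBlocks_mulVec, rot_inv hε,
    matDz_eq]
  generalize s' * √z = K at *
  have hKK : K * K⁻¹ = 1 := mul_inv_cancel₀ hk
  -- insert the chord at `V0` into the chord at `V1`, with `R'_z = I - z A'`
  have y0 : √(1 - z * a₁⁻¹) * (cosE ε (θ1 p) * Λ0 p 0 - ε * sinE ε (θ1 p) * (s * Λ0 p 1)) =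
      cosE ε (θ0 p) * Λ1 p 0 - ε * sinE ε (θ0 p) * (s * Λ1 p 1) - K * a₁⁻¹ * V0 p 0 := by
    refine mul_left_cancel₀ hk ?_
    linear_combination -√(1 - z * a₁⁻¹) * r0 - t0 + V0 p 0 * q1 + a₁⁻¹ * V0 p 0 * kk
  have y1 : √(1 - z * a₂⁻¹) * (sinE ε (θ1 p) * Λ0 p 0 - cosE ε (θ1 p) * (s * Λ0 p 1)) =
      sinE ε (θ0 p) * Λ1 p 0 - cosE ε (θ0 p) * (s * Λ1 p 1) - K * a₂⁻¹ * V0 p 1 := by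
    refine mul_left_cancel₀ hk ?_
    linear_combination -√(1 - z * a₂⁻¹) * r1 - t1 + V0 p 1 * q2 + a₂⁻¹ * V0 p 1 * kk
  generalize hY0 : cosE ε (θ1 p) * Λ0 p 0 - ε * sinE ε (θ1 p) * (s * Λ0 p 1) = Y0 at *
  generalize hY1 : sinE ε (θ1 p) * Λ0 p 0 - cosE ε (θ1 p) * (s * Λ0 p 1) = Y1 at *
  funext i
  rcases i with i | i <;> fin_cases i <;>
    simp [rot, signMat, invA, dotProduct, Fin.sum_univ_two, Matrix.mul_apply,
      Matrix.vecMul_diagonal]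
  · linear_combination -r0 - √(1 - z * a₁⁻¹) * V0 p 0 * hKK + K * hY0
  · linear_combination -r1 - √(1 - z * a₂⁻¹) * V0 p 1 * hKK + K * hY1
  · linear_combination -cosE ε (θ0 p) * y0 + ε * sinE ε (θ0 p) * y1 - Λ1 p 0 * k -
      (cosE ε (θ0 p) * √(1 - z * a₁⁻¹) * Y0 - ε * sinE ε (θ0 p) * √(1 - z * a₂⁻¹) * Y1) * hKK -
      K * K⁻¹ * (cosE ε (θ0 p) * √(1 - z * a₁⁻¹) * hY0 -
        ε * sinE ε (θ0 p) * √(1 - z * a₂⁻¹) * hY1)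
  · linear_combination s * (-sinE ε (θ0 p) * y0 + cosE ε (θ0 p) * y1) - s * s * Λ1 p 1 * k -
      Λ1 p 1 * ss + s * (-sinE ε (θ0 p) * √(1 - z * a₁⁻¹) * Y0 +
        cosE ε (θ0 p) * √(1 - z * a₂⁻¹) * Y1) * hKK +
      s * K * K⁻¹ * (-sinE ε (θ0 p) * √(1 - z * a₁⁻¹) * hY0 +
        cosE ε (θ0 p) * √(1 - z * a₂⁻¹) * hY1)

/-- After differentiating the chord `√R'_z V0 - V1 = s' √z R1 𝓔₁ Λ0` and multiplying by `R1⁻¹`,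
the terms with `Λ1` and `V0` appear only in the `du` part of the first and in the `dv` part of the
second component. The other two parts are multiples of `λ₀` and `μ₀` and determine `dθ1`. -/
lemma isMatrixBacklundAt_of_chord (hε : ε = 1 ∨ ε = -1) (hs : s = 1 ∨ s = -1)
    (hs' : s' = 1 ∨ s' = -1) (hz : 0 < z) (hU : IsOpen U)
    (hV0 : ContDiffOn ℝ ∞ V0 U) (hV1 : ContDiffOn ℝ ∞ V1 U)
    (hA0 : IsAngleData ε a₁ a₂ U x0 V0 θ0 Λ0) (hA1 : IsAngleData ε a₁ a₂ U x1 V1 θ1 Λ1)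
    (h : ∀ p ∈ U, chord a₁ a₂ z (V0 p) (V1 p) =
      (s' * √z) • (rot ε (θ1 p) *ᵥ (signMat s *ᵥ Λ0 p))) (hp : p ∈ U) :
    IsMatrixBacklundAt ε s (matDz a₁ a₂ z s') θ0 θ1 p := by
  have ee := eps_mul_self hε
  have ss := eps_mul_self hs
  have ss' := eps_mul_self hs'
  have hw0 : √z ≠ 0 := (Real.sqrt_pos.2 hz).ne'
  have hk : s' * √z ≠ 0 := mul_ne_zero (fun h => by simp [h] at ss') hw0
  have dV0 := differentiableAt_of_smoothOn hU hV0 hp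
  have dV1 := differentiableAt_of_smoothOn hU hV1 hp
  have d0 := differentiableAt_of_smoothOn hU hA0.smooth_θ hp
  have d1 := differentiableAt_of_smoothOn hU hA1.smooth_θ hp
  have dΛ := differentiableAt_of_smoothOn hU hA0.smooth_Λ hp
  have dl (i : Fin 2) := differentiableAt_coord dΛ i
  obtain ⟨dC, eC⟩ := fderiv_cosE_comp hε d1
  obtain ⟨dS, eS⟩ := fderiv_sinE_comp hε d1
  have k := cosE_sq_sub hε (θ1 p)
  rw [matDz_eq, isMatrixBacklundAt_iff_fderiv hε hs d0 d1]
  generalize hK : s' * √z = K at *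
  -- the two components of the differential of the chord
  have c0 (ξ : ℝ × ℝ) : √(1 - z * a₁⁻¹) * fderiv ℝ V0 p ξ 0 - fderiv ℝ V1 p ξ 0 =
      K * ((ε * sinE ε (θ1 p) * fderiv ℝ θ1 p ξ * Λ0 p 0 + cosE ε (θ1 p) * fderiv ℝ Λ0 p ξ 0) -
        ε * s * (cosE ε (θ1 p) * fderiv ℝ θ1 p ξ * Λ0 p 1 +
          sinE ε (θ1 p) * fderiv ℝ Λ0 p ξ 1)) := by
    have e : ∀ q ∈ U, chord a₁ a₂ z (V0 q) (V1 q) 0 = K * (cosE ε (θ1 q) * Λ0 q 0 -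
        ε * s * (sinE ε (θ1 q) * Λ0 q 1)) := fun q hq => by
      rw [h q hq, (smul_rot_signMat_mulVec _ _ _).1]; ring
    rw [← (fderiv_chord dV0 dV1 ξ).1.2, fderiv_congr_on hU hp e,
      fderiv_const_mul ((dC.fun_mul (dl 0)).fun_sub ((dS.fun_mul (dl 1)).const_mul _)),
      _root_.smul_apply, fderiv_fun_sub (dC.fun_mul (dl 0)) ((dS.fun_mul (dl 1)).const_mul _),
      _root_.sub_apply, fderiv_const_mul (dS.fun_mul (dl 1)), _root_.smul_apply,
      fderiv_mul_apply dC (dl 0), fderiv_mul_apply dS (dl 1), eC, eS,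
      fderiv_apply_coord dΛ, fderiv_apply_coord dΛ, smul_eq_mul, smul_eq_mul]
  have c1 (ξ : ℝ × ℝ) : √(1 - z * a₂⁻¹) * fderiv ℝ V0 p ξ 1 - fderiv ℝ V1 p ξ 1 =
      K * ((cosE ε (θ1 p) * fderiv ℝ θ1 p ξ * Λ0 p 0 + sinE ε (θ1 p) * fderiv ℝ Λ0 p ξ 0) -
        s * (ε * sinE ε (θ1 p) * fderiv ℝ θ1 p ξ * Λ0 p 1 +
          cosE ε (θ1 p) * fderiv ℝ Λ0 p ξ 1)) := by
    have e : ∀ q ∈ U, chord a₁ a₂ z (V0 q) (V1 q) 1 = K * (sinE ε (θ1 q) * Λ0 q 0 -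
        s * (cosE ε (θ1 q) * Λ0 q 1)) := fun q hq => by
      rw [h q hq, (smul_rot_signMat_mulVec _ _ _).2]; ring
    rw [← (fderiv_chord dV0 dV1 ξ).2.2, fderiv_congr_on hU hp e,
      fderiv_const_mul ((dS.fun_mul (dl 0)).fun_sub ((dC.fun_mul (dl 1)).const_mul _)),
      _root_.smul_apply, fderiv_fun_sub (dS.fun_mul (dl 0)) ((dC.fun_mul (dl 1)).const_mul _),
      _root_.sub_apply, fderiv_const_mul (dC.fun_mul (dl 1)), _root_.smul_apply,
      fderiv_mul_apply dS (dl 0), fderiv_mul_apply dC (dl 1), eC, eS,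
      fderiv_apply_coord dΛ, fderiv_apply_coord dΛ, smul_eq_mul, smul_eq_mul]
  obtain ⟨pu0, pu1, pv0, pv1⟩ := hA0.partials hp
  obtain ⟨u0, u1, v0, v1⟩ := hA1.partials hp
  obtain ⟨lu, lv, mu, mv⟩ := hA0.fderiv_Λ hε hU hV0 hp
  obtain ⟨hl, hm⟩ := hA0.ne_zero hp
  have cu0 := c0 (1, 0)
  have cu1 := c1 (1, 0)
  have cv0 := c0 (0, 1)
  have cv1 := c1 (0, 1)
  rw [pu0, u0, mu] at cu0
  rw [pu1, u1, mu] at cu1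
  rw [pv0, v0, lv] at cv0
  rw [pv1, v1, lv] at cv1
  intro ξ
  rw [fderiv_eq_partials θ1, fderiv_eq_partials θ0]
  simp only [partialU, partialV, smul_eq_mul]
  clear c0 c1 lu lv mu mv pu0 pu1 pv0 pv1 u0 u1 v0 v1 hK
  generalize fderiv ℝ θ1 p (1, 0) = tu at *
  generalize fderiv ℝ θ1 p (0, 1) = tv at *
  generalize fderiv ℝ θ0 p (1, 0) = τu at *
  generalize fderiv ℝ θ0 p (0, 1) = τv at *
  have hKK : K * K⁻¹ = 1 := mul_inv_cancel₀ hk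
  have hu : tu = s * τv - (cosE ε (θ0 p) * (K⁻¹ * √(1 - z * a₁⁻¹)) * sinE ε (θ1 p) -
      sinE ε (θ0 p) * (K⁻¹ * √(1 - z * a₂⁻¹)) * cosE ε (θ1 p)) := by
    refine mul_left_cancel₀ (mul_ne_zero hk hl) ?_
    linear_combination sinE ε (θ1 p) * cu0 - cosE ε (θ1 p) * cu1 -
      K * Λ0 p 0 * (tu - s * τv) * k +
      Λ0 p 0 * (cosE ε (θ0 p) * √(1 - z * a₁⁻¹) * sinE ε (θ1 p) -
        sinE ε (θ0 p) * √(1 - z * a₂⁻¹) * cosE ε (θ1 p)) * hKK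
  have hv : tv = s * τu + s * (cosE ε (θ0 p) * (K⁻¹ * √(1 - z * a₂⁻¹)) * sinE ε (θ1 p) -
      sinE ε (θ0 p) * (K⁻¹ * √(1 - z * a₁⁻¹)) * cosE ε (θ1 p)) := by
    refine mul_left_cancel₀ (mul_ne_zero hk hm) ?_
    linear_combination ε * s * (cosE ε (θ1 p) * cv0 - ε * sinE ε (θ1 p) * cv1) +
      ε * ε * K * Λ0 p 1 * (s * τu - s * s * tv) * k -
      s * Λ0 p 1 * (cosE ε (θ0 p) * √(1 - z * a₂⁻¹) * sinE ε (θ1 p) -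
        sinE ε (θ0 p) * √(1 - z * a₁⁻¹) * cosE ε (θ1 p)) * (hKK - ee) +
      K * Λ0 p 1 * (s * τu - s * s * tv) * ee - K * Λ0 p 1 * tv * ss
  rw [hu, hv]
  ring

end Chord

end Paraboloid

/-! ### Bianchi's Bäcklund transformation -/

theorem mainTheorem2
    (ε a₁ a₂ z : ℝ) (hε : ε = 1 ∨ ε = -1)
    (hz : 0 < z) (hza : z < a₁) (ha₂ : a₂ < 0) (ha : a₁⁻¹ - a₂⁻¹ = 1)
    (U : Set (ℝ × ℝ)) (hU : IsOpen U) (hsc : SimplyConnectedSpace U)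
    (x0 x1 : ℝ × ℝ → Fin 3 → ℝ) (V0 V1 : ℝ × ℝ → Fin 2 → ℝ)
    (θ0 : ℝ × ℝ → ℝ) (Λ0 : ℝ × ℝ → Fin 2 → ℝ)
    (hseed : Paraboloid.IsDeformation ε a₁ a₂ U x0 V0)
    (hiso : Paraboloid.IsIsothermicConjugate ε a₁ a₂ U x0 V0)
    (hangle : Paraboloid.IsAngleData ε a₁ a₂ U x0 V0 θ0 Λ0)
    (hleaf : Paraboloid.IsLeaf ε a₁ a₂ z U x0 V0 x1 V1) :
    -- the seed is a leaf of the leaf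
    Paraboloid.IsLeaf ε a₁ a₂ z U x1 V1 x0 V0 ∧
    -- the common isothermic-conjugate system is preserved
    Paraboloid.IsIsothermicConjugate ε a₁ a₂ U x1 V1 ∧
    (∃ (θ1 : ℝ × ℝ → ℝ) (Λ1 : ℝ × ℝ → Fin 2 → ℝ),
      Paraboloid.IsAngleData ε a₁ a₂ U x1 V1 θ1 Λ1) ∧
    ∃ ε₁ : ℝ, (ε₁ = 1 ∨ ε₁ = -1) ∧
      Paraboloid.HasLeafSign ε a₁ a₂ z ε₁ U x0 V0 V1 ∧
      Paraboloid.HasLeafSign ε a₁ a₂ z ε₁ U x1 V1 V0 ∧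
      ∀ (θ1 : ℝ × ℝ → ℝ) (Λ1 : ℝ × ℝ → Fin 2 → ℝ),
        Paraboloid.IsAngleData ε a₁ a₂ U x1 V1 θ1 Λ1 →
        Paraboloid.HasSecondForm ε a₁ a₂ U x0 V0 Λ0 ∧
        Paraboloid.HasSecondForm ε a₁ a₂ U x1 V1 Λ1 ∧
        Paraboloid.SolvesLinearSystem ε a₁ a₂ U V0 θ0 Λ0 ∧
        Paraboloid.SolvesLinearSystem ε a₁ a₂ U V1 θ1 Λ1 ∧
        ∃ ε₁' : ℝ, (ε₁' = 1 ∨ ε₁' = -1) ∧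
          -- the algebraic formula, and its inverse with `ε₀ = ε₁`, `ε₀' = -ε₁'`
          Paraboloid.IsAlgebraicTransform ε a₁ a₂ z ε₁ ε₁' U V0 θ0 Λ0 V1 θ1 Λ1 ∧
          Paraboloid.IsAlgebraicTransform ε a₁ a₂ z ε₁ (-ε₁') U V1 θ1 Λ1 V0 θ0 Λ0 ∧
          -- the Bäcklund transformation in matrix form, in both directions
          (∀ p ∈ U, Paraboloid.IsMatrixBacklundAt ε ε₁
            (Paraboloid.matDz a₁ a₂ z ε₁') θ0 θ1 p) ∧
          (∀ p ∈ U, Paraboloid.IsMatrixBacklundAt ε ε₁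
            (Paraboloid.matDz a₁ a₂ z (-ε₁')) θ1 θ0 p) ∧
          -- the classical Bäcklund transformation
          Paraboloid.SolvesGordon ε U θ0 ∧
          Paraboloid.SolvesGordon ε U (fun q => ε₁ * θ1 q) ∧
          ∃ σ₁ : ℝ, σ₁ ≠ 0 ∧
            Matrix.diagonal ![(σ₁ - σ₁⁻¹) / 2, (σ₁ + σ₁⁻¹) / 2] =
              -(Paraboloid.matDz a₁ a₂ z ε₁' * Paraboloid.signMat ε₁) ∧
            (∀ p ∈ U, Paraboloid.IsBacklundAt ε σ₁ θ0 (fun q => ε₁ * θ1 q) p) ∧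
            (∀ p ∈ U, Paraboloid.IsBacklundAt ε (-σ₁) (fun q => ε₁ * θ1 q) θ0 p) ∧
            ∀ (φ0 φ1 : ℝ × ℝ → ℝ) (p : ℝ × ℝ),
              DifferentiableAt ℝ φ0 p → DifferentiableAt ℝ φ1 p →
              (Paraboloid.IsMatrixBacklundAt ε ε₁
                  (Paraboloid.matDz a₁ a₂ z ε₁') φ0 φ1 p ↔
                Paraboloid.IsBacklundAt ε σ₁ φ0 (fun q => ε₁ * φ1 q) p) := by
  have ha₁ : 0 < a₁ := hz.trans hza
  have hc : IsPreconnected U := (isConnected_iff_connectedSpace.2 inferInstance).isPreconnected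
  obtain ⟨s, hs, hN⟩ := hleaf.exists_sign hε hz hza ha₂ hU hc hseed
  have hII := Paraboloid.hasSecondForm_of_isothermic hε ha₁ ha₂ hU hseed hiso hangle
  have hleaf' := hleaf.symm hε hz hza ha₂ hU hseed hN
  have hdef := hleaf.deformation
  have hiso' := hleaf.isIsothermicConjugate hε hs hz hza ha₂ hU hseed hangle hII hN
  refine ⟨hleaf', hiso', hleaf.exists_angleData hε hs hz hza ha₂ hU hsc hseed hangle hII hN, s, hs,
    hleaf.hasLeafSign hU hseed hN, hleaf'.hasLeafSign hU hdef
      (hleaf.hasNormalComponent_symm hε hz hza ha₂ hU hseed hN), fun θ1 Λ1 hA1 => ?_⟩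
  obtain ⟨s', hs', hch, hch'⟩ :=
    hleaf.exists_chord_eq hε hs hz hza ha₂ hU hc hseed hangle hII hN hA1
  have hns' : -s' = 1 ∨ -s' = -1 := by rcases hs' with rfl | rfl <;> simp
  have hB (p : ℝ × ℝ) (hp : p ∈ U) : Paraboloid.IsMatrixBacklundAt ε s
      (Paraboloid.matDz a₁ a₂ z s') θ0 θ1 p :=
    Paraboloid.isMatrixBacklundAt_of_chord hε hs hs' hz hU hseed.smooth_V hdef.smooth_V hangle hA1
      hch hp
  have ss := Paraboloid.eps_mul_self hs
  have hD := Paraboloid.matDz_eq a₁ a₂ z s'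
  have hd : ((s' * √z)⁻¹ * √(1 - z * a₂⁻¹)) ^ 2 - ((s' * √z)⁻¹ * √(1 - z * a₁⁻¹)) ^ 2 = 1 := by
    obtain ⟨q1, q2⟩ := Paraboloid.sqrtR_sq hz hza ha₂
    have hk : (s' * √z) ^ 2 = z := by
      rw [mul_pow, Real.sq_sqrt hz.le, pow_two, Paraboloid.eps_mul_self hs', one_mul]
    rw [mul_pow, mul_pow, inv_pow, hk, q1, q2]
    linear_combination z * z⁻¹ * ha + mul_inv_cancel₀ hz.ne'
  generalize (s' * √z)⁻¹ * √(1 - z * a₁⁻¹) = d₁ at hD hd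
  generalize (s' * √z)⁻¹ * √(1 - z * a₂⁻¹) = d₂ at hD hd
  -- `(σ - σ⁻¹) / 2 = -d₁` and `(σ + σ⁻¹) / 2 = s d₂`, where `d₂² - d₁² = 1`
  have hσ : (s * d₂ - d₁) * (s * d₂ + d₁) = 1 := by linear_combination d₂ ^ 2 * ss + hd
  have hσ' : (s * d₂ - d₁)⁻¹ = s * d₂ + d₁ := inv_eq_of_mul_eq_one_right hσ
  have hσ₁ : ((s * d₂ - d₁) - (s * d₂ - d₁)⁻¹) / 2 = -d₁ := by rw [hσ']; ring
  have hσ₂ : ((s * d₂ - d₁) + (s * d₂ - d₁)⁻¹) / 2 = s * d₂ := by rw [hσ']; ring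
  have hiff (φ0 φ1 : ℝ × ℝ → ℝ) (p : ℝ × ℝ) (h0 : DifferentiableAt ℝ φ0 p)
      (h1 : DifferentiableAt ℝ φ1 p) : Paraboloid.IsMatrixBacklundAt ε s
        (Paraboloid.matDz a₁ a₂ z s') φ0 φ1 p ↔
      Paraboloid.IsBacklundAt ε (s * d₂ - d₁) φ0 (fun q => s * φ1 q) p := by
    rw [hD]
    exact Paraboloid.isMatrixBacklundAt_iff_isBacklundAt hε hs h0 h1 hσ₁ hσ₂
  have hcl (p : ℝ × ℝ) (hp : p ∈ U) :
      Paraboloid.IsBacklundAt ε (s * d₂ - d₁) θ0 (fun q => s * θ1 q) p :=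
    (hiff θ0 θ1 p (Paraboloid.differentiableAt_of_smoothOn hU hangle.smooth_θ hp)
      (Paraboloid.differentiableAt_of_smoothOn hU hA1.smooth_θ hp)).1 (hB p hp)
  refine ⟨hII, Paraboloid.hasSecondForm_of_isothermic hε ha₁ ha₂ hU hdef hiso' hA1,
    hangle.solvesLinearSystem hε hU hseed.smooth_V, hA1.solvesLinearSystem hε hU hdef.smooth_V,
    s', hs', Paraboloid.isAlgebraicTransform_of_chord hε hs hs' hz hza ha₂ hch hch',
    Paraboloid.isAlgebraicTransform_of_chord hε hs hns' hz hza ha₂ hch' (by rwa [neg_neg]), hB,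
    fun p hp => Paraboloid.isMatrixBacklundAt_of_chord hε hs hns' hz hU hdef.smooth_V
      hseed.smooth_V hA1 hangle hch' hp,
    hangle.solvesGordon hε ha hU hseed.smooth_V,
    (hA1.solvesGordon hε ha hU hdef.smooth_V).sign_mul hs,
    s * d₂ - d₁, left_ne_zero_of_mul_eq_one hσ, ?_, hcl, fun p hp => (hcl p hp).symm, hiff⟩
  rw [hD, Paraboloid.signMat, hσ₁, hσ₂, Matrix.diagonal_mul_diagonal]
  ext i j
  fin_cases i <;> fin_cases j <;> simp [mul_comm]
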